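/- Let $k$ be a commutative coherent ring (every finitely generated ideal is finitely presented). **Forms on simplices.** Let $\mathcal D^*(x)$ be the complex of free $k$-modules with basis $1$, $Y_s$ ($s\in\mathbf Z$) in degree $0$ and $\omega_s$ ($s\in\mathbf Z$) in degree $1$, with $d1=0$, $dY_s=-\omega_s$; here $Y_s$ is the function on $\mathbf Z$ equal to $1$ at the integers $\le s$ and to $0$ elsewhere, and $\omega_s$ is the Dirac function at $s$. The singular support of $1$ is empty, that of $Y_s$ and $\omega_s$ is $\{s\}$; the singular support of a word $f_0\otimes\dots\otimes f_r$ in these basis elements is the union of those of the $f_i$. Let $\mathcal D^*(\Delta_r)$ be the quotient of $\mathcal D^*(x_0)\otimes\dots\otimes\mathcal D^*(x_r)$ by the span of the words in which no letter is $1$ (the forms which vanish when some $x_i=+\infty$). It is a simplicial complex of $k$-modules in $r$: faces put $x_i=-\infty$ ($1\mapsto1$, $Y_s\mapsto 1$, $\omega_s\mapsto 0$), degeneracies double a variable ($1\mapsto 1\otimes 1$, $Y_s\mapsto Y_s\otimes Y_s$, $\omega_s\mapsto\omega_s\otimes Y_s+Y_s\otimes\omega_s$). For $T\subset\mathbf Z$,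 ${}_T\mathcal D^*(\Delta_r)$ is the span of the words with singular support in $T$, and ${}_T\mathcal D^*(\Delta_r)\,\overline\otimes\,{}_T\mathcal D^*(\Delta_s)\subset{}_T\mathcal D^*(\Delta_r)\otimes{}_T\mathcal D^*(\Delta_s)$ is the span of the $\omega\otimes\theta$ with $\omega,\theta$ words with disjoint singular supports in $T$. **Coproducts.** For a cosimplicial $k$-module $C$ and a simplicial $k$-module $B$, with normalized modules $\overline C^p$ (the quotient of $C^p$ by the images of all cofaces but the last) and $\overline B_p$ (the quotient of $B_p$ by the degenerate elements), $C\,\Delta\,B$ is the module of the families $(\omega_p)\in\prod_p C^p\otimes B_p$ such that $(u_*\otimes1)\omega_p=(1\otimes u^*)\omega_{p'}$ for every nondecreasing $u:[p]\to[p']$ and such that the image of $\omega_p$ in $\overline C^p\otimes\overline B_p$ is zero for almost all $p$. The coproduct of a bicosimplicial and a bisimplicial module is defined in the same way. For cosimplicial $k$-modules $M,N$ and finite $S\subset\mathbf Z$ put $${}_S\mathcal D^*(M)=M\,\Delta\,{}_S\mathcal D^*(\Delta_\bullet),$$ $$G_S(M,N)=[M\otimes N]\,\Delta\,[{}_S\mathcal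 D^*(\Delta_\bullet)\otimes{}_S\mathcal D^*(\Delta_\bullet)],$$ $$F_S(M,N)={}_S\mathcal D^*(M)\,\overline\otimes\,{}_S\mathcal D^*(N)=[M\otimes N]\,\Delta\,[{}_S\mathcal D^*(\Delta_\bullet)\,\overline\otimes\,{}_S\mathcal D^*(\Delta_\bullet)]\subset G_S(M,N);$$ for infinite $S$, take the direct limit over the finite subsets of $S$. These are cochain complexes, graded by the total degree of forms. There is a canonical map ${}_S\mathcal D^*(M)\otimes{}_S\mathcal D^*(N)\to G_S(M,N)$, $x\otimes y\mapsto(x_p\otimes y_q)_{p,q}$. Write $\mathcal D^*={}_{\mathbf Z}\mathcal D^*$, and for a simplicial set $X$ write ${}_S\mathcal D^*(X)={}_S\mathcal D^*(C^\bullet(X))$ with $C^p(X)=k^{X_p}$. **Theorem.** Let $m,n\ge0$ be integers and let $S\subset\mathbf Z$ satisfy $\mathrm{card}(S)>m+n+4$. 1. Let $M$ and $N$ be flat cosimplicial $k$-modules (each $M^p$ and $N^p$ is flat) whose normalized complexes vanish in degrees $>m$ and $>n$ respectively. Then the canonical map ${}_S\mathcal D^*(M)\otimes{}_S\mathcal D^*(N)\to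 G_S(M,N)$ is an isomorphism, and, under this identification, the inclusion $${}_S\mathcal D^*(M)\,\overline\otimes\,{}_S\mathcal D^*(N)\longrightarrow{}_S\mathcal D^*(M)\otimes{}_S\mathcal D^*(N)$$ is a quasi-isomorphism. 2. In particular, let $X$ and $Y$ be simplicial sets of dimension $\le m$ and $\le n$ respectively. Then the inclusion ${}_S\mathcal D^*(X)\,\overline\otimes\,{}_S\mathcal D^*(Y)\to{}_S\mathcal D^*(X)\otimes{}_S\mathcal D^*(Y)$ and both of the inclusions $${}_S\mathcal D^*(X)\,\overline\otimes\,{}_S\mathcal D^*(Y)\longrightarrow\mathcal D^*(X)\,\overline\otimes\,\mathcal D^*(Y)\longrightarrow\mathcal D^*(X)\otimes\mathcal D^*(Y)$$ are quasi-isomorphisms (the tensor products being identified with $G_S(C^\bullet(X),C^\bullet(Y))$ and $G_{\mathbf Z}(C^\bullet(X),C^\bullet(Y))$). -/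

import Mathlib

open scoped TensorProduct

universe u v w

noncomputable section

namespace QuasiComm

/-- The standard basis of the module `D*(x)` of forms on the affine line: the constant function `1`,
the Heaviside function `Y_s` (equal to `1` at the integers `≤ s` and to `0` elsewhere), of degree
`0`, and the Dirac function `ω_s` at `s`, of degree `1`. The differential is `d 1 = 0`,
`d Y_s = -ω_s`, `d ω_s = 0`. -/
inductive Letter : Type
  | one : Letter
  | heaviside (s : ℤ) : Letter
  | dirac (s : ℤ) : Letter

namespace Letter

def isDirac : Letter → Prop
  | dirac _ => True
  | _ => False

def isHeaviside : Letter → Prop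
  | heaviside _ => True
  | _ => False

/-- Replaces `Y_s` by `ω_s`. -/
def toDirac : Letter → Letter
  | heaviside s => dirac s
  | l => l

/-- Replaces `ω_s` by `Y_s`. -/
def toHeaviside : Letter → Letter
  | dirac s => heaviside s
  | l => l

/-- The singular support of a letter. -/
def support : Letter → Set ℤ
  | one => ∅
  | heaviside s => {s}
  | dirac s => {s}

end Letter

/-- The words `f_0 ⊗ ... ⊗ f_p`, which form a basis of `D*(x_0, ..., x_p) = D*(x_0) ⊗ ... ⊗ D*(x_p)`. -/
abbrev Word (p : ℕ) : Type := Fin (p + 1) → Letter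

namespace Word

open scoped Classical in
def diracs {p : ℕ} (w : Word p) : Finset (Fin (p + 1)) :=
  Finset.univ.filter fun i => (w i).isDirac

open scoped Classical in
def heavisides {p : ℕ} (w : Word p) : Finset (Fin (p + 1)) :=
  Finset.univ.filter fun i => (w i).isHeaviside

/-- The degree of a word as a differential form. -/
def degree {p : ℕ} (w : Word p) : ℕ := w.diracs.card

/-- The singular support of a word: the union of the singular supports of its letters. -/
def support {p : ℕ} (w : Word p) : Set ℤ := ⋃ i, (w i).support

/-- The number of letters of degree one in front of the `i`-th letter (for the Koszul sign). -/
def diracBefore {p : ℕ} (w : Word p) (i : Fin (p + 1)) : ℕ :=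
  (w.diracs.filter fun j => j < i).card

/-- Replaces the Heaviside letter in position `i` by the Dirac letter at the same point. -/
def diff {p : ℕ} (w : Word p) (i : Fin (p + 1)) : Word p :=
  Function.update w i (w i).toDirac

/-- The word in `p + 1` variables whose `i`-th letter is the `u i`-th letter of `w`, where the Dirac
letters outside `A` are replaced by Heaviside letters. -/
def spread {p n : ℕ} (u : Fin (p + 1) →o Fin (n + 1)) (w : Word n)
    (A : Finset (Fin (p + 1))) : Word p :=
  open scoped Classical in
  fun i => if i ∈ A then w (u i) else (w (u i)).toHeaviside

open scoped Classical in
/-- The sets of positions that contain exactly one element over each Dirac letter of `w`, and no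
other element. -/
def sections {p n : ℕ} (u : Fin (p + 1) →o Fin (n + 1)) (w : Word n) :
    Finset (Finset (Fin (p + 1))) :=
  Finset.univ.filter fun A => Set.BijOn u (A : Set (Fin (p + 1))) (w.diracs : Set (Fin (n + 1)))

end Word

section Forms

variable (k : Type u) [CommRing k]

/-- The module `D*(x_0, ..., x_p)` of forms on the cube, free on the words. -/
abbrev CubeForm (p : ℕ) : Type _ := Word p →₀ k

/-- The differential of the graded tensor product `D*(x_0) ⊗ ... ⊗ D*(x_p)`. -/
def cubeD (p : ℕ) : CubeForm k p →ₗ[k] CubeForm k p :=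
  Finsupp.linearCombination k fun w : Word p =>
    ∑ i ∈ w.heavisides, Finsupp.single (w.diff i) (-(-1 : k) ^ w.diracBefore i)

/-- The map `D*(x_0, ..., x_n) → D*(x_0, ..., x_p)` induced by a nondecreasing map
`u : [p] → [n]`. It is the tensor product, over the variables `x_j`, of the iterations
`D*(x_j) → ⨂_{u i = j} D*(x_i)` of the coproduct
`1 ↦ 1 ⊗ 1`, `Y_s ↦ Y_s ⊗ Y_s`, `ω_s ↦ ω_s ⊗ Y_s + Y_s ⊗ ω_s`
(a degeneracy repeats a variable) and of the counit `1 ↦ 1`, `Y_s ↦ 1`, `ω_s ↦ 0`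
(a face puts `x_j = -∞`). -/
def cubePull {p n : ℕ} (u : Fin (p + 1) →o Fin (n + 1)) : CubeForm k n →ₗ[k] CubeForm k p :=
  Finsupp.linearCombination k fun w : Word n =>
    ∑ A ∈ w.sections u, Finsupp.single (w.spread u A) (1 : k)

variable {k}

theorem cubeD_single {p : ℕ} (w : Word p) (c : k) : cubeD k p (Finsupp.single w c) =
    ∑ i ∈ w.heavisides, Finsupp.single (w.diff i) (c * -(-1 : k) ^ w.diracBefore i) := by
  simp [cubeD, Finset.smul_sum]

theorem cubePull_single {p n : ℕ} (u : Fin (p + 1) →o Fin (n + 1)) (w : Word n) (c : k) :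
    cubePull k u (Finsupp.single w c) =
      ∑ A ∈ w.sections u, Finsupp.single (w.spread u A) c := by
  simp [cubePull, Finset.smul_sum]

theorem mem_diracs {p : ℕ} {w : Word p} {i : Fin (p + 1)} :
    i ∈ w.diracs ↔ (w i).isDirac := by simp [Word.diracs]

theorem mem_heavisides {p : ℕ} {w : Word p} {i : Fin (p + 1)} :
    i ∈ w.heavisides ↔ (w i).isHeaviside := by simp [Word.heavisides]

theorem diracs_diff {p : ℕ} {w : Word p} {i : Fin (p + 1)} (h : i ∈ w.heavisides) :
    (w.diff i).diracs = insert i w.diracs := by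
  ext j
  rw [mem_heavisides] at h
  rw [Finset.mem_insert, mem_diracs, mem_diracs]
  by_cases hj : j = i
  · subst hj
    cases hw : w j <;> simp_all [Word.diff, Letter.isHeaviside, Letter.toDirac, Letter.isDirac]
  · simp [Word.diff, hj]

theorem not_mem_diracs {p : ℕ} {w : Word p} {i : Fin (p + 1)} (h : i ∈ w.heavisides) :
    i ∉ w.diracs := by
  rw [mem_heavisides] at h
  rw [mem_diracs]
  cases hw : w i <;> simp_all [Letter.isHeaviside, Letter.isDirac]

theorem mem_heavisides_diff {p : ℕ} {w : Word p} {i j : Fin (p + 1)} (h : i ∈ w.heavisides) :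
    j ∈ (w.diff i).heavisides ↔ j ∈ w.heavisides ∧ j ≠ i := by
  rw [mem_heavisides] at *
  rw [mem_heavisides]
  by_cases hj : j = i
  · subst hj
    cases hw : w j <;> simp_all [Word.diff, Letter.isHeaviside, Letter.toDirac]
  · simp [Word.diff, hj]

theorem diff_comm {p : ℕ} (w : Word p) {i j : Fin (p + 1)} (h : i ≠ j) :
    (w.diff i).diff j = (w.diff j).diff i := by
  unfold Word.diff
  rw [Function.update_of_ne h.symm, Function.update_of_ne h, Function.update_comm h]

theorem diracBefore_diff {p : ℕ} {w : Word p} {i j : Fin (p + 1)} (h : i ∈ w.heavisides) :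
    (w.diff i).diracBefore j = w.diracBefore j + if i < j then 1 else 0 := by
  unfold Word.diracBefore
  rw [diracs_diff h, Finset.filter_insert]
  split_ifs
  · rw [Finset.card_insert_of_notMem]
    simp [not_mem_diracs h]
  · rfl

theorem cubeD_comp_self (p : ℕ) : cubeD k p ∘ₗ cubeD k p = 0 := by
  refine Finsupp.lhom_ext fun w c => ?_
  rw [LinearMap.comp_apply, cubeD_single, map_sum]
  simp only [cubeD_single, LinearMap.zero_apply]
  rw [Finset.sum_sigma']
  refine Finset.sum_involution (fun x _ => ⟨x.2, x.1⟩) ?_ ?_ ?_ ?_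
  · rintro ⟨i, j⟩ hx
    simp only [Finset.mem_sigma] at hx
    obtain ⟨hi, hj⟩ := hx
    rw [mem_heavisides_diff hi] at hj
    simp only
    rw [diff_comm w hj.2, ← Finsupp.single_add, diracBefore_diff hi, diracBefore_diff hj.1]
    rw [Finsupp.single_eq_zero]
    rcases lt_or_gt_of_ne hj.2 with h | h
    · simp [h, h.not_gt, pow_succ]; ring
    · simp [h, h.not_gt, pow_succ]; ring
  · rintro ⟨i, j⟩ hx _ h
    simp only [Finset.mem_sigma] at hx
    rw [mem_heavisides_diff hx.1] at hx
    simp only [Sigma.mk.injEq] at h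
    exact hx.2.2 h.1
  · rintro ⟨i, j⟩ hx
    simp only [Finset.mem_sigma] at hx ⊢
    rw [mem_heavisides_diff hx.1] at hx
    rw [mem_heavisides_diff hx.2.1]
    exact ⟨hx.2.1, hx.1, hx.2.2.symm⟩
  · rintro ⟨i, j⟩ hx
    rfl

theorem mem_sections {p n : ℕ} {u : Fin (p + 1) →o Fin (n + 1)} {w : Word n}
    {A : Finset (Fin (p + 1))} : A ∈ w.sections u ↔
      Set.BijOn u (A : Set (Fin (p + 1))) (w.diracs : Set (Fin (n + 1))) := by
  simp [Word.sections]

theorem diracs_spread {p n : ℕ} {u : Fin (p + 1) →o Fin (n + 1)} {w : Word n}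
    {A : Finset (Fin (p + 1))} (hA : A ∈ w.sections u) : (w.spread u A).diracs = A := by
  ext i
  rw [mem_sections] at hA
  rw [mem_diracs]
  by_cases hi : i ∈ A
  · have := hA.mapsTo hi
    simp only [Finset.mem_coe, mem_diracs] at this
    simp [Word.spread, hi, this]
  · simp only [Word.spread, hi, if_false, iff_false]
    cases w (u i) <;> simp [Letter.toHeaviside, Letter.isDirac]

theorem mem_heavisides_spread {p n : ℕ} {u : Fin (p + 1) →o Fin (n + 1)} {w : Word n}
    {A : Finset (Fin (p + 1))} (hA : A ∈ w.sections u) {i : Fin (p + 1)} :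
    i ∈ (w.spread u A).heavisides ↔ u i ∈ w.heavisides ∨ (u i ∈ w.diracs ∧ i ∉ A) := by
  rw [mem_sections] at hA
  rw [mem_heavisides, mem_heavisides, mem_diracs]
  by_cases hi : i ∈ A
  · have := hA.mapsTo hi
    simp only [Finset.mem_coe, mem_diracs] at this
    simp [Word.spread, hi]
  · simp only [Word.spread, hi, if_false, not_false_eq_true, and_true]
    cases w (u i) <;> simp [Letter.toHeaviside, Letter.isDirac, Letter.isHeaviside]

theorem diff_spread_dirac {p n : ℕ} {u : Fin (p + 1) →o Fin (n + 1)} {w : Word n}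
    {A : Finset (Fin (p + 1))} {i : Fin (p + 1)} (hi : u i ∈ w.diracs) (hiA : i ∉ A) :
    (w.spread u A).diff i = w.spread u (insert i A) := by
  rw [mem_diracs] at hi
  funext j
  by_cases hj : j = i
  · subst hj
    cases hw : w (u j) <;>
      simp_all [Word.diff, Word.spread, Letter.toHeaviside, Letter.toDirac, Letter.isDirac]
  · simp [Word.diff, Word.spread, hj]

theorem diff_spread_heaviside {p n : ℕ} {u : Fin (p + 1) →o Fin (n + 1)} {w : Word n}
    {A : Finset (Fin (p + 1))} {i : Fin (p + 1)} (hA : A ∈ w.sections u)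
    (hi : u i ∈ w.heavisides) :
    (w.spread u A).diff i = (w.diff (u i)).spread u (insert i A) := by
  have hd := not_mem_diracs hi
  rw [mem_heavisides] at hi
  rw [mem_sections] at hA
  funext j
  have key : u j = u i → j ∉ A := fun h hj => hd (h ▸ hA.mapsTo hj)
  by_cases hj : j = i
  · subst hj
    have := key rfl
    cases hw : w (u j) <;>
      simp_all [Word.diff, Word.spread, Letter.toHeaviside, Letter.toDirac, Letter.isHeaviside]
  · by_cases hu : u j = u i
    · have := key hu
      cases hw : w (u i) <;>
      simp_all [Word.diff, Word.spread, Letter.toHeaviside, Letter.toDirac, Letter.isHeaviside]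
    · simp [Word.diff, Word.spread, hj, hu]

theorem diracBefore_spread {p n : ℕ} {u : Fin (p + 1) →o Fin (n + 1)} {w : Word n}
    {A : Finset (Fin (p + 1))} {i : Fin (p + 1)} (hA : A ∈ w.sections u)
    (hi : u i ∈ w.heavisides) :
    (w.spread u A).diracBefore i = w.diracBefore (u i) := by
  have hd := not_mem_diracs hi
  unfold Word.diracBefore
  rw [diracs_spread hA]
  rw [mem_sections] at hA
  have hne : ∀ a ∈ A, u a ≠ u i := fun a ha h => hd (h ▸ hA.mapsTo ha)
  refine Finset.card_bij (fun a _ => u a) ?_ ?_ ?_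
  · intro a ha
    simp only [Finset.mem_filter] at ha ⊢
    exact ⟨hA.mapsTo ha.1, lt_of_le_of_ne (u.monotone ha.2.le) (hne a ha.1)⟩
  · intro a ha b hb h
    simp only [Finset.mem_filter] at ha hb
    exact hA.injOn ha.1 hb.1 h
  · intro b hb
    simp only [Finset.mem_filter] at hb
    obtain ⟨a, ha, rfl⟩ := hA.surjOn hb.1
    refine ⟨a, ?_, rfl⟩
    simp only [Finset.mem_filter]
    refine ⟨ha, ?_⟩
    by_contra h
    exact absurd (u.monotone (not_lt.1 h)) (not_le.2 hb.2)

theorem insert_mem_sections {p n : ℕ} {u : Fin (p + 1) →o Fin (n + 1)} {w : Word n}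
    {A : Finset (Fin (p + 1))} {i : Fin (p + 1)} (hA : A ∈ w.sections u)
    (hi : u i ∈ w.heavisides) : insert i A ∈ (w.diff (u i)).sections u := by
  rw [mem_sections] at *
  rw [diracs_diff hi, Finset.coe_insert, Finset.coe_insert]
  exact hA.insert (by simpa using not_mem_diracs hi)

theorem cubeD_comp_cubePull {p n : ℕ} (u : Fin (p + 1) →o Fin (n + 1)) :
    cubeD k p ∘ₗ cubePull k u = cubePull k u ∘ₗ cubeD k n := by
  classical
  refine Finsupp.lhom_ext fun w c => ?_
  rw [LinearMap.comp_apply, LinearMap.comp_apply, cubeD_single, cubePull_single, map_sum, map_sum]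
  simp only [cubeD_single, cubePull_single]
  rw [Finset.sum_sigma', Finset.sum_sigma']
  rw [← Finset.sum_filter_add_sum_filter_not _ (fun x => u x.2 ∈ w.heavisides)]
  have hzero : ∑ x ∈ ((w.sections u).sigma fun A => (w.spread u A).heavisides) with
      ¬ u x.2 ∈ w.heavisides, Finsupp.single ((w.spread u x.1).diff x.2)
        (c * -(-1 : k) ^ (w.spread u x.1).diracBefore x.2) = 0 := by
    -- the terms with two Dirac letters in the same fibre cancel in pairs
    have hex : ∀ x ∈ ((w.sections u).sigma fun A => (w.spread u A).heavisides).filter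
        (fun x => ¬ u x.2 ∈ w.heavisides), x.1 ∈ w.sections u ∧ u x.2 ∈ w.diracs ∧ x.2 ∉ x.1 ∧
          ∃ a, a ∈ x.1 ∧ u a = u x.2 := by
      rintro ⟨A, i⟩ hx
      simp only [Finset.mem_filter, Finset.mem_sigma] at hx
      obtain ⟨⟨hA, hi⟩, hn⟩ := hx
      rw [mem_heavisides_spread hA] at hi
      have hi' := hi.resolve_left hn
      have hA' := mem_sections.1 hA
      obtain ⟨a, ha, hai⟩ := hA'.surjOn hi'.1
      exact ⟨hA, hi'.1, hi'.2, a, ha, hai⟩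
    choose! h1 h2 h3 a ha hua using hex
    -- the new section
    have hB : ∀ x ∈ ((w.sections u).sigma fun A => (w.spread u A).heavisides).filter
        (fun x => ¬ u x.2 ∈ w.heavisides),
        (insert x.2 (x.1.erase (a x))) ∈ w.sections u := by
      intro x hx
      have hA := mem_sections.1 (h1 x hx)
      rw [mem_sections]
      refine ⟨?_, ?_, ?_⟩
      · intro y hy
        simp only [Finset.coe_insert, Finset.coe_erase, Set.mem_insert_iff, Set.mem_sdiff] at hy
        rcases hy with rfl | hy
        · exact h2 x hx
        · exact hA.mapsTo hy.1
      · have hinj : ∀ y ∈ x.1, y ≠ a x → u y ≠ u x.2 := by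
          intro y hy hya h
          exact hya (hA.injOn hy (ha x hx) (h.trans (hua x hx).symm))
        intro y hy z hz hyz
        simp only [Finset.coe_insert, Finset.coe_erase, Set.mem_insert_iff, Set.mem_sdiff,
          Finset.mem_coe, Set.mem_singleton_iff] at hy hz
        rcases hy with rfl | hy <;> rcases hz with rfl | hz
        · rfl
        · exact absurd hyz.symm (hinj z hz.1 hz.2)
        · exact absurd hyz (hinj y hy.1 hy.2)
        · exact hA.injOn hy.1 hz.1 hyz
      · intro b hb
        obtain ⟨y, hy, rfl⟩ := hA.surjOn hb
        by_cases hya : y = a x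
        · exact ⟨x.2, by simp, by rw [hya, hua x hx]⟩
        · exact ⟨y, by simp [hya, Finset.mem_coe.1 hy], rfl⟩
    have hmem : ∀ x ∈ ((w.sections u).sigma fun A => (w.spread u A).heavisides).filter
        (fun x => ¬ u x.2 ∈ w.heavisides),
        (⟨insert x.2 (x.1.erase (a x)), a x⟩ : Σ _ : Finset (Fin (p + 1)), Fin (p + 1)) ∈
        ((w.sections u).sigma fun A => (w.spread u A).heavisides).filter
        (fun x => ¬ u x.2 ∈ w.heavisides) := by
      intro x hx
      have hne : a x ≠ x.2 := fun h => h3 x hx (h ▸ ha x hx)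
      simp only [Finset.mem_filter, Finset.mem_sigma]
      refine ⟨⟨hB x hx, ?_⟩, ?_⟩
      · rw [mem_heavisides_spread (hB x hx)]
        right
        refine ⟨by rw [hua x hx]; exact h2 x hx, by simp [hne]⟩
      · rw [hua x hx]
        exact fun h => not_mem_diracs h (h2 x hx)
    have haa : ∀ x (hx : x ∈ ((w.sections u).sigma fun A => (w.spread u A).heavisides).filter
        (fun x => ¬ u x.2 ∈ w.heavisides)),
        a ⟨insert x.2 (x.1.erase (a x)), a x⟩ = x.2 := by
      intro x hx
      have hA := mem_sections.1 (hB x hx)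
      refine hA.injOn (ha _ (hmem x hx)) (by simp) ?_
      rw [hua _ (hmem x hx)]
      exact hua x hx
    refine Finset.sum_involution (fun x _ => ⟨insert x.2 (x.1.erase (a x)), a x⟩) ?_ ?_ hmem ?_
    · intro x hx
      have hne : a x ≠ x.2 := fun h => h3 x hx (h ▸ ha x hx)
      have e1 : (w.spread u x.1).diff x.2 = w.spread u (insert x.2 x.1) :=
        diff_spread_dirac (h2 x hx) (h3 x hx)
      have e2 : (w.spread u (insert x.2 (x.1.erase (a x)))).diff (a x)
          = w.spread u (insert x.2 x.1) := by
        rw [diff_spread_dirac (by rw [hua x hx]; exact h2 x hx) (by simp [hne])]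
        congr 1
        ext y
        by_cases hy : y = a x
        · subst hy; simp [ha x hx]
        · simp [hy]
      simp only
      rw [e1, e2, ← Finsupp.single_add, Finsupp.single_eq_zero]
      -- no letter of the section lies strictly between `a x` and `x.2`
      have hA := mem_sections.1 (h1 x hx)
      have hbetween : ∀ y ∈ x.1, y ≠ a x → (y < x.2 ↔ y < a x) := by
        intro y hy hya
        have hyu : u y ≠ u (a x) := fun h => hya (hA.injOn hy (ha x hx) h)
        constructor
        · intro hlt
          by_contra h
          exact hyu (le_antisymm (by rw [hua x hx]; exact u.monotone hlt.le)
            (u.monotone (not_lt.1 h)))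
        · intro hlt
          by_contra h
          exact hyu (le_antisymm (u.monotone hlt.le)
            (by rw [hua x hx]; exact u.monotone (not_lt.1 h)))
      have c1 : (w.spread u x.1).diracBefore x.2 =
          ((x.1.erase (a x)).filter fun j => j < a x).card + if a x < x.2 then 1 else 0 := by
        unfold Word.diracBefore
        rw [diracs_spread (h1 x hx)]
        conv_lhs => rw [← Finset.insert_erase (ha x hx)]
        rw [Finset.filter_insert]
        have : (x.1.erase (a x)).filter (fun j => j < x.2) =
            (x.1.erase (a x)).filter (fun j => j < a x) := by
          refine Finset.filter_congr fun y hy => ?_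
          rw [Finset.mem_erase] at hy
          exact hbetween y hy.2 hy.1
        rw [this]
        split_ifs
        · rw [Finset.card_insert_of_notMem (by simp)]
        · rfl
      have c2 : (w.spread u (insert x.2 (x.1.erase (a x)))).diracBefore (a x) =
          ((x.1.erase (a x)).filter fun j => j < a x).card + if x.2 < a x then 1 else 0 := by
        unfold Word.diracBefore
        rw [diracs_spread (hB x hx), Finset.filter_insert]
        split_ifs
        · rw [Finset.card_insert_of_notMem (by simp [h3 x hx])]
        · rfl
      rw [c1, c2]
      rcases lt_or_gt_of_ne hne with h | h
      · simp [h, h.not_gt, pow_succ]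
      · simp [h, h.not_gt, pow_succ]
    · intro x hx _ h
      have hne : a x ≠ x.2 := fun h => h3 x hx (h ▸ ha x hx)
      exact hne (congrArg Sigma.snd h)
    · intro x hx
      have hne : a x ≠ x.2 := fun h => h3 x hx (h ▸ ha x hx)
      have h5 := haa x hx
      obtain ⟨A, i⟩ := x
      simp only at h5 hne ⊢
      rw [h5]
      congr 1
      have h6 := ha _ hx
      have h7 := h3 _ hx
      simp only at h6 h7
      rw [Finset.erase_insert (by simp [h7]), Finset.insert_erase h6]
  rw [hzero, add_zero]
  refine Finset.sum_bij' (fun x _ => ⟨u x.2, insert x.2 x.1⟩)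
    (fun y _ => ⟨y.2.filter (fun a => u a ≠ y.1),
      if h : ∃ a ∈ y.2, u a = y.1 then h.choose else 0⟩) ?_ ?_ ?_ ?_ ?_
  · rintro ⟨A, i⟩ hx
    simp only [Finset.mem_filter, Finset.mem_sigma] at hx ⊢
    exact ⟨hx.2, insert_mem_sections hx.1.1 hx.2⟩
  · rintro ⟨j, A⟩ hy
    simp only [Finset.mem_sigma] at hy
    obtain ⟨hj, hA⟩ := hy
    have hA' := mem_sections.1 hA
    rw [diracs_diff hj] at hA'
    have hex : ∃ a ∈ A, u a = j := hA'.surjOn (by simp)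
    have hs := hex.choose_spec
    have hsec : A.filter (fun a => u a ≠ j) ∈ w.sections u := by
      rw [mem_sections]
      refine ⟨?_, hA'.injOn.mono fun y hy => (by simpa using hy : y ∈ A ∧ _).1, ?_⟩
      · intro y hy
        simp only [Finset.coe_filter, Set.mem_ofPred_eq] at hy
        have := hA'.mapsTo hy.1
        simpa [hy.2] using this
      · intro b hb
        obtain ⟨y, hy, rfl⟩ := hA'.surjOn (by simp at hb ⊢; exact Or.inr hb)
        refine ⟨y, ?_, rfl⟩
        simp only [Finset.coe_filter, Set.mem_ofPred_eq]
        exact ⟨hy, fun h => not_mem_diracs hj (h ▸ hb)⟩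
    simp only [Finset.mem_filter, Finset.mem_sigma]
    rw [dif_pos hex, hs.2]
    refine ⟨⟨hsec, ?_⟩, hj⟩
    rw [mem_heavisides_spread hsec, hs.2]
    exact Or.inl hj
  · rintro ⟨A, i⟩ hx
    simp only [Finset.mem_filter, Finset.mem_sigma] at hx
    obtain ⟨⟨hA, _⟩, hi⟩ := hx
    have hA' := mem_sections.1 hA
    have hne : ∀ a ∈ A, u a ≠ u i := fun a ha h => not_mem_diracs hi (h ▸ hA'.mapsTo ha)
    have hex : ∃ a ∈ insert i A, u a = u i := ⟨i, by simp, rfl⟩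
    have hs := hex.choose_spec
    have hc : hex.choose = i := by
      rcases Finset.mem_insert.1 hs.1 with h | h
      · exact h
      · exact absurd hs.2 (hne _ h)
    simp only
    rw [dif_pos hex, hc]
    congr 1
    rw [Finset.filter_insert]
    simp only [ne_eq, not_true_eq_false, if_false]
    exact Finset.filter_true_of_mem hne
  · rintro ⟨j, A⟩ hy
    simp only [Finset.mem_sigma] at hy
    obtain ⟨hj, hA⟩ := hy
    have hA' := mem_sections.1 hA
    rw [diracs_diff hj] at hA'
    have hex : ∃ a ∈ A, u a = j := hA'.surjOn (by simp)
    have hs := hex.choose_spec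
    simp only
    rw [dif_pos hex, hs.2]
    congr 1
    ext y
    simp only [Finset.mem_insert, Finset.mem_filter]
    constructor
    · rintro (rfl | h)
      · exact hs.1
      · exact h.1
    · intro h
      by_cases hyj : u y = j
      · exact Or.inl (hA'.injOn h hs.1 (hyj.trans hs.2.symm))
      · exact Or.inr ⟨h, hyj⟩
  · rintro ⟨A, i⟩ hx
    simp only [Finset.mem_filter, Finset.mem_sigma] at hx
    simp only
    rw [diff_spread_heaviside hx.1.1 hx.2, diracBefore_spread hx.1.1 hx.2]


theorem support_diff {p : ℕ} (w : Word p) (i : Fin (p + 1)) : (w.diff i).support = w.support := by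
  have h : ∀ l : Letter, l.toDirac.support = l.support := by rintro (_ | _ | _) <;> rfl
  unfold Word.support
  refine Set.iUnion_congr fun j => ?_
  by_cases hj : j = i
  · subst hj; simp [Word.diff, h]
  · simp [Word.diff, hj]

theorem degree_diff {p : ℕ} {w : Word p} {i : Fin (p + 1)} (h : i ∈ w.heavisides) :
    (w.diff i).degree = w.degree + 1 := by
  unfold Word.degree
  rw [diracs_diff h, Finset.card_insert_of_notMem (not_mem_diracs h)]

theorem degree_spread {p n : ℕ} {u : Fin (p + 1) →o Fin (n + 1)} {w : Word n}
    {A : Finset (Fin (p + 1))} (hA : A ∈ w.sections u) : (w.spread u A).degree = w.degree := by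
  unfold Word.degree
  rw [diracs_spread hA]
  rw [mem_sections] at hA
  rw [← Set.ncard_coe_finset, ← Set.ncard_coe_finset, ← hA.image_eq,
    hA.injOn.ncard_image]

variable (k)

/-- Multiplication by `(-1) ^ degree`. -/
def cubeSign (p : ℕ) : CubeForm k p →ₗ[k] CubeForm k p :=
  Finsupp.linearCombination k fun w : Word p => Finsupp.single w ((-1 : k) ^ w.degree)

/-- The forms on the cube that vanish as soon as one variable is `+∞`: they are spanned by the words
in which every letter is a Heaviside or a Dirac letter, since `1`, `Y_s`, `ω_s` take the values
`1`, `0`, `0` at `+∞`. -/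
def vanishing (p : ℕ) : Submodule k (CubeForm k p) :=
  Submodule.span k {f | ∃ w : Word p, (∀ i, w i ≠ Letter.one) ∧ f = Finsupp.single w 1}

theorem cubeSign_single {p : ℕ} (w : Word p) (c : k) :
    cubeSign k p (Finsupp.single w c) = Finsupp.single w (c * (-1) ^ w.degree) := by
  simp [cubeSign]

theorem single_mem_vanishing {p : ℕ} {w : Word p} (h : ∀ i, w i ≠ Letter.one) (c : k) :
    Finsupp.single w c ∈ vanishing k p := by
  have := (vanishing k p).smul_mem c (Submodule.subset_span ⟨w, h, rfl⟩)
  simpa using this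

theorem vanishing_le_cubeD (p : ℕ) : vanishing k p ≤ (vanishing k p).comap (cubeD k p) := by
  refine Submodule.span_le.2 ?_
  rintro _ ⟨w, hw, rfl⟩
  rw [SetLike.mem_coe, Submodule.mem_comap, cubeD_single]
  refine Submodule.sum_mem _ fun i _ => single_mem_vanishing k (fun j => ?_) _
  have h : ∀ l : Letter, l ≠ Letter.one → l.toDirac ≠ Letter.one := by
    rintro (_ | _ | _) <;> simp [Letter.toDirac]
  by_cases hj : j = i
  · subst hj; simpa [Word.diff] using h _ (hw j)
  · simpa [Word.diff, hj] using hw j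

theorem vanishing_le_cubeSign (p : ℕ) :
    vanishing k p ≤ (vanishing k p).comap (cubeSign k p) := by
  refine Submodule.span_le.2 ?_
  rintro _ ⟨w, hw, rfl⟩
  rw [SetLike.mem_coe, Submodule.mem_comap, cubeSign_single]
  exact single_mem_vanishing k hw _

theorem vanishing_le_cubePull {p n : ℕ} (u : Fin (p + 1) →o Fin (n + 1)) :
    vanishing k n ≤ (vanishing k p).comap (cubePull k u) := by
  refine Submodule.span_le.2 ?_
  rintro _ ⟨w, hw, rfl⟩
  rw [SetLike.mem_coe, Submodule.mem_comap, cubePull_single]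
  refine Submodule.sum_mem _ fun A _ => single_mem_vanishing k (fun j => ?_) _
  have h : ∀ l : Letter, l ≠ Letter.one → l.toHeaviside ≠ Letter.one := by
    rintro (_ | _ | _) <;> simp [Letter.toHeaviside]
  unfold Word.spread
  split_ifs
  · exact hw _
  · exact h _ (hw _)

theorem cubeD_comp_cubeSign (p : ℕ) :
    cubeD k p ∘ₗ cubeSign k p = -(cubeSign k p ∘ₗ cubeD k p) := by
  refine Finsupp.lhom_ext fun w c => ?_
  simp only [LinearMap.comp_apply, LinearMap.neg_apply, cubeSign_single, cubeD_single, map_sum]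
  rw [← Finset.sum_neg_distrib]
  refine Finset.sum_congr rfl fun i hi => ?_
  rw [degree_diff hi, ← Finsupp.single_neg]
  congr 1
  ring

theorem cubeSign_comp_self (p : ℕ) : cubeSign k p ∘ₗ cubeSign k p = LinearMap.id := by
  refine Finsupp.lhom_ext fun w c => ?_
  simp only [LinearMap.comp_apply, cubeSign_single, LinearMap.id_apply]
  rw [mul_assoc, ← mul_pow]
  simp

theorem cubeSign_comp_cubePull {p n : ℕ} (u : Fin (p + 1) →o Fin (n + 1)) :
    cubeSign k p ∘ₗ cubePull k u = cubePull k u ∘ₗ cubeSign k n := by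
  refine Finsupp.lhom_ext fun w c => ?_
  simp only [LinearMap.comp_apply, cubePull_single, cubeSign_single, map_sum]
  refine Finset.sum_congr rfl fun A hA => ?_
  rw [degree_spread hA]

/-- The module `D*(Δ_p)` of forms on the simplex `Δ_p`, given by the equation that one of the
variables `x_0, ..., x_p` is `+∞`. -/
abbrev Form (p : ℕ) : Type _ := CubeForm k p ⧸ vanishing k p

/-- The differential of `D*(Δ_p)`. -/
def formD (p : ℕ) : Form k p →ₗ[k] Form k p :=
  (vanishing k p).mapQ _ (cubeD k p) (vanishing_le_cubeD k p)

/-- Multiplication by `(-1) ^ degree` on `D*(Δ_p)`. -/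
def formSign (p : ℕ) : Form k p →ₗ[k] Form k p :=
  (vanishing k p).mapQ _ (cubeSign k p) (vanishing_le_cubeSign k p)

/-- The simplicial structure of `D*(Δ_•)`. -/
def formPull {p n : ℕ} (u : Fin (p + 1) →o Fin (n + 1)) : Form k n →ₗ[k] Form k p :=
  (vanishing k n).mapQ _ (cubePull k u) (vanishing_le_cubePull k u)

/-- The form on `Δ_p` given by a word. -/
def formOf {p : ℕ} (w : Word p) : Form k p := (vanishing k p).mkQ (Finsupp.single w 1)

theorem formD_formOf {p : ℕ} (w : Word p) : formD k p (formOf k w) =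
    ∑ i ∈ w.heavisides, (-(-1 : k) ^ w.diracBefore i) • formOf k (w.diff i) := by
  have : formD k p (formOf k w) = (vanishing k p).mkQ (cubeD k p (Finsupp.single w 1)) := rfl
  rw [this, cubeD_single, map_sum]
  refine Finset.sum_congr rfl fun i _ => ?_
  rw [formOf, ← map_smul, Finsupp.smul_single, smul_eq_mul, one_mul, mul_one]

theorem formSign_formOf {p : ℕ} (w : Word p) :
    formSign k p (formOf k w) = ((-1 : k) ^ w.degree) • formOf k w := by
  have : formSign k p (formOf k w) = (vanishing k p).mkQ (cubeSign k p (Finsupp.single w 1)) := rfl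
  rw [this, cubeSign_single, formOf, ← map_smul, Finsupp.smul_single, smul_eq_mul, one_mul, mul_one]

theorem formD_comp_self (p : ℕ) : formD k p ∘ₗ formD k p = 0 := by
  refine Submodule.linearMap_qext _ (LinearMap.ext fun x => ?_)
  have := LinearMap.congr_fun (cubeD_comp_self (k := k) p) x
  change (vanishing k p).mkQ (cubeD k p (cubeD k p x)) = 0
  rw [LinearMap.comp_apply] at this
  rw [this]; simp

theorem formD_comp_formSign (p : ℕ) :
    formD k p ∘ₗ formSign k p = -(formSign k p ∘ₗ formD k p) := by
  refine Submodule.linearMap_qext _ (LinearMap.ext fun x => ?_)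
  exact congrArg (vanishing k p).mkQ (LinearMap.congr_fun (cubeD_comp_cubeSign k p) x)

theorem formSign_comp_self (p : ℕ) : formSign k p ∘ₗ formSign k p = LinearMap.id := by
  refine Submodule.linearMap_qext _ (LinearMap.ext fun x => ?_)
  exact congrArg (vanishing k p).mkQ (LinearMap.congr_fun (cubeSign_comp_self k p) x)

theorem formD_comp_formPull {p n : ℕ} (u : Fin (p + 1) →o Fin (n + 1)) :
    formD k p ∘ₗ formPull k u = formPull k u ∘ₗ formD k n := by
  refine Submodule.linearMap_qext _ (LinearMap.ext fun x => ?_)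
  exact congrArg (vanishing k p).mkQ (LinearMap.congr_fun (cubeD_comp_cubePull (k := k) u) x)

theorem formSign_comp_formPull {p n : ℕ} (u : Fin (p + 1) →o Fin (n + 1)) :
    formSign k p ∘ₗ formPull k u = formPull k u ∘ₗ formSign k n := by
  refine Submodule.linearMap_qext _ (LinearMap.ext fun x => ?_)
  exact congrArg (vanishing k p).mkQ (LinearMap.congr_fun (cubeSign_comp_cubePull k u) x)

/-- The submodule of `D*(Δ_p)` spanned by the degenerate elements. -/
def degenerateForms : ∀ p : ℕ, Submodule k (Form k p)
  | 0 => ⊥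
  | p + 1 => ⨆ i : Fin (p + 1), LinearMap.range (formPull k (SimplexCategory.σ i).toOrderHom)

theorem degenerateForms_le_comap (p : ℕ) (f : ∀ p, Form k p →ₗ[k] Form k p)
    (hf : ∀ {p n : ℕ} (u : Fin (p + 1) →o Fin (n + 1)), f p ∘ₗ formPull k u = formPull k u ∘ₗ f n) :
    degenerateForms k p ≤ (degenerateForms k p).comap (f p) := by
  cases p with
  | zero => simp [degenerateForms]
  | succ p =>
    refine iSup_le fun i => ?_
    rintro _ ⟨x, rfl⟩
    rw [Submodule.mem_comap]
    refine Submodule.mem_iSup_of_mem i ⟨f p x, ?_⟩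
    exact (LinearMap.congr_fun (hf (SimplexCategory.σ i).toOrderHom) x).symm

/-- The bisimplicial module `D*(Δ_p) ⊗ D*(Δ_q)`. -/
abbrev BiForm (p q : ℕ) : Type _ := Form k p ⊗[k] Form k q

/-- The differential `d ⊗ 1 + (-1) ^ degree ⊗ d` of `D*(Δ_p) ⊗ D*(Δ_q)`. -/
def biD (p q : ℕ) : BiForm k p q →ₗ[k] BiForm k p q :=
  TensorProduct.map (formD k p) LinearMap.id + TensorProduct.map (formSign k p) (formD k q)

theorem biD_comp_self (p q : ℕ) : biD k p q ∘ₗ biD k p q = 0 := by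
  refine TensorProduct.ext' fun x y => ?_
  have h1 := LinearMap.congr_fun (formD_comp_self k p) x
  have h2 := LinearMap.congr_fun (formD_comp_self k q) y
  have h3 := LinearMap.congr_fun (formD_comp_formSign k p) x
  simp only [LinearMap.comp_apply, LinearMap.zero_apply, LinearMap.neg_apply] at h1 h2 h3
  simp [biD, h1, h2, h3, TensorProduct.neg_tmul]

/-- The bisimplicial structure of `D*(Δ_p) ⊗ D*(Δ_q)`. -/
def biPull {p q p' q' : ℕ} (u : Fin (p + 1) →o Fin (p' + 1)) (v : Fin (q + 1) →o Fin (q' + 1)) :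
    BiForm k p' q' →ₗ[k] BiForm k p q :=
  TensorProduct.map (formPull k u) (formPull k v)

theorem biD_comp_biPull {p q p' q' : ℕ} (u : Fin (p + 1) →o Fin (p' + 1))
    (v : Fin (q + 1) →o Fin (q' + 1)) :
    biD k p q ∘ₗ biPull k u v = biPull k u v ∘ₗ biD k p' q' := by
  refine TensorProduct.ext' fun x y => ?_
  have h1 := LinearMap.congr_fun (formD_comp_formPull k u) x
  have h2 := LinearMap.congr_fun (formD_comp_formPull k v) y
  have h3 := LinearMap.congr_fun (formSign_comp_formPull k u) x
  simp only [LinearMap.comp_apply] at h1 h2 h3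
  simp [biD, biPull, h1, h2, h3]

/-- The part of degree `a` of `_T D*(Δ_p)`: the forms with singular support in `T`. -/
def formsIn (T : Set ℤ) (a p : ℕ) : Submodule k (Form k p) :=
  Submodule.span k {x | ∃ w : Word p, w.support ⊆ T ∧ w.degree = a ∧ x = formOf k w}

/-- The part of total degree `n` of `_T D*(Δ_p) ⊗ _T D*(Δ_q)`. -/
def biFormsIn (T : Set ℤ) (n p q : ℕ) : Submodule k (BiForm k p q) :=
  Submodule.span k {x | ∃ (w : Word p) (w' : Word q), w.support ⊆ T ∧ w'.support ⊆ T ∧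
    w.degree + w'.degree = n ∧ x = formOf k w ⊗ₜ[k] formOf k w'}

/-- The part of total degree `n` of the reduced tensor product of `_T D*(Δ_p)` and `_T D*(Δ_q)`: the
image of the span of the tensor products of two words with disjoint singular supports in `T`. -/
def reducedBiFormsIn (T : Set ℤ) (n p q : ℕ) : Submodule k (BiForm k p q) :=
  Submodule.span k {x | ∃ (w : Word p) (w' : Word q), w.support ⊆ T ∧ w'.support ⊆ T ∧
    Disjoint w.support w'.support ∧
    w.degree + w'.degree = n ∧ x = formOf k w ⊗ₜ[k] formOf k w'}

theorem biD_formOf_tmul_mem {p q : ℕ} (w : Word p) (w' : Word q) (W : Submodule k (BiForm k p q))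
    (h1 : ∀ i ∈ w.heavisides, formOf k (w.diff i) ⊗ₜ[k] formOf k w' ∈ W)
    (h2 : ∀ i ∈ w'.heavisides, formOf k w ⊗ₜ[k] formOf k (w'.diff i) ∈ W) :
    biD k p q (formOf k w ⊗ₜ[k] formOf k w') ∈ W := by
  simp only [biD, LinearMap.add_apply, TensorProduct.map_tmul, LinearMap.id_apply, formD_formOf,
    formSign_formOf, TensorProduct.sum_tmul, TensorProduct.tmul_sum, TensorProduct.smul_tmul',
    TensorProduct.tmul_smul]
  refine W.add_mem (W.sum_mem fun i hi => W.smul_mem _ (h1 i hi))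
    (W.sum_mem fun i hi => W.smul_mem _ (W.smul_mem _ (h2 i hi)))

theorem biFormsIn_le_comap (T : Set ℤ) (n p q : ℕ) :
    biFormsIn k T n p q ≤ (biFormsIn k T (n + 1) p q).comap (biD k p q) := by
  refine Submodule.span_le.2 ?_
  rintro _ ⟨w, w', h, h', rfl, rfl⟩
  rw [SetLike.mem_coe, Submodule.mem_comap]
  refine biD_formOf_tmul_mem k w w' _ (fun i hi => ?_) (fun i hi => ?_)
  · exact Submodule.subset_span ⟨_, _, (support_diff w i).symm ▸ h, h',
      by rw [degree_diff hi]; ring, rfl⟩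
  · exact Submodule.subset_span ⟨_, _, h, (support_diff w' i).symm ▸ h',
      by rw [degree_diff hi]; ring, rfl⟩

theorem reducedBiFormsIn_le_comap (T : Set ℤ) (n p q : ℕ) :
    reducedBiFormsIn k T n p q ≤ (reducedBiFormsIn k T (n + 1) p q).comap (biD k p q) := by
  refine Submodule.span_le.2 ?_
  rintro _ ⟨w, w', h, h', hd, rfl, rfl⟩
  rw [SetLike.mem_coe, Submodule.mem_comap]
  refine biD_formOf_tmul_mem k w w' _ (fun i hi => ?_) (fun i hi => ?_)
  · exact Submodule.subset_span ⟨_, _, (support_diff w i).symm ▸ h, h',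
      (support_diff w i).symm ▸ hd, by rw [degree_diff hi]; ring, rfl⟩
  · exact Submodule.subset_span ⟨_, _, h, (support_diff w' i).symm ▸ h',
      (support_diff w' i).symm ▸ hd, by rw [degree_diff hi]; ring, rfl⟩

theorem reducedBiFormsIn_le (T : Set ℤ) (n p q : ℕ) :
    reducedBiFormsIn k T n p q ≤ biFormsIn k T n p q := by
  refine Submodule.span_mono ?_
  rintro _ ⟨w, w', h, h', _, e, rfl⟩
  exact ⟨w, w', h, h', e, rfl⟩


end Forms

section Coproduct

variable {k : Type u} [CommRing k]

open CategoryTheory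

/-- The module `M^p`. -/
abbrev level (M : CosimplicialObject (ModuleCat.{v} k)) (p : ℕ) : ModuleCat.{v} k :=
  M.obj (SimplexCategory.mk p)

/-- The sum of the images in `M^p` of all the cofaces except the last one. -/
def cofaces (M : CosimplicialObject (ModuleCat.{v} k)) : ∀ p : ℕ, Submodule k (level M p)
  | 0 => ⊥
  | p + 1 => ⨆ i : Fin (p + 1), LinearMap.range (M.map (SimplexCategory.δ i.castSucc)).hom

/-- The normalized complex of a cosimplicial module, in degree `p`, as a quotient of `M^p`; it is
canonically isomorphic to the intersection of the kernels of the codegeneracies. -/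
abbrev Normalized (M : CosimplicialObject (ModuleCat.{v} k)) (p : ℕ) : Type v :=
  level M p ⧸ cofaces M p

/-- The normalized complex of the simplicial module `D*(Δ_•)`, as a quotient of `D*(Δ_p)`. -/
abbrev NormalizedForm (k : Type u) [CommRing k] (p : ℕ) : Type u := Form k p ⧸ degenerateForms k p

/-- The product over `p` of the modules `M^p ⊗ D*(Δ_p)`. -/
abbrev Family (M : CosimplicialObject (ModuleCat.{v} k)) : Type (max u v) :=
  ∀ p : ℕ, level M p ⊗[k] Form k p

/-- The product over `p` and `q` of the modules `(M^p ⊗ N^q) ⊗ (D*(Δ_p) ⊗ D*(Δ_q))`. -/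
abbrev BiFamily (M : CosimplicialObject (ModuleCat.{v} k))
    (N : CosimplicialObject (ModuleCat.{w} k)) : Type (max u v w) :=
  ∀ p q : ℕ, (level M p ⊗[k] level N q) ⊗[k] BiForm k p q

section Single

variable (M : CosimplicialObject (ModuleCat.{v} k))

/-- The projection on the tensor product of the normalized modules. -/
def normalization (p : ℕ) :
    level M p ⊗[k] Form k p →ₗ[k] Normalized M p ⊗[k] NormalizedForm k p :=
  TensorProduct.map (cofaces M p).mkQ (degenerateForms k p).mkQ

/-- The coproduct `M Δ B` of a cosimplicial module `M` and a simplicial submodule `B` of `D*(Δ_•)`: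
the compatible families in the restricted product of the `M^p ⊗ B_p`, that is, those whose images
in the normalized modules are almost all zero. (In the cases used below `B_p` is spanned by a part of
a basis of `D*(Δ_p)`, so that `M^p ⊗ B_p` is a submodule of `M^p ⊗ D*(Δ_p)`.) -/
def coproduct (B : ∀ p : ℕ, Submodule k (Form k p)) : Submodule k (Family M) where
  carrier := {x |
    (∀ p, x p ∈ LinearMap.range ((B p).subtype.lTensor (level M p))) ∧
    (∀ (p p' : ℕ) (f : SimplexCategory.mk p ⟶ SimplexCategory.mk p'),
      (M.map f).hom.rTensor (Form k p) (x p) =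
        (formPull k f.toOrderHom).lTensor (level M p') (x p')) ∧
    {p : ℕ | normalization M p (x p) ≠ 0}.Finite}
  zero_mem' := ⟨fun _ => zero_mem _, by simp, by simp⟩
  add_mem' := by
    rintro x y ⟨h1, h2, h3⟩ ⟨h1', h2', h3'⟩
    refine ⟨fun p => add_mem (h1 p) (h1' p), fun p p' f => ?_, ?_⟩
    · simp only [Pi.add_apply, map_add, h2 p p' f, h2' p p' f]
    · refine (h3.union h3').subset fun p hp => ?_
      by_contra h
      simp only [Set.mem_union, Set.mem_ofPred_eq, not_or, not_not] at h
      exact hp (by rw [Pi.add_apply, map_add, h.1, h.2, add_zero])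
  smul_mem' := by
    rintro c x ⟨h1, h2, h3⟩
    refine ⟨fun p => Submodule.smul_mem _ c (h1 p), fun p p' f => ?_, ?_⟩
    · simp only [Pi.smul_apply, map_smul, h2 p p' f]
    · refine h3.subset fun p hp h => hp ?_
      rw [Pi.smul_apply, map_smul, h, smul_zero]

/-- The part of degree `a` of `_S D*(M)`: the directed union of the coproducts of `M` and
`_T D^a(Δ_•)` over the finite subsets `T` of `S` (the coproduct for `T = S` if `S` is finite). -/
def cochains (S : Set ℤ) (a : ℕ) : Submodule k (Family M) :=
  ⨆ (T : Finset ℤ) (_ : (T : Set ℤ) ⊆ S), coproduct M (formsIn k T a)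

end Single

variable (M : CosimplicialObject (ModuleCat.{v} k)) (N : CosimplicialObject (ModuleCat.{w} k))

/-- The projection on the tensor product of the normalized modules. -/
def biNormalization (p q : ℕ) : (level M p ⊗[k] level N q) ⊗[k] BiForm k p q →ₗ[k]
    (Normalized M p ⊗[k] Normalized N q) ⊗[k] (NormalizedForm k p ⊗[k] NormalizedForm k q) :=
  TensorProduct.map (TensorProduct.map (cofaces M p).mkQ (cofaces N q).mkQ)
    (TensorProduct.map (degenerateForms k p).mkQ (degenerateForms k q).mkQ)

/-- The coproduct `(M ⊗ N) Δ B` of the bicosimplicial module `M ⊗ N` and a bisimplicial submodule `B`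
of `D*(Δ_•) ⊗ D*(Δ_•)`: the compatible families in the restricted product of the
`(M^p ⊗ N^q) ⊗ B_{p,q}`. -/
def biCoproduct (B : ∀ p q : ℕ, Submodule k (BiForm k p q)) : Submodule k (BiFamily M N) where
  carrier := {x |
    (∀ p q, x p q ∈ LinearMap.range ((B p q).subtype.lTensor (level M p ⊗[k] level N q))) ∧
    (∀ (p p' q q' : ℕ) (f : SimplexCategory.mk p ⟶ SimplexCategory.mk p')
        (g : SimplexCategory.mk q ⟶ SimplexCategory.mk q'),
      (TensorProduct.map (M.map f).hom (N.map g).hom).rTensor (BiForm k p q) (x p q) =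
        (biPull k f.toOrderHom g.toOrderHom).lTensor (level M p' ⊗[k] level N q') (x p' q')) ∧
    {pq : ℕ × ℕ | biNormalization M N pq.1 pq.2 (x pq.1 pq.2) ≠ 0}.Finite}
  zero_mem' := ⟨fun _ _ => zero_mem _, by simp, by simp⟩
  add_mem' := by
    rintro x y ⟨h1, h2, h3⟩ ⟨h1', h2', h3'⟩
    refine ⟨fun p q => add_mem (h1 p q) (h1' p q), fun p p' q q' f g => ?_, ?_⟩
    · simp only [Pi.add_apply, map_add, h2 p p' q q' f g, h2' p p' q q' f g]
    · refine (h3.union h3').subset fun p hp => ?_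
      by_contra h
      simp only [Set.mem_union, Set.mem_ofPred_eq, not_or, not_not] at h
      exact hp (by rw [Pi.add_apply, Pi.add_apply, map_add, h.1, h.2, add_zero])
  smul_mem' := by
    rintro c x ⟨h1, h2, h3⟩
    refine ⟨fun p q => Submodule.smul_mem _ c (h1 p q), fun p p' q q' f g => ?_, ?_⟩
    · simp only [Pi.smul_apply, map_smul, h2 p p' q q' f g]
    · refine h3.subset fun p hp h => hp ?_
      rw [Pi.smul_apply, Pi.smul_apply, map_smul, h, smul_zero]

theorem biCoproduct_mono {B B' : ∀ p q : ℕ, Submodule k (BiForm k p q)}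
    (h : ∀ p q, B p q ≤ B' p q) : biCoproduct M N B ≤ biCoproduct M N B' := by
  rintro x ⟨h1, h2, h3⟩
  refine ⟨fun p q => ?_, h2, h3⟩
  obtain ⟨y, hy⟩ := h1 p q
  refine ⟨(Submodule.inclusion (h p q)).lTensor _ y, ?_⟩
  rw [← LinearMap.comp_apply, ← LinearMap.lTensor_comp, Submodule.subtype_comp_inclusion, hy]

/-- The differential, induced by the one of the `D*(Δ_p) ⊗ D*(Δ_q)`. -/
def biFamilyD : BiFamily M N →ₗ[k] BiFamily M N :=
  LinearMap.pi fun p => LinearMap.pi fun q =>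
    (biD k p q).lTensor (level M p ⊗[k] level N q) ∘ₗ LinearMap.proj q ∘ₗ LinearMap.proj p

theorem biFamilyD_apply (x : BiFamily M N) (p q : ℕ) :
    biFamilyD M N x p q = (biD k p q).lTensor (level M p ⊗[k] level N q) (x p q) := rfl

theorem biFamilyD_biFamilyD (x : BiFamily M N) : biFamilyD M N (biFamilyD M N x) = 0 := by
  funext p q
  rw [biFamilyD_apply, biFamilyD_apply, ← LinearMap.comp_apply, ← LinearMap.lTensor_comp,
    biD_comp_self]
  simp

theorem biCoproduct_le_comap {B B' : ∀ p q : ℕ, Submodule k (BiForm k p q)}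
    (h : ∀ p q, B p q ≤ (B' p q).comap (biD k p q)) :
    biCoproduct M N B ≤ (biCoproduct M N B').comap (biFamilyD M N) := by
  rintro x ⟨h1, h2, h3⟩
  refine ⟨fun p q => ?_, fun p p' q q' f g => ?_, ?_⟩
  · obtain ⟨y, hy⟩ := h1 p q
    refine ⟨((biD k p q).restrict (h p q)).lTensor _ y, ?_⟩
    rw [biFamilyD_apply, ← hy, ← LinearMap.comp_apply, ← LinearMap.comp_apply,
      ← LinearMap.lTensor_comp, ← LinearMap.lTensor_comp]
    rfl
  · rw [biFamilyD_apply, biFamilyD_apply, ← LinearMap.comp_apply, ← LinearMap.comp_apply,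
      ← LinearMap.lTensor_comp, ← biD_comp_biPull, LinearMap.rTensor_comp_lTensor,
      ← LinearMap.lTensor_comp_rTensor, LinearMap.comp_apply, h2 p p' q q' f g,
      ← LinearMap.comp_apply, ← LinearMap.lTensor_comp]
  · refine h3.subset fun pq hpq hz => hpq ?_
    obtain ⟨p, q⟩ := pq
    let d₁ : NormalizedForm k p →ₗ[k] NormalizedForm k p :=
      (degenerateForms k p).mapQ _ (formD k p)
        (degenerateForms_le_comap k p (formD k) (formD_comp_formPull k))
    let s₁ : NormalizedForm k p →ₗ[k] NormalizedForm k p :=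
      (degenerateForms k p).mapQ _ (formSign k p)
        (degenerateForms_le_comap k p (formSign k) (formSign_comp_formPull k))
    let d₂ : NormalizedForm k q →ₗ[k] NormalizedForm k q :=
      (degenerateForms k q).mapQ _ (formD k q)
        (degenerateForms_le_comap k q (formD k) (formD_comp_formPull k))
    have key : biNormalization M N p q ∘ₗ (biD k p q).lTensor (level M p ⊗[k] level N q) =
        (TensorProduct.map d₁ LinearMap.id + TensorProduct.map s₁ d₂).lTensor _ ∘ₗ
          biNormalization M N p q := by
      refine TensorProduct.ext_fourfold' fun a b c e => ?_
      simp only [LinearMap.comp_apply, LinearMap.lTensor_tmul, biD, biNormalization,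
        TensorProduct.map_tmul, LinearMap.add_apply, map_add, TensorProduct.tmul_add,
        LinearMap.id_apply]
      rfl
    have := LinearMap.congr_fun key (x p q)
    simp only [LinearMap.comp_apply] at this hz ⊢
    rw [biFamilyD_apply, this, hz, map_zero]

/-- The part of degree `n` of `G(M, N) = (M ⊗ N) Δ (_S D*(Δ_•) ⊗ _S D*(Δ_•))`, which is the tensor
product `_S D*(M) ⊗ _S D*(N)` (for infinite `S`, the union over the finite subsets of `S`). -/
def fullTensor (S : Set ℤ) (n : ℕ) : Submodule k (BiFamily M N) :=
  ⨆ (T : Finset ℤ) (_ : (T : Set ℤ) ⊆ S), biCoproduct M N (biFormsIn k T n)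

/-- The part of degree `n` of the reduced tensor product of `_S D*(M)` and `_S D*(N)`, which is
`F(M, N) = (M ⊗ N) Δ B` for `B` the reduced tensor product of `_S D*(Δ_•)` and `_S D*(Δ_•)`
(for infinite `S`, the union over the finite subsets of `S`). -/
def reducedTensor (S : Set ℤ) (n : ℕ) : Submodule k (BiFamily M N) :=
  ⨆ (T : Finset ℤ) (_ : (T : Set ℤ) ⊆ S), biCoproduct M N (reducedBiFormsIn k T n)

theorem fullTensor_le_comap (S : Set ℤ) (n : ℕ) :
    fullTensor M N S n ≤ (fullTensor M N S (n + 1)).comap (biFamilyD M N) :=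
  iSup₂_le fun T hT => (biCoproduct_le_comap M N fun p q => biFormsIn_le_comap k T n p q).trans
    (Submodule.comap_mono (le_iSup₂_of_le T hT le_rfl))

theorem reducedTensor_le_comap (S : Set ℤ) (n : ℕ) :
    reducedTensor M N S n ≤ (reducedTensor M N S (n + 1)).comap (biFamilyD M N) :=
  iSup₂_le fun T hT => (biCoproduct_le_comap M N fun p q =>
    reducedBiFormsIn_le_comap k T n p q).trans
    (Submodule.comap_mono (le_iSup₂_of_le T hT le_rfl))

theorem reducedTensor_le_fullTensor (S : Set ℤ) (n : ℕ) :
    reducedTensor M N S n ≤ fullTensor M N S n :=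
  iSup₂_mono fun T _ => biCoproduct_mono M N fun p q => reducedBiFormsIn_le k T n p q

theorem reducedTensor_mono {S S' : Set ℤ} (h : S ⊆ S') (n : ℕ) :
    reducedTensor M N S n ≤ reducedTensor M N S' n :=
  iSup₂_le fun T hT => le_iSup₂_of_le T (hT.trans h) le_rfl

/-- The cochain complex given by submodules `W n` of a module with a differential `d`. -/
def subcomplex {V : Type w} [AddCommGroup V] [Module k V] (d : V →ₗ[k] V)
    (hd : ∀ x, d (d x) = 0) (W : ℕ → Submodule k V) (hW : ∀ n, W n ≤ (W (n + 1)).comap d) :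
    CochainComplex (ModuleCat.{w} k) ℕ :=
  CochainComplex.of (fun n => ModuleCat.of k (W n))
    (fun n => ModuleCat.ofHom (d.restrict (hW n)))
    (fun n => by
      refine ModuleCat.hom_ext (LinearMap.ext fun x => ?_)
      exact Subtype.ext (hd x))

def subcomplexInclusion {V : Type w} [AddCommGroup V] [Module k V] (d : V →ₗ[k] V)
    (hd : ∀ x, d (d x) = 0) (W W' : ℕ → Submodule k V) (hW : ∀ n, W n ≤ (W (n + 1)).comap d)
    (hW' : ∀ n, W' n ≤ (W' (n + 1)).comap d) (h : ∀ n, W n ≤ W' n) :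
    subcomplex d hd W hW ⟶ subcomplex d hd W' hW' :=
  CochainComplex.ofHom (fun n => ModuleCat.ofHom (Submodule.inclusion (h n))) fun n => by
    simp only [subcomplex, CochainComplex.of_d]
    rfl

/-- The cochain complex `_S D*(M) ⊗ _S D*(N)`. -/
def fullComplex (S : Set ℤ) : CochainComplex (ModuleCat.{max u v w} k) ℕ :=
  subcomplex (biFamilyD M N) (biFamilyD_biFamilyD M N) (fullTensor M N S)
    (fullTensor_le_comap M N S)

/-- The reduced tensor product of `_S D*(M)` and `_S D*(N)`, as a cochain complex. -/
def reducedComplex (S : Set ℤ) : CochainComplex (ModuleCat.{max u v w} k) ℕ :=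
  subcomplex (biFamilyD M N) (biFamilyD_biFamilyD M N) (reducedTensor M N S)
    (reducedTensor_le_comap M N S)

/-- The inclusion of the reduced tensor product of `_S D*(M)` and `_S D*(N)` into their tensor
product. -/
def reducedInclusion (S : Set ℤ) : reducedComplex M N S ⟶ fullComplex M N S :=
  subcomplexInclusion _ _ _ _ _ _ (reducedTensor_le_fullTensor M N S)

/-- The inclusion of the reduced tensor products given by an inclusion `S ⊆ S'`. -/
def reducedExtension {S S' : Set ℤ} (h : S ⊆ S') :
    reducedComplex M N S ⟶ reducedComplex M N S' :=
  subcomplexInclusion _ _ _ _ _ _ (reducedTensor_mono M N h)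


/-- The differential of `_S D*(M)`. -/
def familyD (M : CosimplicialObject (ModuleCat.{v} k)) : Family M →ₗ[k] Family M :=
  LinearMap.pi fun p => (formD k p).lTensor (level M p) ∘ₗ LinearMap.proj p

/-- The family `(x_p ⊗ y_q)` for `x = (x_p)` and `y = (y_q)`. -/
def tensorFamily : Family M →ₗ[k] Family N →ₗ[k] BiFamily M N :=
  LinearMap.mk₂ k
    (fun x y p q => TensorProduct.tensorTensorTensorComm k (level M p) (Form k p) (level N q)
      (Form k q) (x p ⊗ₜ[k] y q))
    (fun x x' y => by funext p q; simp [TensorProduct.add_tmul])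
    (fun c x y => by funext p q; simp [← TensorProduct.smul_tmul'])
    (fun x y y' => by funext p q; simp [TensorProduct.tmul_add])
    (fun c x y => by funext p q; simp)

theorem tensorFamily_apply (x : Family M) (y : Family N) (p q : ℕ) :
    tensorFamily M N x y p q = TensorProduct.tensorTensorTensorComm k (level M p) (Form k p)
      (level N q) (Form k q) (x p ⊗ₜ[k] y q) := rfl

theorem tensorFamily_natural {V V' W W' A A' B B' : Type*} [AddCommGroup V] [AddCommGroup V']
    [AddCommGroup W] [AddCommGroup W'] [AddCommGroup A] [AddCommGroup A'] [AddCommGroup B]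
    [AddCommGroup B'] [Module k V] [Module k V'] [Module k W] [Module k W'] [Module k A]
    [Module k A'] [Module k B] [Module k B'] (f : V →ₗ[k] V') (g : W →ₗ[k] W') (a : A →ₗ[k] A')
    (b : B →ₗ[k] B') (x : V ⊗[k] A) (y : W ⊗[k] B) :
    TensorProduct.tensorTensorTensorComm k V' A' W' B'
        (TensorProduct.map f a x ⊗ₜ[k] TensorProduct.map g b y) =
      TensorProduct.map (TensorProduct.map f g) (TensorProduct.map a b)
        (TensorProduct.tensorTensorTensorComm k V A W B (x ⊗ₜ[k] y)) := by
  induction x with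
  | zero => simp
  | add x x' hx hx' => simp only [map_add, TensorProduct.add_tmul, hx, hx']
  | tmul v a =>
    induction y with
    | zero => simp
    | add y y' hy hy' => simp only [map_add, TensorProduct.tmul_add, hy, hy']
    | tmul w b => simp

theorem tmul_mem_biFormsIn {T T' : Set ℤ} {a b p q : ℕ} {x : Form k p} {y : Form k q}
    (hx : x ∈ formsIn k T a p) (hy : y ∈ formsIn k T' b q) :
    x ⊗ₜ[k] y ∈ biFormsIn k (T ∪ T') (a + b) p q := by
  have h : Submodule.map₂ (TensorProduct.mk k _ _) (formsIn k T a p) (formsIn k T' b q) ≤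
      biFormsIn k (T ∪ T') (a + b) p q := by
    unfold formsIn
    rw [Submodule.map₂_span_span]
    refine Submodule.span_mono ?_
    rintro _ ⟨_, ⟨w, h, rfl, rfl⟩, _, ⟨w', h', rfl, rfl⟩, rfl⟩
    exact ⟨w, w', h.trans Set.subset_union_left, h'.trans Set.subset_union_right, rfl, rfl⟩
  exact h (Submodule.apply_mem_map₂ _ hx hy)

theorem tensorFamily_mem_biCoproduct {T T' : Set ℤ} {a b : ℕ} {x : Family M} {y : Family N}
    (hx : x ∈ coproduct M (formsIn k T a)) (hy : y ∈ coproduct N (formsIn k T' b)) :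
    tensorFamily M N x y ∈ biCoproduct M N (biFormsIn k (T ∪ T') (a + b)) := by
  obtain ⟨h1, h2, h3⟩ := hx
  obtain ⟨h1', h2', h3'⟩ := hy
  refine ⟨fun p q => ?_, fun p p' q q' f g => ?_, ?_⟩
  · obtain ⟨x', hx'⟩ := h1 p
    obtain ⟨y', hy'⟩ := h1' q
    let j : formsIn k T a p ⊗[k] formsIn k T' b q →ₗ[k] biFormsIn k (T ∪ T') (a + b) p q :=
      (TensorProduct.map (formsIn k T a p).subtype (formsIn k T' b q).subtype).codRestrict _
        fun z => by
          induction z with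
          | zero => rw [map_zero]; exact zero_mem _
          | add z z' hz hz' => rw [map_add]; exact add_mem hz hz'
          | tmul z z' => exact tmul_mem_biFormsIn z.2 z'.2
    refine ⟨j.lTensor _ (TensorProduct.tensorTensorTensorComm k _ _ _ _ (x' ⊗ₜ[k] y')), ?_⟩
    rw [tensorFamily_apply, ← hx', ← hy']
    refine Eq.trans ?_ (tensorFamily_natural LinearMap.id LinearMap.id (formsIn k T a p).subtype
      (formsIn k T' b q).subtype x' y').symm
    rw [← LinearMap.comp_apply, ← LinearMap.lTensor_comp, TensorProduct.map_id]
    rfl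
  · rw [tensorFamily_apply, tensorFamily_apply]
    have e1 := tensorFamily_natural (M.map f).hom (N.map g).hom (LinearMap.id : Form k p →ₗ[k] _)
      (LinearMap.id : Form k q →ₗ[k] _) (x p) (y q)
    have e2 := tensorFamily_natural (LinearMap.id : level M p' →ₗ[k] _)
      (LinearMap.id : level N q' →ₗ[k] _) (formPull k f.toOrderHom) (formPull k g.toOrderHom)
      (x p') (y q')
    rw [TensorProduct.map_id] at e1 e2
    refine e1.symm.trans (Eq.trans ?_ e2)
    exact congrArg _ (congrArg₂ _ (h2 p p' f) (h2' q q' g))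
  · refine (h3.prod h3').subset ?_
    rintro ⟨p, q⟩ h
    have e := tensorFamily_natural (cofaces M p).mkQ (cofaces N q).mkQ (degenerateForms k p).mkQ
      (degenerateForms k q).mkQ (x p) (y q)
    refine ⟨fun h0 => h ?_, fun h0 => h ?_⟩
    · change normalization M p (x p) = 0 at h0
      refine e.symm.trans ?_
      change TensorProduct.tensorTensorTensorComm k _ _ _ _ (normalization M p (x p) ⊗ₜ[k] _) = 0
      rw [h0, TensorProduct.zero_tmul, map_zero]
    · change normalization N q (y q) = 0 at h0
      refine e.symm.trans ?_
      change TensorProduct.tensorTensorTensorComm k _ _ _ _ (_ ⊗ₜ[k] normalization N q (y q)) = 0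
      rw [h0, TensorProduct.tmul_zero, map_zero]

theorem tensorFamily_mem {S : Set ℤ} {a b : ℕ} {x : Family M} {y : Family N}
    (hx : x ∈ cochains M S a) (hy : y ∈ cochains N S b) :
    tensorFamily M N x y ∈ fullTensor M N S (a + b) := by
  have h : Submodule.map₂ (tensorFamily M N) (cochains M S a) (cochains N S b) ≤
      fullTensor M N S (a + b) := by
    classical
    unfold cochains
    simp only [Submodule.map₂_iSup_left, Submodule.map₂_iSup_right]
    refine iSup₂_le fun T' hT' => iSup₂_le fun T hT => Submodule.map₂_le.2 fun x hx y hy => ?_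
    have hTT : ((T ∪ T' : Finset ℤ) : Set ℤ) ⊆ S := by
      rw [Finset.coe_union]; exact Set.union_subset hT hT'
    refine Submodule.mem_iSup_of_mem (T ∪ T') (Submodule.mem_iSup_of_mem hTT ?_)
    rw [Finset.coe_union]
    exact tensorFamily_mem_biCoproduct M N hx hy
  exact h (Submodule.apply_mem_map₂ _ hx hy)

open scoped DirectSum in
/-- The canonical map from the part of degree `n` of the tensor product of the complexes `_S D*(M)` and
`_S D*(N)`, the direct sum of the `_S D^a(M) ⊗ _S D^b(N)` over `a + b = n`, to `G(M, N)`; it sends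
`x ⊗ y` to the family `(x_p ⊗ y_q)`. -/
def tensorComparison (S : Set ℤ) (n : ℕ) :
    (⨁ ab : Finset.HasAntidiagonal.antidiagonal n, cochains M S ab.1.1 ⊗[k] cochains N S ab.1.2) →ₗ[k]
      fullTensor M N S n :=
  DirectSum.toModule k _ _ fun ab => TensorProduct.lift <|
    LinearMap.mk₂ k
      (fun x y => ⟨tensorFamily M N x.1 y.1,
        by
          have h := tensorFamily_mem M N x.2 y.2
          rwa [Finset.HasAntidiagonal.mem_antidiagonal.1 ab.2] at h⟩)
      (fun x x' y => Subtype.ext (by simp))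
      (fun c x y => Subtype.ext (by simp))
      (fun x y y' => Subtype.ext (by simp))
      (fun c x y => Subtype.ext (by simp))

theorem familySign {S : Set ℤ} {a : ℕ} {x : Family M} (hx : x ∈ cochains M S a) (p : ℕ) :
    (formSign k p).lTensor (level M p) (x p) = (-1 : k) ^ a • x p := by
  have h : cochains M S a ≤ LinearMap.ker
      (((formSign k p).lTensor (level M p) - (-1 : k) ^ a • LinearMap.id) ∘ₗ
        (LinearMap.proj p : Family M →ₗ[k] _)) := by
    refine iSup₂_le fun T _ => ?_
    rintro z ⟨hz, -⟩
    obtain ⟨y, hy⟩ := hz p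
    rw [LinearMap.mem_ker, LinearMap.comp_apply, LinearMap.proj_apply, ← hy]
    have e : formSign k p ∘ₗ (formsIn k T a p).subtype =
        (-1 : k) ^ a • (formsIn k T a p).subtype := by
      have : formsIn k T a p ≤ LinearMap.ker (formSign k p - (-1 : k) ^ a • LinearMap.id) := by
        refine Submodule.span_le.2 ?_
        rintro _ ⟨w, _, rfl, rfl⟩
        simp [formSign_formOf]
      ext z
      have := this z.2
      rw [LinearMap.mem_ker, LinearMap.sub_apply, sub_eq_zero] at this
      exact this
    rw [LinearMap.sub_apply, ← LinearMap.comp_apply, ← LinearMap.lTensor_comp, e,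
      LinearMap.lTensor_smul]
    simp
  have := h hx
  rw [LinearMap.mem_ker, LinearMap.comp_apply, LinearMap.sub_apply, sub_eq_zero] at this
  exact this

/-- The canonical map `x ⊗ y ↦ (x_p ⊗ y_q)` is compatible with the differential
`dx ⊗ y + (-1) ^ a x ⊗ dy` of the tensor product of complexes. -/
theorem biFamilyD_tensorFamily {S : Set ℤ} {a : ℕ} {x : Family M} (hx : x ∈ cochains M S a)
    (y : Family N) : biFamilyD M N (tensorFamily M N x y) =
      tensorFamily M N (familyD M x) y + (-1 : k) ^ a • tensorFamily M N x (familyD N y) := by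
  funext p q
  have e1 := tensorFamily_natural (LinearMap.id : level M p →ₗ[k] _)
      (LinearMap.id : level N q →ₗ[k] _) (formD k p) LinearMap.id (x p) (y q)
  have e2 := tensorFamily_natural (LinearMap.id : level M p →ₗ[k] _)
      (LinearMap.id : level N q →ₗ[k] _) (formSign k p) (formD k q) (x p) (y q)
  have e3 := familySign M hx p
  rw [TensorProduct.map_id, TensorProduct.map_id] at e1
  rw [TensorProduct.map_id] at e2
  change TensorProduct.map LinearMap.id (formSign k p) (x p) = _ at e3
  rw [e3] at e2
  rw [biFamilyD_apply, biD, LinearMap.lTensor_add, LinearMap.add_apply]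
  refine (congrArg₂ _ e1.symm e2.symm).trans ?_
  rw [← TensorProduct.smul_tmul', map_smul]
  rfl

/-- The cosimplicial module `[p] ↦ k ^ X_p` of the cochains of a simplicial set. -/
def simplicialCochains (k : Type u) [CommRing k] (X : SSet.{v}) :
    CosimplicialObject (ModuleCat.{max u v} k) where
  obj p := ModuleCat.of k (X.obj (Opposite.op p) → k)
  map f := ModuleCat.ofHom (LinearMap.funLeft k k (X.map f.op))
  map_id p := by
    refine ModuleCat.hom_ext (LinearMap.ext fun x => funext fun s => ?_)
    simp [LinearMap.funLeft]
  map_comp f g := by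
    refine ModuleCat.hom_ext (LinearMap.ext fun x => funext fun s => ?_)
    simp [LinearMap.funLeft]

/-- A commutative ring is coherent if its finitely generated ideals are finitely presented. -/
def IsCoherent (k : Type u) [CommRing k] : Prop :=
  ∀ I : Ideal k, I.FG → Module.FinitePresentation k I

/-- A cosimplicial module is flat if it is flat in each degree. -/
def IsFlat (M : CosimplicialObject (ModuleCat.{v} k)) : Prop :=
  ∀ p : ℕ, Module.Flat k (level M p)

/-- The normalized complex of `M` vanishes in degrees `> m`. -/
def DimensionLE (M : CosimplicialObject (ModuleCat.{v} k)) (m : ℕ) : Prop :=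
  ∀ p : ℕ, m < p → Subsingleton (Normalized M p)

end Coproduct

end QuasiComm
end

/-! All the quasi-isomorphisms come from one relative statement. Let `R` and `R'` be two conditions
on pairs of singular supports, `R` implying `R'` (disjoint in `T` against contained in `T`, or
disjoint in `T` against disjoint in `T'` for `T ⊆ T'`). If `x` is a compatible family of type `R'`
and `dx` is of type `R`, then `x - dy` is of type `R` for some family `y` of type `R'`
(`exists_family_sub_d_mem`). Such a statement makes the inclusion of the smaller complex a
quasi-isomorphism (`quasiIso_subcomplexInclusion`).

The family is treated one bidegree at a time. If the components just to the left of and just below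
`(r, s)` vanish, compatibility forces `x r s` to be normal for the codegeneracies and to have all
simplicial faces zero in both directions. Two facts are then needed. First, elements with all faces
zero lift to bidegree `(r + 1, s + 1)` and form an acyclic complex, absolutely or modulo `R`.
Second, such a lift extends to a whole compatible family that vanishes at every `(p, q)` with `p <
r` or `q < s`. Subtracting such families moves through the rectangle `p ≤ m`, `q ≤ n` in
lexicographic order; the dimension bounds make the components outside the rectangle follow from
those inside.

The first fact rests on an extra degeneracy: a letter `Y_s` is put in front of one word, with `s` in
`T` outside the support of the other word. Such an `s` exists because a word in `q + 1` letters that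
is nonzero on the simplex contains a `1`, hence has at most `q` singular points. This preserves
disjointness and makes the rows and columns of index less than `card T` exact. A zigzag along an
antidiagonal (`BiSimp.exists_face_face`) gives the double lifts and explains the condition `m + n +
1 < card T`. The de Rham direction is contracted by integrating the first letter other than `1`
(`formD_homotopy`), an operation that does not enlarge supports.

The second fact is an explicit formula of Whitney type (`whitney`): an element of `C^r ⊗ S_{r+1}`
produces a family over all `p`, as a sum over the maps `[r] → [p]`. Compatibility is
`pull_whitneyCoeff`, and the component in degree `r` is the zeroth face by `whitney_self`.

The same formula, together with the extra degeneracy, reconstructs a compatible family linearly from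
its component in degree `m` (`IsCompatibleFamily.extend_eq`). Linearity allows the reconstruction in
the two variables to be tensored, and this yields an explicit inverse of the comparison map from the
tensor product of the two cochain complexes. -/

noncomputable section

namespace QuasiComm

/-! ### Simplicial and cosimplicial modules, cycles and Moore elements. -/

section Abstract

/-- A simplicial `k`-module. -/
structure SimpMod (k : Type u) [CommRing k] where
  obj : ℕ → Type v
  [addCommGroup : ∀ a, AddCommGroup (obj a)]
  [module : ∀ a, Module k (obj a)]
  pull : ∀ {a b : ℕ}, (Fin (a + 1) →o Fin (b + 1)) → obj b →ₗ[k] obj a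
  pull_id : ∀ a, pull (OrderHom.id : Fin (a + 1) →o Fin (a + 1)) = LinearMap.id
  pull_comp : ∀ {a b c : ℕ} (u : Fin (a + 1) →o Fin (b + 1)) (v : Fin (b + 1) →o Fin (c + 1)),
    pull (v.comp u) = pull u ∘ₗ pull v

/-- A cosimplicial `k`-module. -/
structure CosMod (k : Type u) [CommRing k] where
  obj : ℕ → Type v
  [addCommGroup : ∀ a, AddCommGroup (obj a)]
  [module : ∀ a, Module k (obj a)]
  push : ∀ {a b : ℕ}, (Fin (a + 1) →o Fin (b + 1)) → obj a →ₗ[k] obj b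
  push_id : ∀ a, push (OrderHom.id : Fin (a + 1) →o Fin (a + 1)) = LinearMap.id
  push_comp : ∀ {a b c : ℕ} (u : Fin (a + 1) →o Fin (b + 1)) (v : Fin (b + 1) →o Fin (c + 1)),
    push (v.comp u) = push v ∘ₗ push u

attribute [instance] SimpMod.addCommGroup SimpMod.module CosMod.addCommGroup CosMod.module

variable {k : Type u} [CommRing k]

/-- The coface that omits `x`. -/
def face {a : ℕ} (x : Fin (a + 2)) : Fin (a + 1) →o Fin (a + 2) := (Fin.succAboveOrderEmb x).toOrderHom

@[simp] theorem face_apply {a : ℕ} (x : Fin (a + 2)) (j : Fin (a + 1)) :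
    face x j = x.succAbove j := rfl

/-- The codegeneracy that repeats `x`. -/
def codegen {a : ℕ} (x : Fin (a + 1)) : Fin (a + 2) →o Fin (a + 1) :=
  ⟨x.predAbove, Fin.predAbove_right_monotone x⟩

theorem face_not_surjective {a : ℕ} (x : Fin (a + 2)) : ¬ Function.Surjective (face x) := by
  intro h
  obtain ⟨j, hj⟩ := h x
  rw [face_apply] at hj
  exact Fin.succAbove_ne _ _ hj

theorem exists_eq_face_comp {a b : ℕ} (v : Fin (a + 1) →o Fin (b + 2)) (x : Fin (b + 2))
    (h : ∀ j, v j ≠ x) : ∃ v' : Fin (a + 1) →o Fin (b + 1), v = (face x).comp v' := by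
  obtain ⟨θ, hθ⟩ := SimplexCategory.eq_comp_δ_of_not_surjective'
    (SimplexCategory.Hom.mk v : SimplexCategory.mk a ⟶ SimplexCategory.mk (b + 1)) x h
  refine ⟨θ.toOrderHom, ?_⟩
  have := congrArg SimplexCategory.Hom.toOrderHom hθ
  exact this

theorem exists_eq_comp_codegen {a b : ℕ} (u : Fin (a + 2) →o Fin (b + 1))
    (h : ¬ Function.Injective u) :
    ∃ (x : Fin (a + 1)) (u' : Fin (a + 1) →o Fin (b + 1)), u = u'.comp (codegen x) := by
  obtain ⟨i, θ, hθ⟩ := SimplexCategory.eq_σ_comp_of_not_injective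
    (SimplexCategory.Hom.mk u : SimplexCategory.mk (a + 1) ⟶ SimplexCategory.mk b) h
  refine ⟨i, θ.toOrderHom, ?_⟩
  have := congrArg SimplexCategory.Hom.toOrderHom hθ
  exact this

theorem exists_castSucc_eq_succ {a b : ℕ} (u : Fin (a + 1) →o Fin (b + 1))
    (h : ¬ Function.Injective u) :
    ∃ x y : Fin (a + 1), (y : ℕ) = x + 1 ∧ u x = u y := by
  obtain ⟨x, y, hxy, hne⟩ : ∃ x y, u x = u y ∧ x ≠ y := by
    simpa [Function.Injective] using h
  wlog hlt : x < y generalizing x y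
  · exact this y x hxy.symm hne.symm (lt_of_le_of_ne (not_lt.1 hlt) hne.symm)
  refine ⟨x, ⟨x + 1, by omega⟩, rfl, le_antisymm (u.monotone ?_) ?_⟩
  · exact Fin.le_def.2 (by simp)
  · rw [hxy]; exact u.monotone (Fin.le_def.2 (by simpa using Fin.lt_def.1 hlt))

namespace SimpMod

variable (S : SimpMod.{u, v} k)

/-- All faces of `b` vanish. -/
def IsCycle {a : ℕ} (b : S.obj a) : Prop :=
  ∀ {a' : ℕ} (v : Fin (a' + 1) →o Fin (a + 1)), ¬ Function.Surjective v → S.pull v b = 0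

/-- All faces of `b` but the zeroth one vanish. -/
def IsMoore {a : ℕ} (b : S.obj a) : Prop :=
  ∀ {a' : ℕ} (v : Fin (a' + 1) →o Fin (a + 1)) (x : Fin (a + 1)), x ≠ 0 → (∀ j, v j ≠ x) →
    S.pull v b = 0

variable {S}

theorem pull_pull {a b c : ℕ} (u : Fin (a + 1) →o Fin (b + 1)) (v : Fin (b + 1) →o Fin (c + 1))
    (x : S.obj c) : S.pull u (S.pull v x) = S.pull (v.comp u) x := by
  rw [S.pull_comp]; rfl

theorem IsCycle.isMoore {a : ℕ} {b : S.obj a} (h : S.IsCycle b) : S.IsMoore b :=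
  fun v x _ hv => h v fun hs => by obtain ⟨j, hj⟩ := hs x; exact hv j hj

theorem isCycle_of_face {a : ℕ} {b : S.obj (a + 1)} (h : ∀ x, S.pull (face x) b = 0) :
    S.IsCycle b := by
  intro a' v hv
  obtain ⟨x, hx⟩ : ∃ x, ∀ j, v j ≠ x := by simpa [Function.Surjective] using hv
  obtain ⟨v', rfl⟩ := exists_eq_face_comp v x hx
  rw [S.pull_comp, LinearMap.comp_apply, h, map_zero]

/-- The condition is empty: every map to `[0]` is surjective. The inductions on simplicial degree
start here. -/
theorem isCycle_zero (b : S.obj 0) : S.IsCycle b := by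
  intro a' v hv
  exact absurd (fun x => ⟨0, Subsingleton.elim (α := Fin 1) _ _⟩) hv

theorem isMoore_of_face {a : ℕ} {b : S.obj (a + 1)}
    (h : ∀ x : Fin (a + 1), S.pull (face x.succ) b = 0) : S.IsMoore b := by
  intro a' v x hx0 hx
  obtain ⟨v', rfl⟩ := exists_eq_face_comp v x hx
  obtain ⟨y, rfl⟩ := Fin.exists_succ_eq.2 hx0
  rw [S.pull_comp, LinearMap.comp_apply, h, map_zero]

theorem IsMoore.isCycle {a : ℕ} {b : S.obj (a + 1)} (h : S.IsMoore b)
    (h0 : S.pull (face 0) b = 0) : S.IsCycle b := by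
  refine isCycle_of_face fun x => ?_
  by_cases hx : x = 0
  · rw [hx, h0]
  · exact h _ x hx fun j => Fin.succAbove_ne x j

/-- A map that misses `x`, followed by the zeroth coface, misses `x + 1`, which is not `0`. In the
Moore complex this is the identity `d ∘ d = 0`. -/
theorem IsMoore.isCycle_face {a : ℕ} {b : S.obj (a + 1)} (h : S.IsMoore b) :
    S.IsCycle (S.pull (face 0) b) := by
  intro a' v hv
  obtain ⟨x, hx⟩ : ∃ x, ∀ j, v j ≠ x := by simpa [Function.Surjective] using hv
  rw [pull_pull]
  refine h _ x.succ (Fin.succ_ne_zero x) fun j => ?_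
  simpa using hx j

theorem IsCycle.sub {a : ℕ} {b c : S.obj a} (hb : S.IsCycle b) (hc : S.IsCycle c) :
    S.IsCycle (b - c) := fun v hv => by rw [map_sub, hb v hv, hc v hv, sub_zero]

theorem IsMoore.sub {a : ℕ} {b c : S.obj a} (hb : S.IsMoore b) (hc : S.IsMoore c) :
    S.IsMoore (b - c) := fun v x h0 hv => by rw [map_sub, hb v x h0 hv, hc v x h0 hv, sub_zero]

/-- A map of simplicial modules preserves cycles. -/
theorem IsCycle.map {S' : SimpMod.{u, w} k} {a : ℕ} {b : S.obj a} (h : S.IsCycle b)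
    (f : ∀ a, S.obj a →ₗ[k] S'.obj a)
    (hf : ∀ {a a' : ℕ} (v : Fin (a' + 1) →o Fin (a + 1)) (x : S.obj a),
      S'.pull v (f a x) = f a' (S.pull v x)) : S'.IsCycle (f a b) :=
  fun v hv => by rw [hf, h v hv, map_zero]

theorem IsMoore.map {S' : SimpMod.{u, w} k} {a : ℕ} {b : S.obj a} (h : S.IsMoore b)
    (f : ∀ a, S.obj a →ₗ[k] S'.obj a)
    (hf : ∀ {a a' : ℕ} (v : Fin (a' + 1) →o Fin (a + 1)) (x : S.obj a),
      S'.pull v (f a x) = f a' (S.pull v x)) : S'.IsMoore (f a b) :=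
  fun v x h0 hv => by rw [hf, h v x h0 hv, map_zero]

end SimpMod

/-! ### Alternating-sum projectors on Moore elements and on normal elements. -/

/-- Lowers the elements of `A` by one. -/
def lower {a : ℕ} (A : Finset (Fin (a + 1))) : Fin (a + 1) →o Fin (a + 1) where
  toFun j := ⟨j - if j ∈ A then 1 else 0, by omega⟩
  monotone' i j h := by
    rw [Fin.le_def] at h ⊢
    simp only
    rcases h.eq_or_lt with h | h
    · rw [Fin.ext h]
    · split_ifs <;> omega

/-- Raises the elements of `A`, except the last one, by one. -/
def raise {a : ℕ} (A : Finset (Fin (a + 1))) : Fin (a + 1) →o Fin (a + 1) where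
  toFun j := ⟨min a (j + if j ∈ A then 1 else 0), by omega⟩
  monotone' i j h := by
    rw [Fin.le_def] at h ⊢
    simp only
    rcases h.eq_or_lt with h | h
    · rw [Fin.ext h]
    · split_ifs <;> omega

theorem lower_val {a : ℕ} (A : Finset (Fin (a + 1))) (j : Fin (a + 1)) :
    (lower A j : ℕ) = j - if j ∈ A then 1 else 0 := rfl

theorem raise_val {a : ℕ} (A : Finset (Fin (a + 1))) (j : Fin (a + 1)) :
    (raise A j : ℕ) = min a (j + if j ∈ A then 1 else 0) := rfl

/-- A sum over the subsets of a set with alternating signs vanishes if the terms do not depend on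
whether a given element belongs to the subset. -/
theorem sum_powerset_eq_zero {ι V : Type*} [DecidableEq ι] [AddCommGroup V] [Module k V]
    (s : Finset ι) (x : ι) (hx : x ∈ s) (f : Finset ι → V)
    (h : ∀ A, x ∉ A → f (insert x A) = f A) :
    ∑ A ∈ s.powerset, (-1 : k) ^ A.card • f A = 0 := by
  rw [← Finset.insert_erase hx, Finset.sum_powerset_insert (Finset.notMem_erase x s),
    ← Finset.sum_add_distrib]
  refine Finset.sum_eq_zero fun A hA => ?_
  have hxA : x ∉ A := fun hh => Finset.notMem_erase x s (Finset.mem_powerset.1 hA hh)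
  rw [Finset.card_insert_of_notMem hxA, h A hxA, ← add_smul]
  simp [pow_succ]

theorem lower_empty {a : ℕ} : lower (∅ : Finset (Fin (a + 1))) = OrderHom.id := by
  ext j; simp [lower_val]

theorem raise_empty {a : ℕ} : raise (∅ : Finset (Fin (a + 1))) = OrderHom.id := by
  ext j; simp [raise_val]; omega

/-- The maximum of `A` is omitted: elements of `A` land strictly below it and the others do not
move. -/
theorem exists_lower_ne {a : ℕ} {A : Finset (Fin (a + 1))} (hA : A ⊆ Finset.univ.erase 0)
    (hne : A ≠ ∅) : ∃ x, x ≠ 0 ∧ ∀ j, lower A j ≠ x := by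
  have hn := Finset.nonempty_iff_ne_empty.2 hne
  refine ⟨A.max' hn, ?_, fun j hj => ?_⟩
  · exact Finset.ne_of_mem_erase (hA (A.max'_mem hn))
  · have h0 : A.max' hn ≠ 0 := Finset.ne_of_mem_erase (hA (A.max'_mem hn))
    have h0' : ((A.max' hn : Fin (a + 1)) : ℕ) ≠ 0 := fun h => h0 (Fin.ext h)
    have hv := congrArg Fin.val hj
    rw [lower_val] at hv
    by_cases h : j ∈ A
    · have := Fin.le_def.1 (A.le_max' j h)
      rw [if_pos h] at hv
      omega
    · rw [if_neg h] at hv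
      exact h (by rw [show j = A.max' hn from Fin.ext (by simpa using hv)]; exact A.max'_mem hn)

/-- Dually, the minimum of `A` is omitted; since it is not the last element, the truncation at `a`
does no harm. -/
theorem exists_raise_ne {a : ℕ} {A : Finset (Fin (a + 1))}
    (hA : A ⊆ Finset.univ.erase (Fin.last a))
    (hne : A ≠ ∅) : ∃ x, x ≠ Fin.last a ∧ ∀ j, raise A j ≠ x := by
  have hn := Finset.nonempty_iff_ne_empty.2 hne
  refine ⟨A.min' hn, ?_, fun j hj => ?_⟩
  · exact Finset.ne_of_mem_erase (hA (A.min'_mem hn))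
  · have h0 : A.min' hn ≠ Fin.last a := Finset.ne_of_mem_erase (hA (A.min'_mem hn))
    have h0' : ((A.min' hn : Fin (a + 1)) : ℕ) ≠ a := fun h => h0 (Fin.ext h)
    have hv := congrArg Fin.val hj
    rw [raise_val] at hv
    by_cases h : j ∈ A
    · have := Fin.le_def.1 (A.min'_le j h)
      rw [if_pos h] at hv
      omega
    · rw [if_neg h] at hv
      exact h (by rw [show j = A.min' hn from Fin.ext (by omega)]; exact A.min'_mem hn)

theorem raise_not_injective {a : ℕ} {A : Finset (Fin (a + 1))}
    (hA : A ⊆ Finset.univ.erase (Fin.last a)) (hne : A ≠ ∅) :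
    ¬ Function.Injective (raise A) := by
  intro hi
  obtain ⟨x, _, hx⟩ := exists_raise_ne hA hne
  obtain ⟨j, hj⟩ := Finite.surjective_of_injective hi x
  exact hx j hj

namespace SimpMod

variable (S : SimpMod.{u, v} k)

/-- The projection on the elements all of whose faces but the zeroth one vanish. -/
def moore (a : ℕ) : S.obj a →ₗ[k] S.obj a :=
  ∑ A ∈ (Finset.univ.erase (0 : Fin (a + 1))).powerset, (-1 : k) ^ A.card • S.pull (lower A)

variable {S}

/-- If `v` misses `x`, then `lower A ∘ v` does not see whether `x` belongs to `A`, so the terms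
cancel in pairs. -/
theorem isMoore_moore {a : ℕ} (b : S.obj a) : S.IsMoore (S.moore a b) := by
  intro a' v x h0 hv
  simp only [moore, LinearMap.sum_apply, LinearMap.smul_apply, map_sum, map_smul, pull_pull]
  refine sum_powerset_eq_zero _ x (by simp [h0]) _ fun A hA => ?_
  congr 2
  ext j
  simp [lower_val, hv j]

theorem moore_eq {a : ℕ} {b : S.obj a} (h : S.IsMoore b) : S.moore a b = b := by
  simp only [moore, LinearMap.sum_apply, LinearMap.smul_apply]
  rw [Finset.sum_eq_single ∅]
  · simp [lower_empty, S.pull_id]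
  · intro A hA hne
    obtain ⟨x, hx, hx'⟩ := exists_lower_ne (Finset.mem_powerset.1 hA) hne
    rw [h _ x hx hx', smul_zero]
  · simp

/-- The projector is a universal combination of simplicial operators. In a bisimplicial module it
therefore commutes with the operators of the other direction and with differentials. -/
theorem moore_map {S' : SimpMod.{u, w} k} {a : ℕ} 
    (f : S.obj a →ₗ[k] S'.obj a)
    (hf : ∀ (v : Fin (a + 1) →o Fin (a + 1)) (x : S.obj a),
      S'.pull v (f x) = f (S.pull v x)) (b : S.obj a) : S'.moore a (f b) = f (S.moore a b) := by
  simp [moore, LinearMap.sum_apply, hf]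

end SimpMod

namespace CosMod

variable (C : CosMod.{u, v} k)

/-- All codegeneracies of `c` vanish. -/
def IsNormal {a : ℕ} (c : C.obj a) : Prop :=
  ∀ {b : ℕ} (u : Fin (a + 1) →o Fin (b + 1)), ¬ Function.Injective u → C.push u c = 0

/-- The projection on the intersection of the kernels of the codegeneracies. -/
def normal (a : ℕ) : C.obj a →ₗ[k] C.obj a :=
  ∑ A ∈ (Finset.univ.erase (Fin.last a)).powerset, (-1 : k) ^ A.card • C.push (raise A)

variable {C}

theorem push_push {a b c : ℕ} (u : Fin (a + 1) →o Fin (b + 1)) (v : Fin (b + 1) →o Fin (c + 1))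
    (x : C.obj a) : C.push v (C.push u x) = C.push (v.comp u) x := by
  rw [C.push_comp]; rfl

theorem isNormal_of_codegen {a : ℕ} {c : C.obj (a + 1)} (h : ∀ x, C.push (codegen x) c = 0) :
    C.IsNormal c := by
  intro b u hu
  obtain ⟨x, u', rfl⟩ := exists_eq_comp_codegen u hu
  rw [C.push_comp, LinearMap.comp_apply, h, map_zero]

theorem isNormal_zero (c : C.obj 0) : C.IsNormal c := by
  intro b u hu
  exact absurd (Function.injective_of_subsingleton (α := Fin 1) u) hu

/-- A monotone map that is not injective identifies some `x` with `x + 1`. After it, raising or not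
raising `x` makes no difference, and the terms cancel in pairs. -/
theorem isNormal_normal {a : ℕ} (c : C.obj a) : C.IsNormal (C.normal a c) := by
  intro b u hu
  obtain ⟨x, y, hxy, h⟩ := exists_castSucc_eq_succ u hu
  simp only [normal, LinearMap.sum_apply, LinearMap.smul_apply, map_sum, map_smul, push_push]
  refine sum_powerset_eq_zero _ x ?_ _ fun A hA => ?_
  · rw [Finset.mem_erase]
    refine ⟨?_, Finset.mem_univ _⟩
    rintro rfl
    have := y.is_lt
    simp at hxy
    omega
  · congr 2
    ext j
    simp only [OrderHom.comp_coe, Function.comp_apply]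
    by_cases hj : j = x
    · subst hj
      have e1 : raise (insert j A) j = y := Fin.ext (by simp [raise_val, hxy]; omega)
      have e2 : raise A j = j := Fin.ext (by simp [raise_val, hA]; omega)
      rw [e1, e2, h]
    · congr 2
      exact Fin.ext (by simp [raise_val, hj])

theorem normal_eq {a : ℕ} {c : C.obj a} (h : C.IsNormal c) : C.normal a c = c := by
  simp only [normal, LinearMap.sum_apply, LinearMap.smul_apply]
  rw [Finset.sum_eq_single ∅]
  · simp [raise_empty, C.push_id]
  · intro A hA hne
    rw [h _ (raise_not_injective (Finset.mem_powerset.1 hA) hne), smul_zero]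
  · simp

/-- The image of this coface misses the position `x`, so again the terms with and without `x` in `A`
cancel. The projector thus factors through the quotient by all cofaces but the last. -/
theorem normal_face {a : ℕ} (x : Fin (a + 1)) (c : C.obj a) :
    C.normal (a + 1) (C.push (face x.castSucc) c) = 0 := by
  simp only [normal, LinearMap.sum_apply, LinearMap.smul_apply, push_push]
  refine sum_powerset_eq_zero _ x.castSucc ?_ _ fun A hA => ?_
  · simp [Fin.ext_iff]; omega
  · congr 2
    ext j
    have : Fin.succAbove x.castSucc j ≠ x.castSucc := Fin.succAbove_ne _ _
    simp [raise_val, this]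

/-- The identity is the normalization modulo the images of the cofaces but the last one. -/
theorem sub_normal_mem {a : ℕ} (c : C.obj (a + 1)) : c - C.normal (a + 1) c ∈
    ⨆ x : Fin (a + 1), LinearMap.range (C.push (face x.castSucc)) := by
  simp only [normal, LinearMap.sum_apply, LinearMap.smul_apply]
  rw [← Finset.sum_erase_add _ _ (Finset.empty_mem_powerset _)]
  simp only [Finset.card_empty, pow_zero, one_smul, raise_empty, C.push_id, LinearMap.id_apply]
  rw [sub_add_cancel_right]
  refine Submodule.neg_mem _ (Submodule.sum_mem _ fun A hA => Submodule.smul_mem _ _ ?_)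
  rw [Finset.mem_erase, Finset.mem_powerset] at hA
  obtain ⟨x, hx, hx'⟩ := exists_raise_ne hA.2 hA.1
  obtain ⟨v', hv'⟩ := exists_eq_face_comp _ x hx'
  obtain ⟨y, rfl⟩ := Fin.exists_castSucc_eq.2 hx
  refine Submodule.mem_iSup_of_mem y ⟨C.push v' c, ?_⟩
  rw [push_push, ← hv']

end CosMod

end Abstract
end QuasiComm
end

noncomputable section

namespace QuasiComm

/-! ### The Whitney-type formula that spreads one element into a compatible family. -/

section Whitney

variable {k : Type u} [CommRing k]

instance instFintypeOrderHom (a b : ℕ) : Fintype (Fin a →o Fin b) :=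
  Fintype.ofInjective (fun u => (u : Fin a → Fin b)) DFunLike.coe_injective

/-- The monotone map whose value at `j` is the number of the `t i` that are at most `j`. -/
def count {r p : ℕ} (t : Fin (r + 1) → Fin (p + 2)) : Fin (p + 1) →o Fin (r + 2) where
  toFun j := ⟨(Finset.univ.filter fun i => t i ≤ j.castSucc).card,
    Nat.lt_succ_of_le ((Finset.card_filter_le _ _).trans (by simp))⟩
  monotone' i j h := by
    rw [Fin.le_def]
    refine Finset.card_le_card (fun x hx => ?_ : (Finset.univ.filter fun x => t x ≤ i.castSucc) ⊆
      Finset.univ.filter fun x => t x ≤ j.castSucc)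
    rw [Finset.mem_filter] at hx ⊢
    exact ⟨hx.1, hx.2.trans (Fin.castSucc_le_castSucc_iff.2 h)⟩

theorem count_val {r p : ℕ} (t : Fin (r + 1) → Fin (p + 2)) (j : Fin (p + 1)) :
    (count t j : ℕ) = (Finset.univ.filter fun i => t i ≤ j.castSucc).card := rfl

/-- The number of the elements whose image is less than `t`. -/
def lowerAdjoint {p p' : ℕ} (v : Fin (p + 1) →o Fin (p' + 1)) (t : Fin (p' + 2)) : Fin (p + 2) :=
  ⟨(Finset.univ.filter fun j => (v j).castSucc < t).card,
    Nat.lt_succ_of_le ((Finset.card_filter_le _ _).trans (by simp))⟩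

/-- This is a Galois connection: the elements with image below `t` form an initial segment because
`v` is monotone. The value past the end stands for a threshold that is never reached, hence the
types `Fin (p + 2)`. -/
theorem lowerAdjoint_le {p p' : ℕ} (v : Fin (p + 1) →o Fin (p' + 1)) (t : Fin (p' + 2))
    (j : Fin (p + 1)) : lowerAdjoint v t ≤ j.castSucc ↔ t ≤ (v j).castSucc := by
  rw [Fin.le_def]
  constructor
  · intro h
    by_contra hlt
    rw [not_le] at hlt
    have h2 : Finset.Iic j ⊆ Finset.univ.filter fun j => (v j).castSucc < t := fun i hi => by
      rw [Finset.mem_filter]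
      exact ⟨Finset.mem_univ _, lt_of_le_of_lt
        (Fin.castSucc_le_castSucc_iff.2 (v.monotone (Finset.mem_Iic.1 hi))) hlt⟩
    have := Finset.card_le_card h2
    rw [Fin.card_Iic] at this
    simp only [lowerAdjoint, Fin.val_castSucc] at h
    omega
  · intro h
    have h2 : (Finset.univ.filter fun j => (v j).castSucc < t) ⊆ Finset.Iio j := fun i hi => by
      rw [Finset.mem_filter] at hi
      rw [Finset.mem_Iio]
      by_contra hij
      exact absurd (h.trans (Fin.castSucc_le_castSucc_iff.2 (v.monotone (not_lt.1 hij))))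
        (not_le.2 hi.2)
    have := Finset.card_le_card h2
    rw [Fin.card_Iio] at this
    simpa [lowerAdjoint] using this

theorem count_comp {r p p' : ℕ} (v : Fin (p + 1) →o Fin (p' + 1)) (t : Fin (r + 1) → Fin (p' + 2)) :
    (count t).comp v = count (lowerAdjoint v ∘ t) := by
  ext j
  simp [count_val, lowerAdjoint_le]

variable (k) in
/-- The difference of the indicators of `x` and `x + 1`. -/
def jump {p : ℕ} (x : Fin (p + 1)) (t : Fin (p + 2)) : k :=
  (if x.castSucc = t then 1 else 0) - if x.succ = t then 1 else 0

/-- By the adjunction, the fibre of `v` over `x` is the interval between the adjoints of `x` and `x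
+ 1`, and the sum telescopes over it. -/
theorem sum_fiber_jump {p p' : ℕ} (v : Fin (p + 1) →o Fin (p' + 1)) (x : Fin (p' + 1))
    (t : Fin (p + 2)) : ∑ j with v j = x, jump k j t =
      (if lowerAdjoint v x.castSucc = t then 1 else 0) -
        if lowerAdjoint v x.succ = t then 1 else 0 := by
  have hle : lowerAdjoint v x.castSucc ≤ lowerAdjoint v x.succ := by
    rw [Fin.le_def]
    refine Finset.card_le_card (fun j hj => ?_ : (Finset.univ.filter fun j =>
      (v j).castSucc < x.castSucc) ⊆ Finset.univ.filter fun j => (v j).castSucc < x.succ)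
    rw [Finset.mem_filter] at hj ⊢
    exact ⟨hj.1, hj.2.trans Fin.castSucc_lt_succ⟩
  have hmem : ∀ j, v j = x ↔ (lowerAdjoint v x.castSucc : ℕ) ≤ j ∧ (j : ℕ) < lowerAdjoint v x.succ := by
    intro j
    have h1 := lowerAdjoint_le v x.castSucc j
    have h2 := (lowerAdjoint_le v x.succ j).not
    rw [Fin.le_def, Fin.val_castSucc, Fin.castSucc_le_castSucc_iff] at h1
    rw [Fin.le_def, Fin.val_castSucc, Fin.succ_le_castSucc_iff, not_lt, not_le] at h2
    rw [h1, h2]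
    exact ⟨fun h => ⟨h.ge, h.le⟩, fun h => le_antisymm h.2 h.1⟩
  set l := lowerAdjoint v x.castSucc
  set h := lowerAdjoint v x.succ
  let f : ℕ → k := fun i => if i = (t : ℕ) then 1 else 0
  have e : ∀ j : Fin (p + 1), jump k j t = f j - f (j + 1) := by
    intro j
    simp [jump, f, Fin.ext_iff]
  have e2 : ∑ j with v j = x, jump k j t = ∑ i ∈ Finset.Ico (l : ℕ) h, (f i - f (i + 1)) := by
    refine Finset.sum_bij (fun j _ => (j : ℕ)) ?_ ?_ ?_ ?_
    · intro j hj
      rw [Finset.mem_filter] at hj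
      rw [Finset.mem_Ico]
      exact (hmem j).1 hj.2
    · intro i _ j _ hij
      exact Fin.ext hij
    · intro i hi
      rw [Finset.mem_Ico] at hi
      have : i < p + 1 := by have := h.is_lt; omega
      exact ⟨⟨i, this⟩, by simpa [hmem] using hi, rfl⟩
    · intro j _
      exact e j
  rw [e2, Finset.sum_Ico_eq_sum_range]
  have e3 := Finset.sum_range_sub' (fun i => f (l + i)) (h - l)
  refine e3.trans ?_
  have : (l : ℕ) + (h - l) = h := Nat.add_sub_cancel' (Fin.le_def.1 hle)
  simp only [this, add_zero, f, Fin.ext_iff]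

/-- The pushforward of `jump k x` along the adjoint equals the fibre sum of `sum_fiber_jump`. This
coincidence, taken for each factor, is the whole naturality of the coefficients. -/
theorem sum_jump_of_lowerAdjoint {p p' : ℕ} (v : Fin (p + 1) →o Fin (p' + 1)) (x : Fin (p' + 1))
    (t : Fin (p + 2)) : ∑ τ with lowerAdjoint v τ = t, jump k x τ =
      (if lowerAdjoint v x.castSucc = t then 1 else 0) -
        if lowerAdjoint v x.succ = t then 1 else 0 := by
  simp only [jump, Finset.sum_sub_distrib]
  congr 1
  · rw [Finset.sum_ite_eq]
    simp
  · rw [Finset.sum_ite_eq]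
    simp

variable (S : SimpMod.{u, v} k) (C : CosMod.{u, w} k)

/-- The map `S_{r + 1} → S_p` that gives the coefficient of the face `u` in Whitney's elementary
form. -/
def whitneyCoeff {r p : ℕ} (u : Fin (r + 1) →o Fin (p + 1)) : S.obj (r + 1) →ₗ[k] S.obj p :=
  ∑ t : Fin (r + 1) → Fin (p + 2), (∏ i, jump k (u i) (t i)) • S.pull (count t)

/-- Both sides expand as sums over thresholds `t` with coefficient a product over `i`. On the right
the product collects the lifts of the points `u' i` through the fibres of `v`; on the left it
collects the thresholds with given adjoints. The two lemmas on `jump` identify the factors. -/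
theorem pull_whitneyCoeff {r p p' : ℕ} (v : Fin (p + 1) →o Fin (p' + 1))
    (u' : Fin (r + 1) →o Fin (p' + 1)) (hu' : Function.Injective u') :
    S.pull v ∘ₗ whitneyCoeff S u' = ∑ u with v.comp u = u', whitneyCoeff S u := by
  classical
  have e1 : ∑ u with v.comp u = u', whitneyCoeff S u = ∑ t : Fin (r + 1) → Fin (p + 2),
      (∏ i, ((if lowerAdjoint v (u' i).castSucc = t i then (1 : k) else 0) -
        if lowerAdjoint v (u' i).succ = t i then 1 else 0)) • S.pull (count t) := by
    unfold whitneyCoeff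
    rw [Finset.sum_comm]
    refine Finset.sum_congr rfl fun t _ => ?_
    rw [← Finset.sum_smul]
    congr 1
    simp only [← sum_fiber_jump]
    rw [Finset.prod_univ_sum]
    refine Finset.sum_bij (fun u _ => ⇑u) ?_ ?_ ?_ ?_
    · intro u hu
      rw [Finset.mem_filter] at hu
      rw [Fintype.mem_piFinset]
      intro i
      rw [Finset.mem_filter]
      exact ⟨Finset.mem_univ _, DFunLike.congr_fun hu.2 i⟩
    · intro u _ u₁ _ h
      exact DFunLike.coe_injective h
    · intro x hx
      rw [Fintype.mem_piFinset] at hx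
      have hx' : ∀ i, v (x i) = u' i := fun i => (Finset.mem_filter.1 (hx i)).2
      -- Independent choices of points over the `u' i` form a monotone map because `u'` is strictly
      -- increasing. For a noninjective `u'` the expansion of the product would contain other terms.
      refine ⟨⟨x, fun i j hij => ?_⟩, ?_, rfl⟩
      · by_contra hlt
        have h1 := v.monotone (not_le.1 hlt).le
        rw [hx', hx'] at h1
        have h2 := hu' (le_antisymm (u'.monotone hij) h1)
        exact hlt (by rw [h2])
      · rw [Finset.mem_filter]
        exact ⟨Finset.mem_univ _, OrderHom.ext _ _ (funext hx')⟩
    · intro u _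
      rfl
  rw [e1]
  unfold whitneyCoeff
  have e2 : (S.pull v ∘ₗ ∑ t : Fin (r + 1) → Fin (p' + 2),
      (∏ i, jump k (u' i) (t i)) • S.pull (count t)) = ∑ t : Fin (r + 1) → Fin (p' + 2),
      (∏ i, jump k (u' i) (t i)) • S.pull (count (lowerAdjoint v ∘ t)) := by
    ext x
    simp [LinearMap.sum_apply, SimpMod.pull_pull, count_comp]
  rw [e2, ← Finset.sum_fiberwise _ (fun t => lowerAdjoint v ∘ t)]
  refine Finset.sum_congr rfl fun t _ => ?_
  have e3 : ∑ t' with lowerAdjoint v ∘ t' = t,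
      (∏ i, jump k (u' i) (t' i)) • S.pull (count (lowerAdjoint v ∘ t')) =
      ∑ t' with lowerAdjoint v ∘ t' = t, (∏ i, jump k (u' i) (t' i)) • S.pull (count t) := by
    refine Finset.sum_congr rfl fun t' ht' => ?_
    rw [(Finset.mem_filter.1 ht').2]
  rw [e3, ← Finset.sum_smul]
  congr 1
  simp only [← sum_jump_of_lowerAdjoint]
  rw [Finset.prod_univ_sum]
  refine Finset.sum_congr ?_ fun _ _ => rfl
  ext t'
  simp [Fintype.mem_piFinset, funext_iff]

/-- Only thresholds with `t i` equal to `i` or `i + 1` have a nonzero coefficient. The choice `t i =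
i` for all `i` gives the zeroth face; any other choice gives a map that omits a nonzero value, which
kills a Moore element. -/
theorem whitneyCoeff_id {r : ℕ} {b : S.obj (r + 1)} (h : S.IsMoore b) :
    whitneyCoeff S (OrderHom.id : Fin (r + 1) →o Fin (r + 1)) b = S.pull (face 0) b := by
  simp only [whitneyCoeff, LinearMap.sum_apply, LinearMap.smul_apply, OrderHom.id_coe, id]
  rw [Finset.sum_eq_single (fun i => i.castSucc)]
  · have e : count (fun i : Fin (r + 1) => i.castSucc) = face 0 := by
      ext j
      have : (Finset.univ.filter fun x : Fin (r + 1) => x ≤ j) = Finset.Iic j := by ext; simp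
      simp [count_val, this]
    rw [e]
    have : ∀ i : Fin (r + 1), jump k i i.castSucc = 1 := fun i => by simp [jump, Fin.ext_iff]
    simp [this]
  · intro t _ ht
    by_cases h0 : ∀ i, t i = i.castSucc ∨ t i = i.succ
    · obtain ⟨i₀, hi₀⟩ : ∃ i, t i ≠ i.castSucc := by
        by_contra hh
        push Not at hh
        exact ht (funext hh)
      -- the value after the last index that jumps late is omitted
      have hn : (Finset.univ.filter fun i => t i ≠ i.castSucc).Nonempty := ⟨i₀, by simp [hi₀]⟩
      obtain ⟨m, hm, hmax⟩ := Finset.exists_max_image _ id hn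
      simp only [Finset.mem_filter, Finset.mem_univ, true_and, id] at hm hmax
      have hm' := (h0 m).resolve_left hm
      rw [h _ m.succ (Fin.succ_ne_zero m) ?_, smul_zero]
      intro j hj
      have hv := congrArg Fin.val hj
      rw [count_val, Fin.val_succ] at hv
      rcases le_or_gt j m with hjm | hjm
      · have hsub : (Finset.univ.filter fun i => t i ≤ j.castSucc) ⊆ Finset.Iio m := by
          intro i hi
          simp only [Finset.mem_filter, Finset.mem_univ, true_and, Fin.le_def,
            Fin.val_castSucc] at hi
          rw [Finset.mem_Iio, Fin.lt_def]
          rw [Fin.le_def] at hjm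
          by_cases him : i = m
          · subst him
            rw [hm'] at hi
            simp at hi
            omega
          · have : (i : ℕ) ≠ m := fun h => him (Fin.ext h)
            rcases h0 i with h1 | h1 <;> rw [h1] at hi <;> simp at hi <;> omega
        have := Finset.card_le_card hsub
        rw [Fin.card_Iio] at this
        have : (Finset.univ.filter fun i => t i ≤ j.castSucc).card = m + 1 := hv
        omega
      · have hsub : Finset.Iic j ⊆ (Finset.univ.filter fun i => t i ≤ j.castSucc) := by
          intro i hi
          rw [Finset.mem_Iic, Fin.le_def] at hi
          simp only [Finset.mem_filter, Finset.mem_univ, true_and, Fin.le_def,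
            Fin.val_castSucc]
          by_cases him : i ≤ m
          · rw [Fin.le_def] at him
            rw [Fin.lt_def] at hjm
            rcases h0 i with h1 | h1 <;> rw [h1] <;> simp <;> omega
          · have : t i = i.castSucc := by
              by_contra hh
              exact him (hmax i hh)
            rw [this]
            exact hi
        have := Finset.card_le_card hsub
        rw [Fin.card_Iic] at this
        rw [Fin.lt_def] at hjm
        have : (Finset.univ.filter fun i => t i ≤ j.castSucc).card = m + 1 := hv
        omega
    · push Not at h0
      obtain ⟨i, h1, h2⟩ := h0
      rw [Finset.prod_eq_zero (Finset.mem_univ i), zero_smul]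
      simp [jump, h1.symm, h2.symm]
  · simp

variable {S C}

/-- The element of degree `p` of the compatible family generated by an element of
`C^r ⊗ S_{r + 1}`. -/
def whitney (C : CosMod.{u, w} k) (S : SimpMod.{u, v} k) (r p : ℕ) :
    C.obj r ⊗[k] S.obj (r + 1) →ₗ[k] C.obj p ⊗[k] S.obj p :=
  ∑ u : Fin (r + 1) →o Fin (p + 1), TensorProduct.map (C.push u) (whitneyCoeff S u)

end Whitney

/-! ### Compatibility and leading term of the Whitney family. -/

section Tensor

variable {k : Type u} [CommRing k]

/-- The tensor product of a module and a simplicial module. -/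
abbrev SimpMod.lTensor (V : Type w) [AddCommGroup V] [Module k V] (S : SimpMod.{u, v} k) :
    SimpMod.{u, max v w} k where
  obj a := V ⊗[k] S.obj a
  pull v := (S.pull v).lTensor V
  pull_id a := by rw [S.pull_id, LinearMap.lTensor_id]
  pull_comp u v := by rw [S.pull_comp, LinearMap.lTensor_comp]

/-- The tensor product of a simplicial module and a module. -/
abbrev SimpMod.rTensor (S : SimpMod.{u, v} k) (V : Type w) [AddCommGroup V] [Module k V] :
    SimpMod.{u, max v w} k where
  obj a := S.obj a ⊗[k] V
  pull v := (S.pull v).rTensor V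
  pull_id a := by rw [S.pull_id, LinearMap.rTensor_id]
  pull_comp u v := by rw [S.pull_comp, LinearMap.rTensor_comp]

/-- The tensor product of a module and a cosimplicial module. -/
abbrev CosMod.lTensor (V : Type w) [AddCommGroup V] [Module k V] (C : CosMod.{u, v} k) :
    CosMod.{u, max v w} k where
  obj a := V ⊗[k] C.obj a
  push v := (C.push v).lTensor V
  push_id a := by rw [C.push_id, LinearMap.lTensor_id]
  push_comp u v := by rw [C.push_comp, LinearMap.lTensor_comp]

/-- The tensor product of a cosimplicial module and a module. -/
abbrev CosMod.rTensor (C : CosMod.{u, v} k) (V : Type w) [AddCommGroup V] [Module k V] :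
    CosMod.{u, max v w} k where
  obj a := C.obj a ⊗[k] V
  push v := (C.push v).rTensor V
  push_id a := by rw [C.push_id, LinearMap.rTensor_id]
  push_comp u v := by rw [C.push_comp, LinearMap.rTensor_comp]

variable {C : CosMod.{u, w} k} {S : SimpMod.{u, v} k}

theorem map_push_eq_zero {r a p b : ℕ} {ξ : C.obj r ⊗[k] S.obj a}
    (hξ : (C.rTensor (S.obj a)).IsNormal ξ) (u : Fin (r + 1) →o Fin (p + 1))
    (hu : ¬ Function.Injective u) (g : S.obj a →ₗ[k] S.obj b) :
    TensorProduct.map (C.push u) g ξ = 0 := by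
  have h : (C.push u).rTensor (S.obj a) ξ = 0 := hξ u hu
  rw [← LinearMap.lTensor_comp_rTensor, LinearMap.comp_apply, h, map_zero]

/-- The family generated by a normal element is compatible. -/
theorem whitney_compatible {r p p' : ℕ} (v : Fin (p + 1) →o Fin (p' + 1))
    {ξ : C.obj r ⊗[k] S.obj (r + 1)} (hξ : (C.rTensor (S.obj (r + 1))).IsNormal ξ) :
    (C.push v).rTensor (S.obj p) (whitney C S r p ξ) =
      (S.pull v).lTensor (C.obj p') (whitney C S r p' ξ) := by
  classical
  simp only [whitney, LinearMap.sum_apply, map_sum]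
  rw [← Finset.sum_fiberwise _ (fun u => v.comp u)]
  refine Finset.sum_congr rfl fun u' _ => ?_
  -- The pushforward along `v` regroups the terms by `u' = v ∘ u`. For injective `u'` the
  -- coefficients match by `pull_whitneyCoeff`; the other `u'` contribute zero on a normal element.
  have e1 : ∑ u with v.comp u = u', (C.push v).rTensor (S.obj p)
      (TensorProduct.map (C.push u) (whitneyCoeff S u) ξ) =
      TensorProduct.map (C.push u') (∑ u with v.comp u = u', whitneyCoeff S u) ξ := by
    have e := map_sum (TensorProduct.mapBilinear (RingHom.id k) (C.obj r) (S.obj (r + 1)) (C.obj p') (S.obj p) (C.push u'))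
      (fun u => whitneyCoeff S u) (Finset.univ.filter fun u => v.comp u = u')
    refine Eq.trans ?_ (LinearMap.congr_fun e ξ).symm
    rw [LinearMap.sum_apply]
    refine Finset.sum_congr rfl fun u hu => ?_
    rw [← (Finset.mem_filter.1 hu).2, C.push_comp, ← LinearMap.comp_apply,
      LinearMap.rTensor_comp_map]
    rfl
  rw [e1, ← LinearMap.comp_apply, LinearMap.lTensor_comp_map]
  by_cases hu' : Function.Injective u'
  · rw [pull_whitneyCoeff S v u' hu']
  · rw [map_push_eq_zero hξ u' hu', map_push_eq_zero hξ u' hu']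

theorem whitney_of_lt {r p : ℕ} (h : p < r) {ξ : C.obj r ⊗[k] S.obj (r + 1)}
    (hξ : (C.rTensor (S.obj (r + 1))).IsNormal ξ) : whitney C S r p ξ = 0 := by
  rw [whitney, LinearMap.sum_apply]
  refine Finset.sum_eq_zero fun u _ => map_push_eq_zero hξ u (fun hu => ?_) _
  have := Fintype.card_le_of_injective u hu
  simp at this
  omega

theorem orderHom_eq_id_of_injective {r : ℕ} (u : Fin (r + 1) →o Fin (r + 1))
    (hu : Function.Injective u) : u = OrderHom.id := by
  have hs : StrictMono u := u.monotone.strictMono_of_injective hu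
  have hsurj : Function.Surjective u := Finite.surjective_of_injective hu
  have := Subsingleton.elim (hs.orderIsoOfSurjective u hsurj) (OrderIso.refl _)
  ext j
  exact congrArg Fin.val (DFunLike.congr_fun this j)

theorem whitneyCoeff_lTensor {r p : ℕ} (V : Type w) [AddCommGroup V] [Module k V]
    (u : Fin (r + 1) →o Fin (p + 1)) :
    (whitneyCoeff S u).lTensor V = whitneyCoeff (S.lTensor V) u := by
  change LinearMap.lTensorHom V (whitneyCoeff S u) = _
  rw [whitneyCoeff, map_sum]
  refine Finset.sum_congr rfl fun t _ => ?_
  rw [map_smul]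
  rfl

/-- Normality leaves only injective maps `[r] → [r]`, that is, the identity, and its coefficient on
Moore elements is the zeroth face. So lifting `x` to a Moore element with zeroth face `x` gives a
family with leading component `x`. -/
theorem whitney_self {r : ℕ} {ξ : C.obj r ⊗[k] S.obj (r + 1)}
    (hξ : (C.rTensor (S.obj (r + 1))).IsNormal ξ) (hm : (S.lTensor (C.obj r)).IsMoore ξ) :
    whitney C S r r ξ = (S.pull (face 0)).lTensor (C.obj r) ξ := by
  rw [whitney, LinearMap.sum_apply, Finset.sum_eq_single OrderHom.id]
  · rw [C.push_id]
    change (whitneyCoeff S OrderHom.id).lTensor _ ξ = _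
    rw [whitneyCoeff_lTensor]
    exact whitneyCoeff_id _ hm
  · intro u _ hu
    exact map_push_eq_zero hξ u (fun h => hu (orderHom_eq_id_of_injective u h)) _
  · simp

end Tensor
end QuasiComm
end

noncomputable section

namespace QuasiComm

/-! ### Zigzags in bisimplicial modules with exact rows and columns. -/

section Bisimplicial

/-- A bisimplicial `k`-module. -/
structure BiSimp (k : Type u) [CommRing k] where
  obj : ℕ → ℕ → Type v
  [addCommGroup : ∀ p q, AddCommGroup (obj p q)]
  [module : ∀ p q, Module k (obj p q)]
  pull₁ : ∀ {a b : ℕ} (q : ℕ), (Fin (a + 1) →o Fin (b + 1)) → obj b q →ₗ[k] obj a q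
  pull₂ : ∀ {a b : ℕ} (p : ℕ), (Fin (a + 1) →o Fin (b + 1)) → obj p b →ₗ[k] obj p a
  pull₁_id : ∀ a q, pull₁ q (OrderHom.id : Fin (a + 1) →o Fin (a + 1)) = LinearMap.id
  pull₁_comp : ∀ {a b c : ℕ} (q : ℕ) (u : Fin (a + 1) →o Fin (b + 1))
    (v : Fin (b + 1) →o Fin (c + 1)), pull₁ q (v.comp u) = pull₁ q u ∘ₗ pull₁ q v
  pull₂_id : ∀ p a, pull₂ p (OrderHom.id : Fin (a + 1) →o Fin (a + 1)) = LinearMap.id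
  pull₂_comp : ∀ {a b c : ℕ} (p : ℕ) (u : Fin (a + 1) →o Fin (b + 1))
    (v : Fin (b + 1) →o Fin (c + 1)), pull₂ p (v.comp u) = pull₂ p u ∘ₗ pull₂ p v
  pull_comm : ∀ {a b a' b' : ℕ} (u : Fin (a + 1) →o Fin (b + 1)) (v : Fin (a' + 1) →o Fin (b' + 1))
    (x : obj b b'), pull₁ a' u (pull₂ b v x) = pull₂ a v (pull₁ b' u x)

attribute [instance] BiSimp.addCommGroup BiSimp.module

namespace BiSimp

variable {k : Type u} [CommRing k]

/-- The simplicial module of the elements of second degree `q`. -/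
abbrev row (Q : BiSimp.{u, v} k) (q : ℕ) : SimpMod.{u, v} k where
  obj p := Q.obj p q
  pull u := Q.pull₁ q u
  pull_id a := Q.pull₁_id a q
  pull_comp u v := Q.pull₁_comp q u v

/-- The simplicial module of the elements of first degree `p`. -/
abbrev col (Q : BiSimp.{u, v} k) (p : ℕ) : SimpMod.{u, v} k where
  obj q := Q.obj p q
  pull u := Q.pull₂ p u
  pull_id a := Q.pull₂_id p a
  pull_comp u v := Q.pull₂_comp p u v

variable {Q : BiSimp.{u, v} k}

theorem moore₁_isMoore₂ {p q : ℕ} {x : Q.obj p q} (h : (Q.col p).IsMoore x) :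
    (Q.col p).IsMoore ((Q.row q).moore p x) := by
  intro a v y h0 hv
  change Q.pull₂ p v _ = 0
  have := SimpMod.moore_map (S := Q.row q) (S' := Q.row a) (a := p) (Q.pull₂ p v)
    (fun u x => Q.pull_comm u v x) x
  rw [← this]
  have h2 : Q.pull₂ p v x = 0 := h v y h0 hv
  rw [h2, map_zero]

theorem moore₂_isMoore₁ {p q : ℕ} {x : Q.obj p q} (h : (Q.row q).IsMoore x) :
    (Q.row q).IsMoore ((Q.col p).moore q x) := by
  intro a v y h0 hv
  change Q.pull₁ q v _ = 0
  have := SimpMod.moore_map (S := Q.col p) (S' := Q.col a) (a := q) (Q.pull₁ q v)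
    (fun u x => (Q.pull_comm v u x).symm) x
  rw [← this]
  have h2 : Q.pull₁ q v x = 0 := h v y h0 hv
  rw [h2, map_zero]

/-- The rows of index less than `t` are exact. -/
def RowExact (Q : BiSimp.{u, v} k) (t : ℕ) : Prop :=
  ∀ p q, q < t → ∀ x : Q.obj p q, (Q.row q).IsCycle x →
    ∃ y : Q.obj (p + 1) q, (Q.row q).IsMoore y ∧ Q.pull₁ q (face 0) y = x

/-- The columns of index less than `t` are exact. -/
def ColExact (Q : BiSimp.{u, v} k) (t : ℕ) : Prop :=
  ∀ p q, p < t → ∀ x : Q.obj p q, (Q.col p).IsCycle x →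
    ∃ y : Q.obj p (q + 1), (Q.col p).IsMoore y ∧ Q.pull₂ p (face 0) y = x

/-- Projecting a row lift by the column projector keeps it Moore in the row, makes it Moore in the
column, and does not change its face, which the projector fixes. -/
theorem RowExact.exists_moore {t : ℕ} (h : Q.RowExact t) {p q : ℕ} (hq : q < t) {x : Q.obj p q}
    (hx : (Q.row q).IsCycle x) (hx' : (Q.col p).IsMoore x) :
    ∃ y : Q.obj (p + 1) q, (Q.row q).IsMoore y ∧ (Q.col (p + 1)).IsMoore y ∧
      Q.pull₁ q (face 0) y = x := by
  obtain ⟨y, hy, hyx⟩ := h p q hq x hx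
  refine ⟨(Q.col (p + 1)).moore q y, moore₂_isMoore₁ hy, SimpMod.isMoore_moore _, ?_⟩
  have := SimpMod.moore_map (S := Q.col (p + 1)) (S' := Q.col p) (a := q) (Q.pull₁ q (face 0))
    (fun u x => (Q.pull_comm (face 0) u x).symm) y
  rw [← this, hyx]
  exact SimpMod.moore_eq hx'

theorem ColExact.exists_moore {t : ℕ} (h : Q.ColExact t) {p q : ℕ} (hp : p < t) {x : Q.obj p q}
    (hx : (Q.col p).IsCycle x) (hx' : (Q.row q).IsMoore x) :
    ∃ y : Q.obj p (q + 1), (Q.col p).IsMoore y ∧ (Q.row (q + 1)).IsMoore y ∧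
      Q.pull₂ p (face 0) y = x := by
  obtain ⟨y, hy, hyx⟩ := h p q hp x hx
  refine ⟨(Q.row (q + 1)).moore p y, moore₁_isMoore₂ hy, SimpMod.isMoore_moore _, ?_⟩
  have := SimpMod.moore_map (S := Q.row (q + 1)) (S' := Q.row q) (a := p) (Q.pull₂ p (face 0))
    (fun u x => Q.pull_comm u (face 0) x) y
  rw [← this, hyx]
  exact SimpMod.moore_eq hx'

theorem pull₁_face_face {p q : ℕ} {x : Q.obj (p + 2) q} (h : (Q.row q).IsMoore x) :
    Q.pull₁ q (face 0) (Q.pull₁ q (face 0) x) = 0 := by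
  exact (SimpMod.IsMoore.isCycle_face (S := Q.row q) h) (face 0) (face_not_surjective 0)

/-- An element all of whose faces vanish is a face in both directions. -/
theorem exists_face_face {t : ℕ} (h₁ : Q.RowExact t) (h₂ : Q.ColExact t) :
    ∀ (q p : ℕ), p + q + 1 < t → ∀ x : Q.obj p q, (Q.row q).IsCycle x → (Q.col p).IsCycle x →
      ∃ y : Q.obj (p + 1) (q + 1), (Q.row (q + 1)).IsMoore y ∧ (Q.col (p + 1)).IsMoore y ∧
        Q.pull₁ q (face 0) (Q.pull₂ (p + 1) (face 0) y) = x := by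
  intro q
  induction q with
  | zero =>
    intro p hp x hx hx'
    obtain ⟨g, hg, hg', rfl⟩ := h₁.exists_moore (by omega) hx hx'.isMoore
    obtain ⟨y, hy, hy', rfl⟩ := h₂.exists_moore (p := p + 1) (by omega)
      (SimpMod.isCycle_zero (S := Q.col (p + 1)) g) hg
    exact ⟨y, hy', hy, rfl⟩
  | succ q ih =>
    intro p hp x hx hx'
    -- The lift `g` along the row need not be a column cycle. Its column face is a cycle in both
    -- directions in bidegree `(p + 1, q)`, on the same antidiagonal, so the induction on `q`
    -- applies to it.
    obtain ⟨g, hg, hg', hgx⟩ := h₁.exists_moore (by omega) hx hx'.isMoore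
    have he : (Q.row q).IsCycle (Q.pull₂ (p + 1) (face 0) g) := by
      refine SimpMod.IsMoore.isCycle (S := Q.row q) ?_ ?_
      · exact SimpMod.IsMoore.map (S := Q.row (q + 1)) (S' := Q.row q) hg
          (fun a => Q.pull₂ a (face 0)) fun v x => Q.pull_comm v (face 0) x
      · change Q.pull₁ q (face 0) _ = 0
        rw [Q.pull_comm, hgx]
        exact hx' (face 0) (face_not_surjective 0)
    have he' : (Q.col (p + 1)).IsCycle (Q.pull₂ (p + 1) (face 0) g) :=
      SimpMod.IsMoore.isCycle_face (S := Q.col (p + 1)) hg'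
    obtain ⟨f, hf, hf', hfe⟩ := ih (p + 1) (by omega) _ he he'
    -- Subtracting the row face of `f` removes the obstruction. The row face of `g` is unchanged,
    -- since two zeroth faces in a row compose to zero on Moore elements.
    have hcyc : (Q.col (p + 1)).IsCycle (g - Q.pull₁ (q + 1) (face 0) f) := by
      refine SimpMod.IsMoore.isCycle (S := Q.col (p + 1)) ?_ ?_
      · refine SimpMod.IsMoore.sub (S := Q.col (p + 1)) hg' ?_
        exact SimpMod.IsMoore.map (S := Q.col (p + 2)) (S' := Q.col (p + 1)) hf'
          (fun a => Q.pull₁ a (face 0)) fun v x => (Q.pull_comm (face 0) v x).symm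
      · change Q.pull₂ (p + 1) (face 0) _ = 0
        rw [map_sub, ← Q.pull_comm, hfe, sub_self]
    have hmoore : (Q.row (q + 1)).IsMoore (g - Q.pull₁ (q + 1) (face 0) f) :=
      SimpMod.IsMoore.sub (S := Q.row (q + 1)) hg
        (SimpMod.IsCycle.isMoore (S := Q.row (q + 1))
          (SimpMod.IsMoore.isCycle_face (S := Q.row (q + 1)) hf))
    obtain ⟨y, hy, hy', hyx⟩ := h₂.exists_moore (p := p + 1) (by omega) hcyc hmoore
    refine ⟨y, hy', hy, ?_⟩
    rw [hyx, map_sub, hgx, pull₁_face_face hf, sub_zero]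

variable (d : ∀ p q, Q.obj p q →ₗ[k] Q.obj p q)

/-- A Moore primitive `y` of `x` has a zeroth face that is a closed cycle one degree lower. By
induction that face is `dv` with `v` a cycle; lifting `v` to `u`, the element `y - du` is a
primitive with all row faces zero. -/
theorem exists_d_eq_of_cycle₁ {t : ℕ} (h₁ : Q.RowExact t) (hdd : ∀ p q x, d p q (d p q x) = 0)
    (hd₁ : ∀ {a b : ℕ} (q : ℕ) (u : Fin (a + 1) →o Fin (b + 1)) (x : Q.obj b q),
      Q.pull₁ q u (d b q x) = d a q (Q.pull₁ q u x))
    (hd₂ : ∀ {a b : ℕ} (p : ℕ) (u : Fin (a + 1) →o Fin (b + 1)) (x : Q.obj p b),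
      Q.pull₂ p u (d p b x) = d p a (Q.pull₂ p u x))
    (hd : ∀ p q x, d p q x = 0 → ∃ y, d p q y = x) {q : ℕ} (hq : q < t) :
    ∀ (p : ℕ) (x : Q.obj p q), (Q.row q).IsCycle x → (Q.col p).IsMoore x → d p q x = 0 →
      ∃ y, (Q.row q).IsCycle y ∧ (Q.col p).IsMoore y ∧ d p q y = x := by
  -- The two projectors commute with `d` and fix `x`, so applying them to any primitive gives a
  -- doubly Moore primitive.
  have key : ∀ (p : ℕ) (x : Q.obj p q), (Q.row q).IsMoore x → (Q.col p).IsMoore x →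
      d p q x = 0 → ∃ y, (Q.row q).IsMoore y ∧ (Q.col p).IsMoore y ∧ d p q y = x := by
    intro p x hx hx' hdx
    obtain ⟨y, rfl⟩ := hd p q x hdx
    refine ⟨(Q.row q).moore p ((Q.col p).moore q y), SimpMod.isMoore_moore _,
      moore₁_isMoore₂ (SimpMod.isMoore_moore _), ?_⟩
    have e1 := SimpMod.moore_map (S := Q.row q) (S' := Q.row q) (a := p) (d p q) (fun u x => hd₁ q u x)
      ((Q.col p).moore q y)
    have e2 := SimpMod.moore_map (S := Q.col p) (S' := Q.col p) (a := q) (d p q) (fun u x => hd₂ p u x) y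
    rw [← e1, ← e2, SimpMod.moore_eq (S := Q.col p) hx', SimpMod.moore_eq (S := Q.row q) hx]
  intro p
  induction p with
  | zero =>
    intro x hx hx' hdx
    obtain ⟨y, -, hy, hyx⟩ := key 0 x hx.isMoore hx' hdx
    exact ⟨y, SimpMod.isCycle_zero (S := Q.row q) y, hy, hyx⟩
  | succ p ih =>
    intro x hx hx' hdx
    obtain ⟨y, hy, hy', hyx⟩ := key _ x hx.isMoore hx' hdx
    have hmap : ∀ z : Q.obj (p + 1) q, (Q.col (p + 1)).IsMoore z →
        (Q.col p).IsMoore (Q.pull₁ q (face 0) z) := fun z hz =>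
      SimpMod.IsMoore.map (S := Q.col (p + 1)) (S' := Q.col p) hz
          (fun a => Q.pull₁ a (face 0)) fun v x => (Q.pull_comm (face 0) v x).symm
    obtain ⟨v, hv, hv', hvy⟩ := ih (Q.pull₁ q (face 0) y)
      (SimpMod.IsMoore.isCycle_face (S := Q.row q) hy) (hmap y hy') (by
        rw [← hd₁, hyx]
        exact hx (face 0) (face_not_surjective 0))
    obtain ⟨u, hu, hu', huv⟩ := h₁.exists_moore hq hv hv'
    refine ⟨y - d _ _ u, ?_, ?_, ?_⟩
    · refine SimpMod.IsMoore.isCycle (S := Q.row q) (SimpMod.IsMoore.sub (S := Q.row q) hy ?_) ?_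
      · exact SimpMod.IsMoore.map (S := Q.row q) (S' := Q.row q) hu
          (fun a => d a q) fun v x => hd₁ q v x
      · change Q.pull₁ q (face 0) _ = 0
        rw [map_sub, hd₁, huv, hvy, sub_self]
    · refine SimpMod.IsMoore.sub (S := Q.col (p + 1)) hy' ?_
      exact SimpMod.IsMoore.map (S := Q.col (p + 1)) (S' := Q.col (p + 1)) hu'
          (fun a => d (p + 1) a) fun v x => hd₂ (p + 1) v x
    · rw [map_sub, hdd, sub_zero, hyx]

/-- The cycles in both directions form an exact complex. -/
theorem exists_d_eq_of_cycle {t : ℕ} (h₁ : Q.RowExact t) (h₂ : Q.ColExact t)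
    (hdd : ∀ p q x, d p q (d p q x) = 0)
    (hd₁ : ∀ {a b : ℕ} (q : ℕ) (u : Fin (a + 1) →o Fin (b + 1)) (x : Q.obj b q),
      Q.pull₁ q u (d b q x) = d a q (Q.pull₁ q u x))
    (hd₂ : ∀ {a b : ℕ} (p : ℕ) (u : Fin (a + 1) →o Fin (b + 1)) (x : Q.obj p b),
      Q.pull₂ p u (d p b x) = d p a (Q.pull₂ p u x))
    (hd : ∀ p q x, d p q x = 0 → ∃ y, d p q y = x) {p : ℕ} :
    ∀ (q : ℕ) (_ : p + q + 1 < t) (x : Q.obj p q), (Q.row q).IsCycle x → (Q.col p).IsCycle x →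
      d p q x = 0 → ∃ y, (Q.row q).IsCycle y ∧ (Q.col p).IsCycle y ∧ d p q y = x := by
  intro q
  induction q with
  | zero =>
    intro hq x hx hx' hdx
    obtain ⟨y, hy, -, hyx⟩ := exists_d_eq_of_cycle₁ d h₁ hdd hd₁ hd₂ hd (by omega) p x hx
      hx'.isMoore hdx
    exact ⟨y, hy, SimpMod.isCycle_zero (S := Q.col p) y, hyx⟩
  | succ q ih =>
    intro hq x hx hx' hdx
    obtain ⟨y, hy, hy', hyx⟩ := exists_d_eq_of_cycle₁ d h₁ hdd hd₁ hd₂ hd (by omega) p x hx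
      hx'.isMoore hdx
    have hmap : ∀ z : Q.obj p (q + 1), (Q.row (q + 1)).IsCycle z →
        (Q.row q).IsCycle (Q.pull₂ p (face 0) z) := fun z hz =>
      SimpMod.IsCycle.map (S := Q.row (q + 1)) (S' := Q.row q) hz
          (fun a => Q.pull₂ a (face 0)) fun v x => Q.pull_comm v (face 0) x
    obtain ⟨v, hv, hv', hvy⟩ := ih (by omega) (Q.pull₂ p (face 0) y) (hmap y hy)
      (SimpMod.IsMoore.isCycle_face (S := Q.col p) hy') (by
        rw [← hd₂, hyx]
        exact hx' (face 0) (face_not_surjective 0))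
    -- The correction must have `v` as its column face and remain a row cycle. A double lift of `v`
    -- provides this: its row face is a row cycle.
    obtain ⟨f, hf, hf', hfv⟩ := exists_face_face h₁ h₂ q p (by omega) v hv hv'
    rw [Q.pull_comm] at hfv
    refine ⟨y - d _ _ (Q.pull₁ (q + 1) (face 0) f), ?_, ?_, ?_⟩
    · refine SimpMod.IsCycle.sub (S := Q.row (q + 1)) hy ?_
      exact SimpMod.IsCycle.map (S := Q.row (q + 1)) (S' := Q.row (q + 1))
        (SimpMod.IsMoore.isCycle_face (S := Q.row (q + 1)) hf)
          (fun a => d a (q + 1)) fun v x => hd₁ (q + 1) v x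
    · refine SimpMod.IsMoore.isCycle (S := Q.col p) (SimpMod.IsMoore.sub (S := Q.col p) hy' ?_) ?_
      · refine SimpMod.IsMoore.map (S := Q.col p) (S' := Q.col p) ?_
          (fun a => d p a) fun v x => hd₂ p v x
        exact SimpMod.IsMoore.map (S := Q.col (p + 1)) (S' := Q.col p) hf'
          (fun a => Q.pull₁ a (face 0)) fun v x => (Q.pull_comm (face 0) v x).symm
      · change Q.pull₂ p (face 0) _ = 0
        rw [map_sub, hd₂, hfv, hvy, sub_self]
    · rw [map_sub, hdd, sub_zero, hyx]

end BiSimp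

end Bisimplicial
end QuasiComm
end

noncomputable section

namespace QuasiComm

/-! ### The simplicial module of forms and its extra degeneracy. -/

section FormOperators

variable {k : Type u} [CommRing k]

theorem formOf_eq_zero {p : ℕ} {w : Word p} (h : ∀ i, w i ≠ Letter.one) : formOf k w = 0 :=
  (Submodule.Quotient.mk_eq_zero _).2 (single_mem_vanishing k h 1)

theorem form_hom_ext {p : ℕ} {V : Type*} [AddCommGroup V] [Module k V] {f g : Form k p →ₗ[k] V}
    (h : ∀ w, f (formOf k w) = g (formOf k w)) : f = g := by
  refine Submodule.linearMap_qext _ (Finsupp.lhom_ext' fun w => LinearMap.ext_ring ?_)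
  exact h w

/-- The linear map on forms with given values on the words. -/
def formLift {p : ℕ} {V : Type*} [AddCommGroup V] [Module k V] (f : Word p → V)
    (hf : ∀ w : Word p, (∀ i, w i ≠ Letter.one) → f w = 0) : Form k p →ₗ[k] V :=
  (vanishing k p).liftQ (Finsupp.linearCombination k f) (by
    refine Submodule.span_le.2 ?_
    rintro _ ⟨w, hw, rfl⟩
    simp [hf w hw])

@[simp] theorem formLift_formOf {p : ℕ} {V : Type*} [AddCommGroup V] [Module k V] (f : Word p → V)
    (hf : ∀ w : Word p, (∀ i, w i ≠ Letter.one) → f w = 0) (w : Word p) :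
    formLift (k := k) f hf (formOf k w) = f w := by
  refine (Submodule.liftQ_apply _ _ _).trans ?_
  simp

theorem formPull_formOf {p n : ℕ} (u : Fin (p + 1) →o Fin (n + 1)) (w : Word n) :
    formPull k u (formOf k w) = ∑ A ∈ w.sections u, formOf k (w.spread u A) := by
  have : formPull k u (formOf k w) =
    (vanishing k p).mkQ (cubePull k u (Finsupp.single w 1)) := rfl
  rw [this, cubePull_single, map_sum]
  rfl

theorem Letter.toHeaviside_eq_self {l : Letter} (h : ¬ l.isDirac) : l.toHeaviside = l := by
  cases l <;> simp_all [Letter.toHeaviside, Letter.isDirac]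

theorem formPull_id (p : ℕ) :
    formPull k (OrderHom.id : Fin (p + 1) →o Fin (p + 1)) = LinearMap.id := by
  refine form_hom_ext fun w => ?_
  have e : w.sections OrderHom.id = {w.diracs} := by
    ext A
    rw [mem_sections, Finset.mem_singleton]
    constructor
    · intro h
      have := h.image_eq
      simp only [OrderHom.id_coe, Set.image_id] at this
      exact_mod_cast this
    · rintro rfl
      exact Set.bijOn_id _
  rw [formPull_formOf, e, Finset.sum_singleton, LinearMap.id_apply]
  congr 1
  funext i
  by_cases hi : i ∈ w.diracs
  · simp [Word.spread, hi]
  · simp only [Word.spread, hi, if_false]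
    exact Letter.toHeaviside_eq_self fun h => hi (mem_diracs.2 h)

theorem formPull_comp {a b c : ℕ} (u : Fin (a + 1) →o Fin (b + 1))
    (v : Fin (b + 1) →o Fin (c + 1)) :
    formPull k (v.comp u) = formPull k u ∘ₗ formPull k v := by
  classical
  refine form_hom_ext fun w => ?_
  rw [LinearMap.comp_apply, formPull_formOf, formPull_formOf, map_sum]
  simp only [formPull_formOf]
  rw [Finset.sum_sigma']
  -- A section over `v` followed by one over `u` is determined by the latter, since the former is
  -- its image under `u`; conversely each section over `v ∘ u` splits in this way.
  refine (Finset.sum_bij' (fun x _ => x.2) (fun A _ => ⟨A.image u, A⟩) ?_ ?_ ?_ ?_ ?_).symm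
  · rintro ⟨A, B⟩ h
    rw [Finset.mem_sigma, mem_sections, mem_sections] at h
    have h2 := h.2
    rw [diracs_spread (mem_sections.2 h.1)] at h2
    exact mem_sections.2 (h.1.comp h2)
  · intro A hA
    rw [mem_sections, OrderHom.comp_coe] at hA
    have h1 : Set.BijOn v (u '' A) w.diracs := by
      refine ⟨?_, ?_, ?_⟩
      · rintro _ ⟨x, hx, rfl⟩
        exact hA.mapsTo hx
      · rintro _ ⟨x, hx, rfl⟩ _ ⟨y, hy, rfl⟩ h
        rw [hA.injOn hx hy h]
      · intro z hz
        obtain ⟨x, hx, rfl⟩ := hA.surjOn hz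
        exact ⟨u x, ⟨x, hx, rfl⟩, rfl⟩
    have h1' : A.image u ∈ w.sections v := by
      rw [mem_sections, Finset.coe_image]
      exact h1
    rw [Finset.mem_sigma]
    refine ⟨h1', ?_⟩
    rw [mem_sections, diracs_spread h1', Finset.coe_image]
    exact Set.InjOn.bijOn_image fun x hx y hy h => hA.injOn hx hy (congrArg v h)
  · rintro ⟨A, B⟩ h
    rw [Finset.mem_sigma, mem_sections, mem_sections] at h
    have h2 := h.2
    rw [diracs_spread (mem_sections.2 h.1)] at h2
    have : B.image u = A := by
      have := h2.image_eq
      exact_mod_cast this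
    simp only
    rw [this]
  · intro A hA
    rfl
  · rintro ⟨A, B⟩ h
    rw [Finset.mem_sigma, mem_sections, mem_sections] at h
    have h2 := h.2
    rw [diracs_spread (mem_sections.2 h.1)] at h2
    congr 1
    funext i
    have hidem : ∀ l : Letter, l.toHeaviside.toHeaviside = l.toHeaviside := by
      rintro (_ | _ | _) <;> rfl
    by_cases hi : i ∈ B
    · have : u i ∈ A := h2.mapsTo hi
      simp [Word.spread, hi, this]
    · by_cases hu : u i ∈ A <;> simp [Word.spread, hi, hu, hidem]

variable (k) in
/-- The simplicial module `D*(Δ_•)`. -/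
abbrev formSimp : SimpMod.{u, u} k where
  obj p := Form k p
  pull u := formPull k u
  pull_id := formPull_id
  pull_comp := formPull_comp

/-- The word with an additional letter `Y_s` in front. -/
def Word.ins {p : ℕ} (s : ℤ) (w : Word p) : Word (p + 1) :=
  Fin.cons (Letter.heaviside s) w

@[simp] theorem Word.ins_zero {p : ℕ} (s : ℤ) (w : Word p) :
    w.ins s 0 = Letter.heaviside s := rfl

@[simp] theorem Word.ins_succ {p : ℕ} (s : ℤ) (w : Word p) (i : Fin (p + 1)) :
    w.ins s i.succ = w i := rfl

variable (k) in
/-- The product with `Y_s` in a new variable, which is put in front. -/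
def ins (s : ℤ) (p : ℕ) : Form k p →ₗ[k] Form k (p + 1) :=
  formLift (fun w => formOf k (w.ins s)) fun w hw => formOf_eq_zero fun i => by
    refine Fin.cases ?_ (fun i => ?_) i
    · simp
    · simpa using hw i

@[simp] theorem ins_formOf (s : ℤ) {p : ℕ} (w : Word p) :
    ins k s p (formOf k w) = formOf k (w.ins s) := formLift_formOf _ _ _

theorem mem_diracs_ins_succ {p : ℕ} (s : ℤ) (w : Word p) (i : Fin (p + 1)) :
    i.succ ∈ (w.ins s).diracs ↔ i ∈ w.diracs := by
  rw [mem_diracs, mem_diracs, Word.ins_succ]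

theorem zero_notMem_diracs_ins {p : ℕ} (s : ℤ) (w : Word p) : 0 ∉ (w.ins s).diracs := by
  rw [mem_diracs, Word.ins_zero]
  exact id

/-- The function `Y_s` takes the value `1` at `-∞`, so putting the new variable equal to `-∞`
deletes the letter. -/
theorem formPull_face_zero_ins (s : ℤ) {p : ℕ} (x : Form k p) :
    formPull k (face 0) (ins k s p x) = x := by
  refine LinearMap.congr_fun (f := formPull k (face 0) ∘ₗ ins k s p) (g := LinearMap.id)
    (form_hom_ext fun w => ?_) x
  have e : (w.ins s).sections (face 0) = {w.diracs} := by
    ext A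
    rw [mem_sections, Finset.mem_singleton]
    have hr : ∀ x : Fin (p + 1), (face 0 : Fin (p + 1) →o Fin (p + 2)) x = x.succ := fun x => by simp
    constructor
    · intro h
      ext i
      rw [← mem_diracs_ins_succ s]
      constructor
      · intro hi
        have := h.mapsTo hi
        rwa [hr] at this
      · intro hi
        obtain ⟨j, hj, hji⟩ := h.surjOn hi
        rw [hr] at hji
        rwa [← Fin.succ_injective _ hji]
    · rintro rfl
      refine ⟨fun i hi => ?_, fun i _ j _ h => ?_, fun i hi => ?_⟩
      · rw [hr]
        exact (mem_diracs_ins_succ s w i).2 hi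
      · rw [hr, hr] at h
        exact Fin.succ_injective _ h
      · have h0 : i ≠ 0 := fun h => zero_notMem_diracs_ins s w (h ▸ hi)
        obtain ⟨j, rfl⟩ := Fin.exists_succ_eq.2 h0
        exact ⟨j, (mem_diracs_ins_succ s w j).1 hi, hr j⟩
  rw [LinearMap.comp_apply, ins_formOf, formPull_formOf, e, Finset.sum_singleton,
    LinearMap.id_apply]
  congr 1
  funext i
  by_cases hi : i ∈ w.diracs
  · simp [Word.spread, hi]
  · simp only [Word.spread, hi, if_false, face_apply, Fin.zero_succAbove, Word.ins_succ]
    exact Letter.toHeaviside_eq_self fun h => hi (mem_diracs.2 h)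

/-- Only the single letter `Y_s` can remain, and a word without the letter `1` is zero on the
simplex. There is no augmentation term, so exactness holds in simplicial degree `0` too. -/
theorem formPull_face_succ_ins_zero (s : ℤ) (i : Fin 1) (x : Form k 0) :
    formPull k (face i.succ) (ins k s 0 x) = 0 := by
  refine LinearMap.congr_fun (f := formPull k (face i.succ) ∘ₗ ins k s 0) (g := 0)
    (form_hom_ext fun w => ?_) x
  rw [LinearMap.comp_apply, ins_formOf, formPull_formOf, LinearMap.zero_apply]
  refine Finset.sum_eq_zero fun A _ => formOf_eq_zero fun j => ?_
  have hj : (face i.succ : Fin 1 →o Fin 2) j = 0 := by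
    rw [Fin.fin_one_eq_zero i, Fin.fin_one_eq_zero j]; rfl
  unfold Word.spread
  rw [hj, Word.ins_zero]
  split_ifs <;> simp [Letter.toHeaviside]

/-- The face acts on the old letters only. The sections over the two maps correspond by a shift,
because the new letter is not a Dirac letter. -/
theorem formPull_face_succ_ins (s : ℤ) {p : ℕ} (y : Fin (p + 2)) (x : Form k (p + 1)) :
    formPull k (face y.succ) (ins k s (p + 1) x) = ins k s p (formPull k (face y) x) := by
  classical
  refine LinearMap.congr_fun (f := formPull k (face y.succ) ∘ₗ ins k s (p + 1))
    (g := ins k s p ∘ₗ formPull k (face y)) (form_hom_ext fun w => ?_) x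
  rw [LinearMap.comp_apply, LinearMap.comp_apply, ins_formOf, formPull_formOf, formPull_formOf,
    map_sum]
  simp only [ins_formOf]
  have h0 : (face y.succ : Fin (p + 2) →o Fin (p + 3)) 0 = 0 := by simp
  have hs : ∀ i : Fin (p + 1), (face y.succ : Fin (p + 2) →o Fin (p + 3)) i.succ =
      ((face y : Fin (p + 1) →o Fin (p + 2)) i).succ := by simp
  have hinj : ∀ {a : ℕ} (y : Fin (a + 2)), Function.Injective (face y) := fun y =>
    Fin.succAbove_right_injective
  refine (Finset.sum_bij (fun A _ => A.map (Fin.succEmb _)) ?_ ?_ ?_ ?_).symm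
  · intro A hA
    rw [mem_sections] at hA ⊢
    refine ⟨?_, (hinj _).injOn, ?_⟩
    · intro i hi
      simp only [Finset.coe_map, Set.mem_image, Finset.mem_coe] at hi
      obtain ⟨j, hj, rfl⟩ := hi
      change face y.succ j.succ ∈ _
      rw [hs]
      exact (mem_diracs_ins_succ s w _).2 (hA.mapsTo hj)
    · intro i hi
      have h0 : i ≠ 0 := fun h => zero_notMem_diracs_ins s w (h ▸ hi)
      obtain ⟨j, rfl⟩ := Fin.exists_succ_eq.2 h0
      obtain ⟨l, hl, rfl⟩ := hA.surjOn ((mem_diracs_ins_succ s w j).1 hi)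
      exact ⟨l.succ, by simpa using hl, hs l⟩
  · intro A _ B _ h
    exact Finset.map_injective _ h
  · intro B hB
    rw [mem_sections] at hB
    have hB0 : 0 ∉ B := fun h => zero_notMem_diracs_ins s w (by
      have := hB.mapsTo h
      rwa [h0] at this)
    refine ⟨Finset.univ.filter fun i => i.succ ∈ B, ?_, ?_⟩
    · rw [mem_sections]
      refine ⟨?_, (hinj _).injOn, ?_⟩
      · intro i hi
        have hi' : i.succ ∈ B := by simpa using hi
        have := hB.mapsTo hi'
        rw [hs] at this
        exact (mem_diracs_ins_succ s w _).1 this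
      · intro i hi
        obtain ⟨l, hl, hli⟩ := hB.surjOn ((mem_diracs_ins_succ s w i).2 hi)
        have hl0 : l ≠ 0 := fun h => hB0 (h ▸ hl)
        obtain ⟨j, rfl⟩ := Fin.exists_succ_eq.2 hl0
        rw [hs] at hli
        exact ⟨j, by simpa using hl, Fin.succ_injective _ hli⟩
    · ext i
      simp only [Finset.mem_map, Finset.mem_filter, Finset.mem_univ, true_and]
      constructor
      · rintro ⟨j, hj, rfl⟩
        exact hj
      · intro hi
        have hl0 : i ≠ 0 := fun h => hB0 (h ▸ hi)
        obtain ⟨j, rfl⟩ := Fin.exists_succ_eq.2 hl0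
        exact ⟨j, hi, rfl⟩
  · intro A _
    congr 1
    funext i
    refine Fin.cases ?_ (fun i => ?_) i
    · unfold Word.spread
      rw [h0, Word.ins_zero, Word.ins_zero]
      split_ifs <;> simp [Letter.toHeaviside]
    · have : i.succ ∈ A.map (Fin.succEmb _) ↔ i ∈ A := by simp
      unfold Word.spread
      rw [hs, Word.ins_succ, Word.ins_succ]
      simp only [this]

/-! ### Contraction of the complex of forms onto the constants. -/

/-- The projection on the span of the words that satisfy `P`. -/
def wordProj (k : Type u) [CommRing k] (p : ℕ) (P : Word p → Prop) : Form k p →ₗ[k] Form k p :=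
  open scoped Classical in
  formLift (fun w => if P w then formOf k w else 0) fun w hw => by
    rw [formOf_eq_zero hw, ite_self]

open scoped Classical in
theorem wordProj_formOf {p : ℕ} (P : Word p → Prop) (w : Word p) :
    wordProj k p P (formOf k w) = if P w then formOf k w else 0 := formLift_formOf _ _ _

/-- The position of the first letter other than `1`. -/
def Word.IsFirst {p : ℕ} (w : Word p) (i : Fin (p + 1)) : Prop :=
  w i ≠ Letter.one ∧ ∀ j < i, w j = Letter.one

theorem Word.IsFirst.unique {p : ℕ} {w : Word p} {i j : Fin (p + 1)} (hi : w.IsFirst i)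
    (hj : w.IsFirst j) : i = j := by
  rcases lt_trichotomy i j with h | h | h
  · exact absurd (hj.2 i h) hi.1
  · exact h
  · exact absurd (hi.2 j h) hj.1

open scoped Classical in
/-- The homotopy that replaces the first letter other than `1` by its primitive. -/
def homotopy (k : Type u) [CommRing k] (p : ℕ) : Form k p →ₗ[k] Form k p :=
  formLift (fun w => ∑ i with w.IsFirst i ∧ (w i).isDirac,
    -formOf k (Function.update w i (w i).toHeaviside)) fun w hw => by
    refine Finset.sum_eq_zero fun i _ => ?_
    rw [formOf_eq_zero, neg_zero]
    intro j
    by_cases hj : j = i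
    · subst hj
      have := hw j
      cases h : w j <;> simp_all [Letter.toHeaviside]
    · simpa [hj] using hw j

/-- The projection on the span of the word `1 ⊗ ... ⊗ 1`. -/
abbrev unitProj (k : Type u) [CommRing k] (p : ℕ) : Form k p →ₗ[k] Form k p :=
  wordProj k p fun w => ∀ i, w i = Letter.one

theorem isFirst_diff {p : ℕ} {w : Word p} {i : Fin (p + 1)} (hi : i ∈ w.heavisides)
    (h : w.IsFirst i) : (w.diff i).IsFirst i := by
  rw [mem_heavisides] at hi
  refine ⟨?_, fun j hj => ?_⟩
  · cases hw : w i <;> simp_all [Word.diff, Letter.toDirac, Letter.isHeaviside]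
  · rw [← h.2 j hj]
    simp [Word.diff, hj.ne]

theorem isFirst_diff_of_ne {p : ℕ} {w : Word p} {i j : Fin (p + 1)} (hj : j ∈ w.heavisides)
    (h : w.IsFirst i) (hij : j ≠ i) : (w.diff j).IsFirst i := by
  rw [mem_heavisides] at hj
  refine ⟨?_, fun l hl => ?_⟩
  · simpa [Word.diff, hij.symm] using h.1
  · have hlj : l ≠ j := by
      rintro rfl
      rw [h.2 l hl] at hj
      exact hj
    rw [← h.2 l hl]
    simp [Word.diff, hlj]

theorem homotopy_formOf {p : ℕ} {w : Word p} {i : Fin (p + 1)} (hi : i ∈ w.heavisides)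
    (h : w.IsFirst i) : homotopy k p (formOf k w) = 0 := by
  rw [homotopy, formLift_formOf]
  refine Finset.sum_eq_zero fun j hj => ?_
  simp only [Finset.mem_filter, Finset.mem_univ, true_and] at hj
  have := hj.1.unique h
  subst this
  exact absurd (mem_diracs.2 hj.2) (not_mem_diracs hi)

theorem homotopy_formOf_diff {p : ℕ} {w : Word p} {i : Fin (p + 1)} (hi : i ∈ w.heavisides)
    (h : w.IsFirst i) : homotopy k p (formOf k (w.diff i)) = -formOf k w := by
  rw [homotopy, formLift_formOf, Finset.sum_eq_single i]
  · congr 2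
    rw [mem_heavisides] at hi
    funext j
    by_cases hj : j = i
    · subst hj
      cases hw : w j <;> simp_all [Word.diff, Letter.toDirac, Letter.toHeaviside, Letter.isHeaviside]
    · simp [hj, Word.diff]
  · intro j hj hne
    simp only [Finset.mem_filter, Finset.mem_univ, true_and] at hj
    exact absurd (hj.1.unique (isFirst_diff hi h)) hne
  · intro hn
    refine absurd ?_ hn
    simp only [Finset.mem_filter, Finset.mem_univ, true_and]
    refine ⟨isFirst_diff hi h, ?_⟩
    rw [← mem_diracs, diracs_diff hi]
    simp

theorem homotopy_formOf_one {p : ℕ} {w : Word p} (h : ∀ i, w i = Letter.one) :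
    homotopy k p (formOf k w) = 0 := by
  rw [homotopy, formLift_formOf]
  refine Finset.sum_eq_zero fun j hj => ?_
  simp only [Finset.mem_filter, Finset.mem_univ, true_and] at hj
  exact absurd (h j) hj.1.1

/-- Apart from the constant word, words come in pairs that differ by `Y_s` or `ω_s` as first letter
other than `1`. The homotopy matches the members of a pair. -/
theorem word_cases {p : ℕ} (w : Word p) : (∀ i, w i = Letter.one) ∨
    ∃ (w' : Word p) (i : Fin (p + 1)), i ∈ w'.heavisides ∧ w'.IsFirst i ∧
      (w = w' ∨ w = w'.diff i) := by
  classical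
  by_cases h : ∀ i, w i = Letter.one
  · exact Or.inl h
  · right
    push Not at h
    have hn : (Finset.univ.filter fun i => w i ≠ Letter.one).Nonempty := by
      obtain ⟨i, hi⟩ := h
      exact ⟨i, by simpa using hi⟩
    obtain ⟨i, hi, hmin⟩ := Finset.exists_min_image _ id hn
    simp only [Finset.mem_filter, Finset.mem_univ, true_and, id] at hi hmin
    have hf : w.IsFirst i := ⟨hi, fun j hj => by
      by_contra hh
      exact absurd (hmin j hh) (not_le.2 hj)⟩
    by_cases hd : (w i).isDirac
    · refine ⟨Function.update w i (w i).toHeaviside, i, ?_, ⟨?_, fun j hj => ?_⟩, Or.inr ?_⟩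
      · rw [mem_heavisides]
        cases hw : w i <;> simp_all [Letter.toHeaviside, Letter.isHeaviside, Letter.isDirac]
      · cases hw : w i <;> simp_all [Letter.toHeaviside, Letter.isDirac]
      · simpa [hj.ne] using hf.2 j hj
      · funext j
        by_cases hj : j = i
        · subst hj
          cases hw : w j <;>
            simp_all [Letter.toHeaviside, Letter.toDirac, Letter.isDirac, Word.diff]
        · simp [hj, Word.diff]
    · refine ⟨w, i, ?_, hf, Or.inl rfl⟩
      rw [mem_heavisides]
      cases hw : w i <;> simp_all [Letter.isHeaviside, Letter.isDirac]

theorem diracBefore_of_isFirst {p : ℕ} {w : Word p} {i : Fin (p + 1)} (h : w.IsFirst i) :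
    w.diracBefore i = 0 := by
  unfold Word.diracBefore
  rw [Finset.card_eq_zero, Finset.filter_eq_empty_iff]
  intro j hj hji
  rw [mem_diracs, h.2 j hji] at hj
  exact hj

theorem lt_of_isFirst {p : ℕ} {w : Word p} {i j : Fin (p + 1)} (h : w.IsFirst i)
    (hj : j ∈ w.heavisides) (hij : j ≠ i) : i < j := by
  by_contra hlt
  rw [mem_heavisides, h.2 j (lt_of_le_of_ne (not_lt.1 hlt) hij)] at hj
  exact hj

/-- This is the tensor product of the contractions of each variable onto constants. Since only
letters `1` precede the integrated letter, no Koszul sign occurs there; the minus sign in `homotopy`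
comes from `d Y_s = -ω_s`. -/
theorem formD_homotopy (p : ℕ) (x : Form k p) : formD k p (homotopy k p x) +
    homotopy k p (formD k p x) = x - unitProj k p x := by
  classical
  refine LinearMap.congr_fun (f := formD k p ∘ₗ homotopy k p + homotopy k p ∘ₗ formD k p)
    (g := LinearMap.id - unitProj k p) (form_hom_ext fun w => ?_) x
  simp only [LinearMap.add_apply, LinearMap.comp_apply, LinearMap.sub_apply, LinearMap.id_apply,
    wordProj_formOf]
  rcases word_cases w with h | ⟨w', i, hi, hf, hw⟩
  · have : w.heavisides = ∅ := by
      ext j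
      rw [mem_heavisides, h j]
      simp [Letter.isHeaviside]
    rw [homotopy_formOf_one h, formD_formOf, this, if_pos h]
    simp
  · have hne : ∀ j ∈ w'.heavisides, j ≠ i → homotopy k p (formOf k (w'.diff j)) = 0 :=
      fun j hj hji => homotopy_formOf (i := i) ((mem_heavisides_diff hj).2 ⟨hi, hji.symm⟩)
        (isFirst_diff_of_ne hj hf hji)
    rcases hw with rfl | rfl
    · rw [homotopy_formOf hi hf, if_neg (fun h => hf.1 (h i)), formD_formOf, map_sum,
        Finset.sum_eq_single i]
      · rw [map_smul, homotopy_formOf_diff hi hf, diracBefore_of_isFirst hf]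
        simp
      · intro j hj hji
        rw [map_smul, hne j hj hji, smul_zero]
      · exact fun hn => absurd hi hn
    · rw [homotopy_formOf_diff hi hf, if_neg (fun h => (isFirst_diff hi hf).1 (h i)), map_neg,
        formD_formOf, formD_formOf, map_sum]
      have hh : (w'.diff i).heavisides = w'.heavisides.erase i := by
        ext j
        rw [mem_heavisides_diff hi, Finset.mem_erase, and_comm]
      -- Every other Heaviside letter lies after position `i`, so the Dirac letter at `i` changes
      -- the sign of its term. These terms cancel those of the differential of the integrated word.
      have e : ∑ j ∈ (w'.diff i).heavisides, homotopy k p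
          ((-(-1 : k) ^ (w'.diff i).diracBefore j) • formOf k ((w'.diff i).diff j)) =
          ∑ j ∈ w'.heavisides.erase i, (-(-1 : k) ^ w'.diracBefore j) • formOf k (w'.diff j) := by
        rw [hh]
        refine Finset.sum_congr rfl fun j hj => ?_
        rw [Finset.mem_erase] at hj
        rw [map_smul, diff_comm w' hj.1.symm, homotopy_formOf_diff
          ((mem_heavisides_diff hj.2).2 ⟨hi, hj.1.symm⟩) (isFirst_diff_of_ne hj.2 hf hj.1),
          diracBefore_diff hi, if_pos (lt_of_isFirst hf hj.2 hj.1)]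
        simp [pow_succ]
      rw [e, ← Finset.add_sum_erase _ _ hi, diracBefore_of_isFirst hf]
      simp

theorem formSign_homotopy (p : ℕ) (x : Form k p) :
    formSign k p (homotopy k p x) + homotopy k p (formSign k p x) = 0 := by
  refine LinearMap.congr_fun (f := formSign k p ∘ₗ homotopy k p + homotopy k p ∘ₗ formSign k p)
    (g := 0) (form_hom_ext fun w => ?_) x
  simp only [LinearMap.add_apply, LinearMap.comp_apply, LinearMap.zero_apply, formSign_formOf,
    map_smul]
  rcases word_cases w with h | ⟨w', i, hi, hf, rfl | rfl⟩
  · simp [homotopy_formOf_one h]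
  · simp [homotopy_formOf hi hf]
  · rw [homotopy_formOf_diff hi hf, map_neg, formSign_formOf, degree_diff hi]
    simp [pow_succ]

theorem formD_unitProj (p : ℕ) (x : Form k p) : formD k p (unitProj k p x) = 0 := by
  classical
  refine LinearMap.congr_fun (f := formD k p ∘ₗ unitProj k p)
    (g := 0) (form_hom_ext fun w => ?_) x
  rw [LinearMap.comp_apply, wordProj_formOf]
  split_ifs with h
  · have : w.heavisides = ∅ := by
      ext j
      rw [mem_heavisides, h j]
      simp [Letter.isHeaviside]
    rw [formD_formOf, this]
    simp
  · simp

theorem unitProj_formD (p : ℕ) (x : Form k p) : unitProj k p (formD k p x) = 0 := by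
  classical
  refine LinearMap.congr_fun (f := unitProj k p ∘ₗ formD k p)
    (g := 0) (form_hom_ext fun w => ?_) x
  rw [LinearMap.comp_apply, formD_formOf, map_sum]
  refine Finset.sum_eq_zero fun i hi => ?_
  rw [map_smul, wordProj_formOf, if_neg, smul_zero]
  intro h
  have h1 : i ∈ (w.diff i).diracs := by rw [diracs_diff hi]; simp
  rw [mem_diracs, h i] at h1
  exact h1

theorem degree_of_forall_eq_one {p : ℕ} {w : Word p} (h : ∀ i, w i = Letter.one) :
    w.degree = 0 := by
  unfold Word.degree
  rw [Finset.card_eq_zero]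
  ext i
  rw [mem_diracs, h i]
  simp [Letter.isDirac]

theorem formSign_unitProj (p : ℕ) (x : Form k p) :
    formSign k p (unitProj k p x) = unitProj k p x := by
  classical
  refine LinearMap.congr_fun (f := formSign k p ∘ₗ unitProj k p)
    (g := unitProj k p) (form_hom_ext fun w => ?_) x
  rw [LinearMap.comp_apply, wordProj_formOf]
  split_ifs with h
  · rw [formSign_formOf, degree_of_forall_eq_one h, pow_zero, one_smul]
  · simp

theorem unitProj_formSign (p : ℕ) (x : Form k p) :
    unitProj k p (formSign k p x) = unitProj k p x := by
  classical
  refine LinearMap.congr_fun (f := unitProj k p ∘ₗ formSign k p)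
    (g := unitProj k p) (form_hom_ext fun w => ?_) x
  rw [LinearMap.comp_apply, formSign_formOf, map_smul, wordProj_formOf]
  split_ifs with h
  · rw [degree_of_forall_eq_one h, pow_zero, one_smul]
  · simp

/-- The contracting homotopy of the augmented complex `D*(Δ_p) ⊗ D*(Δ_q)`. -/
def biHomotopy (k : Type u) [CommRing k] (p q : ℕ) : BiForm k p q →ₗ[k] BiForm k p q :=
  TensorProduct.map (homotopy k p) LinearMap.id + TensorProduct.map (unitProj k p) (homotopy k q)

/-- The first factor is contracted fully, then the second one on the constants of the first. The
cross terms cancel because the homotopy anticommutes with the degree sign. -/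
theorem biD_biHomotopy (p q : ℕ) : biD k p q ∘ₗ biHomotopy k p q + biHomotopy k p q ∘ₗ biD k p q =
    LinearMap.id - TensorProduct.map (unitProj k p) (unitProj k q) := by
  refine TensorProduct.ext' fun x y => ?_
  have e1 := formD_homotopy p x
  have e2 := formD_homotopy q y
  have e3 := formSign_homotopy p x
  simp only [LinearMap.add_apply, LinearMap.comp_apply, LinearMap.sub_apply, LinearMap.id_apply,
    biD, biHomotopy, map_add, TensorProduct.map_tmul, formD_unitProj, unitProj_formD,
    formSign_unitProj, unitProj_formSign, TensorProduct.zero_tmul, zero_add, add_zero]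
  rw [eq_sub_iff_add_eq] at e1 e2
  rw [← eq_neg_iff_add_eq_zero] at e3
  rw [e3, TensorProduct.neg_tmul, eq_sub_iff_add_eq]
  have h1 := congrArg (fun z => z ⊗ₜ[k] y) e1
  have h2 := congrArg (fun z => unitProj k p x ⊗ₜ[k] z) e2
  simp only [TensorProduct.add_tmul] at h1
  simp only [TensorProduct.tmul_add] at h2
  rw [← h1, ← h2]
  abel

end FormOperators
end QuasiComm
end

noncomputable section

namespace QuasiComm

/-! ### Conditions on singular supports and their stability. -/

section Supports

variable {k : Type u} [CommRing k]

theorem biForm_hom_ext {p q : ℕ} {V : Type*} [AddCommGroup V] [Module k V]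
    {f g : BiForm k p q →ₗ[k] V}
    (h : ∀ w w', f (formOf k w ⊗ₜ[k] formOf k w') = g (formOf k w ⊗ₜ[k] formOf k w')) : f = g := by
  refine TensorProduct.ext (form_hom_ext fun w => form_hom_ext fun w' => ?_)
  exact h w w'

variable (k) in
/-- The forms with singular support in `F`. -/
def supported (p : ℕ) (F : Set ℤ) : Submodule k (Form k p) :=
  Submodule.span k {x | ∃ w : Word p, w.support ⊆ F ∧ x = formOf k w}

theorem formOf_mem_supported {p : ℕ} {F : Set ℤ} {w : Word p} (h : w.support ⊆ F) :
    formOf k w ∈ supported k p F := Submodule.subset_span ⟨w, h, rfl⟩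

/-- A map that does not increase singular supports. -/
def IsLocal {p q : ℕ} (f : Form k p →ₗ[k] Form k q) : Prop :=
  ∀ w : Word p, f (formOf k w) ∈ supported k q w.support

theorem isLocal_id (p : ℕ) : IsLocal (LinearMap.id : Form k p →ₗ[k] Form k p) :=
  fun _ => formOf_mem_supported subset_rfl

theorem isLocal_formD (p : ℕ) : IsLocal (formD k p) := fun w => by
  rw [formD_formOf]
  exact Submodule.sum_mem _ fun i _ => Submodule.smul_mem _ _
    (formOf_mem_supported (support_diff w i).le)

theorem isLocal_formSign (p : ℕ) : IsLocal (formSign k p) := fun w => by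
  rw [formSign_formOf]
  exact Submodule.smul_mem _ _ (formOf_mem_supported le_rfl)

theorem support_spread {p n : ℕ} (u : Fin (p + 1) →o Fin (n + 1)) (w : Word n)
    (A : Finset (Fin (p + 1))) : (w.spread u A).support ⊆ w.support := by
  have h : ∀ l : Letter, l.toHeaviside.support = l.support := by rintro (_ | _ | _) <;> rfl
  refine Set.iUnion_subset fun i => ?_
  unfold Word.spread
  split_ifs
  · exact Set.subset_iUnion (fun i => (w i).support) (u i)
  · rw [h]
    exact Set.subset_iUnion (fun i => (w i).support) (u i)

theorem isLocal_formPull {p n : ℕ} (u : Fin (p + 1) →o Fin (n + 1)) :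
    IsLocal (formPull k u) := fun w => by
  rw [formPull_formOf]
  exact Submodule.sum_mem _ fun A _ => formOf_mem_supported (support_spread u w A)

theorem isLocal_wordProj (p : ℕ) (P : Word p → Prop) : IsLocal (wordProj k p P) := fun w => by
  rw [wordProj_formOf]
  split_ifs
  · exact formOf_mem_supported le_rfl
  · exact zero_mem _

theorem isLocal_homotopy (p : ℕ) : IsLocal (homotopy k p) := fun w => by
  rw [homotopy, formLift_formOf]
  refine Submodule.sum_mem _ fun i _ => Submodule.neg_mem _ (formOf_mem_supported ?_)
  have h : ∀ l : Letter, l.toHeaviside.support = l.support := by rintro (_ | _ | _) <;> rfl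
  refine Set.iUnion_subset fun j => ?_
  by_cases hj : j = i
  · subst hj
    rw [Function.update_self, h]
    exact Set.subset_iUnion (fun i => (w i).support) j
  · rw [Function.update_of_ne hj]
    exact Set.subset_iUnion (fun i => (w i).support) j

variable (k) in
/-- The span of the tensor products of two words whose singular supports are in the relation `R`. -/
def spanRel (R : Set ℤ → Set ℤ → Prop) (p q : ℕ) : Submodule k (BiForm k p q) :=
  Submodule.span k {x | ∃ (w : Word p) (w' : Word q), R w.support w'.support ∧
    x = formOf k w ⊗ₜ[k] formOf k w'}

theorem tmul_mem_spanRel {R : Set ℤ → Set ℤ → Prop} {p q : ℕ} {w : Word p} {w' : Word q}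
    (h : R w.support w'.support) : formOf k w ⊗ₜ[k] formOf k w' ∈ spanRel k R p q :=
  Submodule.subset_span ⟨w, w', h, rfl⟩

theorem spanRel_mono {R R' : Set ℤ → Set ℤ → Prop} (h : ∀ F F', R F F' → R' F F') (p q : ℕ) :
    spanRel k R p q ≤ spanRel k R' p q :=
  Submodule.span_mono fun _ ⟨w, w', hR, e⟩ => ⟨w, w', h _ _ hR, e⟩

/-- The relation `R` is inherited by subsets. -/
def IsHereditary (R : Set ℤ → Set ℤ → Prop) : Prop :=
  ∀ ⦃F G F' G' : Set ℤ⦄, F ⊆ G → F' ⊆ G' → R G G' → R F F'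

/-- Maps that do not enlarge supports preserve any hereditary condition. This covers the
differential, the homotopy and the simplicial operators, for disjointness as well as for
containment. -/
theorem spanRel_le_comap_map {R : Set ℤ → Set ℤ → Prop} (hR : IsHereditary R) {p q p' q' : ℕ}
    {f : Form k p →ₗ[k] Form k p'} {g : Form k q →ₗ[k] Form k q'} (hf : IsLocal f)
    (hg : IsLocal g) :
    spanRel k R p q ≤ (spanRel k R p' q').comap (TensorProduct.map f g) := by
  refine Submodule.span_le.2 ?_
  rintro _ ⟨w, w', h, rfl⟩
  rw [SetLike.mem_coe, Submodule.mem_comap, TensorProduct.map_tmul]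
  have key : Submodule.map₂ (TensorProduct.mk k _ _) (supported k p' w.support)
      (supported k q' w'.support) ≤ spanRel k R p' q' := by
    unfold supported
    rw [Submodule.map₂_span_span]
    refine Submodule.span_le.2 ?_
    rintro _ ⟨_, ⟨v, h1, rfl⟩, _, ⟨v', h2, rfl⟩, rfl⟩
    exact tmul_mem_spanRel (hR h1 h2 h)
  exact key (Submodule.apply_mem_map₂ _ (hf w) (hg w'))

theorem le_comap_add {V W : Type*} [AddCommGroup V] [Module k V] [AddCommGroup W] [Module k W]
    {A : Submodule k V} {B : Submodule k W} {f g : V →ₗ[k] W} (hf : A ≤ B.comap f)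
    (hg : A ≤ B.comap g) : A ≤ B.comap (f + g) := fun x hx => by
  rw [Submodule.mem_comap, LinearMap.add_apply]
  exact add_mem (hf hx) (hg hx)

theorem spanRel_le_comap_biD {R : Set ℤ → Set ℤ → Prop} (hR : IsHereditary R) (p q : ℕ) :
    spanRel k R p q ≤ (spanRel k R p q).comap (biD k p q) :=
  le_comap_add (spanRel_le_comap_map hR (isLocal_formD p) (isLocal_id q))
    (spanRel_le_comap_map hR (isLocal_formSign p) (isLocal_formD q))

theorem spanRel_le_comap_biHomotopy {R : Set ℤ → Set ℤ → Prop} (hR : IsHereditary R) (p q : ℕ) :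
    spanRel k R p q ≤ (spanRel k R p q).comap (biHomotopy k p q) :=
  le_comap_add (spanRel_le_comap_map hR (isLocal_homotopy p) (isLocal_id q))
    (spanRel_le_comap_map hR (isLocal_wordProj p _) (isLocal_homotopy q))

theorem map_unitProj_mem {R : Set ℤ → Set ℤ → Prop} (hR : R ∅ ∅) (p q : ℕ) (x : BiForm k p q) :
    TensorProduct.map (unitProj k p) (unitProj k q) x ∈ spanRel k R p q := by
  classical
  have hs : ∀ {p : ℕ} {w : Word p}, (∀ i, w i = Letter.one) → w.support = ∅ := by
    intro p w h
    simp [Word.support, h, Letter.support]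
  have h : (spanRel k R p q).mkQ ∘ₗ TensorProduct.map (unitProj k p) (unitProj k q) = 0 := by
    refine biForm_hom_ext fun w w' => ?_
    rw [LinearMap.comp_apply, TensorProduct.map_tmul, wordProj_formOf, wordProj_formOf,
      LinearMap.zero_apply]
    split_ifs with h1 h2
    · refine (Submodule.Quotient.mk_eq_zero _).2 (tmul_mem_spanRel ?_)
      rwa [hs h1, hs h2]
    all_goals simp
  exact (Submodule.Quotient.mk_eq_zero _).1 (LinearMap.congr_fun h x)

/-- An element of `T` outside `F`, if there is one. -/
def pick (T : Finset ℤ) (F : Set ℤ) : ℤ :=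
  open scoped Classical in
  if h : ∃ s ∈ T, s ∉ F then h.choose else if h : T.Nonempty then h.choose else 0

theorem pick_mem {T : Finset ℤ} (hT : T.Nonempty) (F : Set ℤ) : pick T F ∈ T := by
  unfold pick
  split_ifs with h
  · exact h.choose_spec.1
  · exact hT.choose_spec

theorem pick_notMem {T : Finset ℤ} {F : Set ℤ} (h : ∃ s ∈ T, s ∉ F) : pick T F ∉ F := by
  unfold pick
  rw [dif_pos h]
  exact h.choose_spec.2

/-- A word of length `q + 1` that contains the letter `1` has at most `q` singular points. -/
theorem exists_mem_notMem_support {T : Finset ℤ} {q : ℕ} (hq : q < T.card) {w : Word q}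
    (hw : ∃ i, w i = Letter.one) : ∃ s ∈ T, s ∉ w.support := by
  classical
  obtain ⟨i, hi⟩ := hw
  by_contra hcon
  push Not at hcon
  let val : Letter → ℤ := fun l => match l with
    | Letter.one => 0
    | Letter.heaviside s => s
    | Letter.dirac s => s
  have hsub : T ⊆ (Finset.univ.erase i).image fun j => val (w j) := by
    intro s hs
    obtain ⟨j, hj⟩ := Set.mem_iUnion.1 (hcon s hs)
    rw [Finset.mem_image]
    refine ⟨j, ?_, ?_⟩
    · rw [Finset.mem_erase]
      refine ⟨?_, Finset.mem_univ _⟩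
      rintro rfl
      rw [hi] at hj
      exact hj
    · cases h : w j <;> simp_all [Letter.support, val]
  have := (Finset.card_le_card hsub).trans Finset.card_image_le
  rw [Finset.card_erase_of_mem (Finset.mem_univ i), Finset.card_univ, Fintype.card_fin] at this
  omega

variable (k) in
/-- Puts a letter `Y_s` in front of the first word, where `s` is a point of `T` outside the singular
support of the second word. -/
def insLeft (T : Finset ℤ) (p q : ℕ) : BiForm k p q →ₗ[k] BiForm k (p + 1) q :=
  ∑ s ∈ T, TensorProduct.map (ins k s p) (wordProj k q fun w => pick T w.support = s)

variable (k) in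
/-- Puts a letter `Y_s` in front of the second word, where `s` is a point of `T` outside the
singular support of the first word. -/
def insRight (T : Finset ℤ) (p q : ℕ) : BiForm k p q →ₗ[k] BiForm k p (q + 1) :=
  ∑ s ∈ T, TensorProduct.map (wordProj k p fun w => pick T w.support = s) (ins k s q)

theorem insLeft_tmul {T : Finset ℤ} (hT : T.Nonempty) {p q : ℕ} (x : Form k p) (w : Word q) :
    insLeft k T p q (x ⊗ₜ[k] formOf k w) = ins k (pick T w.support) p x ⊗ₜ[k] formOf k w := by
  classical
  simp only [insLeft, LinearMap.sum_apply, TensorProduct.map_tmul, wordProj_formOf]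
  rw [Finset.sum_eq_single (pick T w.support)]
  · rw [if_pos rfl]
  · intro s _ hs
    rw [if_neg hs.symm, TensorProduct.tmul_zero]
  · exact fun h => absurd (pick_mem hT _) h

theorem insRight_tmul {T : Finset ℤ} (hT : T.Nonempty) {p q : ℕ} (w : Word p) (y : Form k q) :
    insRight k T p q (formOf k w ⊗ₜ[k] y) = formOf k w ⊗ₜ[k] ins k (pick T w.support) q y := by
  classical
  simp only [insRight, LinearMap.sum_apply, TensorProduct.map_tmul, wordProj_formOf]
  rw [Finset.sum_eq_single (pick T w.support)]
  · rw [if_pos rfl]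
  · intro s _ hs
    rw [if_neg hs.symm, TensorProduct.zero_tmul]
  · exact fun h => absurd (pick_mem hT _) h

theorem biForm_hom_ext_left {p q : ℕ} {V : Type*} [AddCommGroup V] [Module k V]
    {f g : BiForm k p q →ₗ[k] V}
    (h : ∀ x w', f (x ⊗ₜ[k] formOf k w') = g (x ⊗ₜ[k] formOf k w')) : f = g :=
  biForm_hom_ext fun _ w' => h _ w'

theorem biForm_hom_ext_right {p q : ℕ} {V : Type*} [AddCommGroup V] [Module k V]
    {f g : BiForm k p q →ₗ[k] V}
    (h : ∀ w y, f (formOf k w ⊗ₜ[k] y) = g (formOf k w ⊗ₜ[k] y)) : f = g :=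
  biForm_hom_ext fun w _ => h w _

theorem face_zero_insLeft {T : Finset ℤ} (hT : T.Nonempty) (p q : ℕ) :
    (formPull k (face 0)).rTensor (Form k q) ∘ₗ insLeft k T p q = LinearMap.id :=
  biForm_hom_ext_left fun x w' => by
    rw [LinearMap.comp_apply, insLeft_tmul hT, LinearMap.rTensor_tmul, formPull_face_zero_ins,
      LinearMap.id_apply]

theorem face_zero_insRight {T : Finset ℤ} (hT : T.Nonempty) (p q : ℕ) :
    (formPull k (face 0)).lTensor (Form k p) ∘ₗ insRight k T p q = LinearMap.id :=
  biForm_hom_ext_right fun x w' => by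
    rw [LinearMap.comp_apply, insRight_tmul hT, LinearMap.lTensor_tmul, formPull_face_zero_ins,
      LinearMap.id_apply]

/-- The point chosen depends on the second word only, and a face in the first variable leaves that
word alone. The identities of the extra degeneracy therefore survive the choice. -/
theorem face_succ_insLeft {T : Finset ℤ} (hT : T.Nonempty) (p q : ℕ) (y : Fin (p + 2)) :
    (formPull k (face y.succ)).rTensor (Form k q) ∘ₗ insLeft k T (p + 1) q =
      insLeft k T p q ∘ₗ (formPull k (face y)).rTensor (Form k q) :=
  biForm_hom_ext_left fun x w' => by
    rw [LinearMap.comp_apply, LinearMap.comp_apply, LinearMap.rTensor_tmul, insLeft_tmul hT,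
      insLeft_tmul hT, LinearMap.rTensor_tmul, formPull_face_succ_ins]

theorem face_succ_insRight {T : Finset ℤ} (hT : T.Nonempty) (p q : ℕ) (y : Fin (q + 2)) :
    (formPull k (face y.succ)).lTensor (Form k p) ∘ₗ insRight k T p (q + 1) =
      insRight k T p q ∘ₗ (formPull k (face y)).lTensor (Form k p) :=
  biForm_hom_ext_right fun x w' => by
    rw [LinearMap.comp_apply, LinearMap.comp_apply, LinearMap.lTensor_tmul, insRight_tmul hT,
      insRight_tmul hT, LinearMap.lTensor_tmul, formPull_face_succ_ins]

theorem face_succ_insLeft_zero {T : Finset ℤ} (hT : T.Nonempty) (q : ℕ) (y : Fin 1) :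
    (formPull k (face y.succ)).rTensor (Form k q) ∘ₗ insLeft k T 0 q = 0 :=
  biForm_hom_ext_left fun x w' => by
    rw [LinearMap.comp_apply, insLeft_tmul hT, LinearMap.rTensor_tmul, formPull_face_succ_ins_zero,
      TensorProduct.zero_tmul, LinearMap.zero_apply]

theorem face_succ_insRight_zero {T : Finset ℤ} (hT : T.Nonempty) (p : ℕ) (y : Fin 1) :
    (formPull k (face y.succ)).lTensor (Form k p) ∘ₗ insRight k T p 0 = 0 :=
  biForm_hom_ext_right fun x w' => by
    rw [LinearMap.comp_apply, insRight_tmul hT, LinearMap.lTensor_tmul,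
      formPull_face_succ_ins_zero, TensorProduct.tmul_zero, LinearMap.zero_apply]

theorem support_ins {p : ℕ} (s : ℤ) (w : Word p) : (w.ins s).support = insert s w.support := by
  ext x
  simp only [Word.support, Set.mem_iUnion, Set.mem_insert_iff]
  rw [Fin.exists_fin_succ]
  rfl

/-- The relation `R` remains true if a point of `T` outside of one set is added to the other one. -/
structure IsExtendable (T : Finset ℤ) (R : Set ℤ → Set ℤ → Prop) : Prop where
  hereditary : IsHereditary R
  left : ∀ ⦃F F' : Set ℤ⦄ ⦃s : ℤ⦄, s ∈ T → s ∉ F' → R F F' → R (insert s F) F'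
  right : ∀ ⦃F F' : Set ℤ⦄ ⦃s : ℤ⦄, s ∈ T → s ∉ F → R F F' → R F (insert s F')

/-- The cardinality of `T` enters here. If the second word contains a `1`, it misses a point of `T`,
which may be added on the left; otherwise it represents zero and the value of `pick` is irrelevant.
-/
theorem spanRel_le_comap_insLeft {T : Finset ℤ} {R : Set ℤ → Set ℤ → Prop} (hR : IsExtendable T R)
    {p q : ℕ} (hq : q < T.card) :
    spanRel k R p q ≤ (spanRel k R (p + 1) q).comap (insLeft k T p q) := by
  have hT : T.Nonempty := Finset.card_pos.1 (by omega)
  refine Submodule.span_le.2 ?_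
  rintro _ ⟨w, w', h, rfl⟩
  rw [SetLike.mem_coe, Submodule.mem_comap, insLeft_tmul hT, ins_formOf]
  by_cases hw : ∃ i, w' i = Letter.one
  · refine tmul_mem_spanRel ?_
    rw [support_ins]
    exact hR.left (pick_mem hT _) (pick_notMem (exists_mem_notMem_support hq hw)) h
  · push Not at hw
    rw [formOf_eq_zero hw, TensorProduct.tmul_zero]
    exact zero_mem _

theorem spanRel_le_comap_insRight {T : Finset ℤ} {R : Set ℤ → Set ℤ → Prop} (hR : IsExtendable T R)
    {p q : ℕ} (hp : p < T.card) :
    spanRel k R p q ≤ (spanRel k R p (q + 1)).comap (insRight k T p q) := by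
  have hT : T.Nonempty := Finset.card_pos.1 (by omega)
  refine Submodule.span_le.2 ?_
  rintro _ ⟨w, w', h, rfl⟩
  rw [SetLike.mem_coe, Submodule.mem_comap, insRight_tmul hT, ins_formOf]
  by_cases hw : ∃ i, w i = Letter.one
  · refine tmul_mem_spanRel ?_
    rw [support_ins]
    exact hR.right (pick_mem hT _) (pick_notMem (exists_mem_notMem_support hp hw)) h
  · push Not at hw
    rw [formOf_eq_zero hw, TensorProduct.zero_tmul]
    exact zero_mem _

end Supports
end QuasiComm
end

noncomputable section

namespace QuasiComm

/-! ### Exactness for bisimplicial subquotients. -/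

section Subquotients

namespace BiSimp

variable {k : Type u} [CommRing k]

/-- The submodules `U p q` are stable under the simplicial operations. -/
structure IsStable (Q : BiSimp.{u, v} k) (U : ∀ p q, Submodule k (Q.obj p q)) : Prop where
  left : ∀ {a b : ℕ} (q : ℕ) (u : Fin (a + 1) →o Fin (b + 1)),
    U b q ≤ (U a q).comap (Q.pull₁ q u)
  right : ∀ {a b : ℕ} (p : ℕ) (u : Fin (a + 1) →o Fin (b + 1)),
    U p b ≤ (U p a).comap (Q.pull₂ p u)

/-- The bisimplicial submodule given by stable submodules. -/
def sub (Q : BiSimp.{u, v} k) (U : ∀ p q, Submodule k (Q.obj p q)) (hU : Q.IsStable U) :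
    BiSimp.{u, v} k where
  obj p q := U p q
  pull₁ q u := (Q.pull₁ q u).restrict (hU.left q u)
  pull₂ p u := (Q.pull₂ p u).restrict (hU.right p u)
  pull₁_id a q := LinearMap.ext fun x => Subtype.ext (LinearMap.congr_fun (Q.pull₁_id a q) x.1)
  pull₁_comp q u v := LinearMap.ext fun x =>
    Subtype.ext (LinearMap.congr_fun (Q.pull₁_comp q u v) x.1)
  pull₂_id a q := LinearMap.ext fun x => Subtype.ext (LinearMap.congr_fun (Q.pull₂_id a q) x.1)
  pull₂_comp q u v := LinearMap.ext fun x =>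
    Subtype.ext (LinearMap.congr_fun (Q.pull₂_comp q u v) x.1)
  pull_comm u v x := Subtype.ext (Q.pull_comm u v x.1)

/-- The quotient of a bisimplicial module by stable submodules. -/
def quot (Q : BiSimp.{u, v} k) (W : ∀ p q, Submodule k (Q.obj p q)) (hW : Q.IsStable W) :
    BiSimp.{u, v} k where
  obj p q := Q.obj p q ⧸ W p q
  pull₁ q u := (W _ q).mapQ _ (Q.pull₁ q u) (hW.left q u)
  pull₂ p u := (W p _).mapQ _ (Q.pull₂ p u) (hW.right p u)
  pull₁_id a q := Submodule.linearMap_qext _ (LinearMap.ext fun x =>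
    congrArg (W a q).mkQ (LinearMap.congr_fun (Q.pull₁_id a q) x))
  pull₁_comp q u v := Submodule.linearMap_qext _ (LinearMap.ext fun x =>
    congrArg (W _ q).mkQ (LinearMap.congr_fun (Q.pull₁_comp q u v) x))
  pull₂_id a q := Submodule.linearMap_qext _ (LinearMap.ext fun x =>
    congrArg (W a q).mkQ (LinearMap.congr_fun (Q.pull₂_id a q) x))
  pull₂_comp p u v := Submodule.linearMap_qext _ (LinearMap.ext fun x =>
    congrArg (W p _).mkQ (LinearMap.congr_fun (Q.pull₂_comp p u v) x))
  pull_comm u v x := by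
    obtain ⟨x, rfl⟩ := Submodule.mkQ_surjective _ x
    exact congrArg (W _ _).mkQ (Q.pull_comm u v x)

variable {Q : BiSimp.{u, v} k} {U W : ∀ p q, Submodule k (Q.obj p q)}

theorem IsStable.submoduleOf (hU : Q.IsStable U) (hW : Q.IsStable W) :
    (Q.sub U hU).IsStable fun p q => (W p q).submoduleOf (U p q) where
  left q u := fun _ hx => hW.left q u hx
  right p u := fun _ hx => hW.right p u hx

/-- The quotient `U / (W ∩ U)`. -/
abbrev subquot (Q : BiSimp.{u, v} k) {U W : ∀ p q, Submodule k (Q.obj p q)}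
    (hU : Q.IsStable U) (hW : Q.IsStable W) : BiSimp.{u, v} k :=
  (Q.sub U hU).quot _ (hU.submoduleOf hW)

/-- The class of an element of `U`. -/
abbrev cls (hU : Q.IsStable U) (hW : Q.IsStable W) {p q : ℕ} (x : U p q) :
    (Q.subquot hU hW).obj p q := Submodule.Quotient.mk x

theorem cls_eq_zero (hU : Q.IsStable U) (hW : Q.IsStable W) {p q : ℕ} (x : U p q) :
    cls hU hW x = 0 ↔ x.1 ∈ W p q := Submodule.Quotient.mk_eq_zero _

/-- An extra degeneracy `s` that preserves `U` and `W` acts on the subquotient. The element `s x`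
lifts `x`, and its other faces are the values of `s` on the faces of `x`, hence lie in `W`. -/
theorem subquot_rowExact (hU : Q.IsStable U) (hW : Q.IsStable W) {t : ℕ}
    (s : ∀ p q, Q.obj p q →ₗ[k] Q.obj (p + 1) q)
    (hsU : ∀ p q, q < t → ∀ x ∈ U p q, s p q x ∈ U (p + 1) q)
    (hsW : ∀ p q, q < t → ∀ x ∈ W p q, s p q x ∈ W (p + 1) q)
    (h0 : ∀ p q, q < t → ∀ x, Q.pull₁ q (face 0) (s p q x) = x)
    (h1 : ∀ p q, q < t → ∀ (y : Fin (p + 2)) x, Q.pull₁ q (face y.succ) (s (p + 1) q x) =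
      s p q (Q.pull₁ q (face y) x))
    (h2 : ∀ q, q < t → ∀ (y : Fin 1) x, Q.pull₁ q (face y.succ) (s 0 q x) = 0) :
    (Q.subquot hU hW).RowExact t := by
  intro p q hq x hx
  obtain ⟨x, rfl⟩ := Submodule.mkQ_surjective _ x
  refine ⟨cls hU hW ⟨s p q x.1, hsU p q hq x.1 x.2⟩, ?_, ?_⟩
  · refine SimpMod.isMoore_of_face (S := (Q.subquot hU hW).row q) fun y => ?_
    refine (cls_eq_zero hU hW ((Q.sub U hU).pull₁ q (face y.succ) _)).2 ?_
    change Q.pull₁ q (face y.succ) (s p q x.1) ∈ W p q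
    cases p with
    | zero => rw [h2 q hq]; exact zero_mem _
    | succ p =>
      rw [h1 p q hq]
      exact hsW p q hq _ ((cls_eq_zero hU hW ((Q.sub U hU).pull₁ q (face y) x)).1
        (hx (face y) (face_not_surjective y)))
  · exact congrArg (cls hU hW) (Subtype.ext (h0 p q hq x.1))

theorem subquot_colExact (hU : Q.IsStable U) (hW : Q.IsStable W) {t : ℕ}
    (s : ∀ p q, Q.obj p q →ₗ[k] Q.obj p (q + 1))
    (hsU : ∀ p q, p < t → ∀ x ∈ U p q, s p q x ∈ U p (q + 1))
    (hsW : ∀ p q, p < t → ∀ x ∈ W p q, s p q x ∈ W p (q + 1))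
    (h0 : ∀ p q, p < t → ∀ x, Q.pull₂ p (face 0) (s p q x) = x)
    (h1 : ∀ p q, p < t → ∀ (y : Fin (q + 2)) x, Q.pull₂ p (face y.succ) (s p (q + 1) x) =
      s p q (Q.pull₂ p (face y) x))
    (h2 : ∀ p, p < t → ∀ (y : Fin 1) x, Q.pull₂ p (face y.succ) (s p 0 x) = 0) :
    (Q.subquot hU hW).ColExact t := by
  intro p q hp x hx
  obtain ⟨x, rfl⟩ := Submodule.mkQ_surjective _ x
  refine ⟨cls hU hW ⟨s p q x.1, hsU p q hp x.1 x.2⟩, ?_, ?_⟩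
  · refine SimpMod.isMoore_of_face (S := (Q.subquot hU hW).col p) fun y => ?_
    refine (cls_eq_zero hU hW ((Q.sub U hU).pull₂ p (face y.succ) _)).2 ?_
    change Q.pull₂ p (face y.succ) (s p q x.1) ∈ W p q
    cases q with
    | zero => rw [h2 p hp]; exact zero_mem _
    | succ q =>
      rw [h1 p q hp]
      exact hsW p q hp _ ((cls_eq_zero hU hW ((Q.sub U hU).pull₂ p (face y) x)).1
        (hx (face y) (face_not_surjective y)))
  · exact congrArg (cls hU hW) (Subtype.ext (h0 p q hp x.1))

/-- A class killed by all faces but the zeroth ones has a representative with the same property. -/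
theorem exists_moore_sub_mem (hU : Q.IsStable U) (hW : Q.IsStable W) {p q : ℕ} (x : U p q)
    (h₁ : ((Q.subquot hU hW).row q).IsMoore (cls hU hW x))
    (h₂ : ((Q.subquot hU hW).col p).IsMoore (cls hU hW x)) :
    ∃ y ∈ U p q, (Q.row q).IsMoore y ∧ (Q.col p).IsMoore y ∧ x.1 - y ∈ W p q := by
  let P := Q.sub U hU
  have e1 := fun z => SimpMod.moore_map (S := P.row q) (S' := (Q.subquot hU hW).row q) (a := p)
    (Submodule.mkQ _) (fun _ _ => rfl) z
  have e2 := fun z => SimpMod.moore_map (S := P.col p) (S' := (Q.subquot hU hW).col p) (a := q)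
    (Submodule.mkQ _) (fun _ _ => rfl) z
  refine ⟨((P.row q).moore p ((P.col p).moore q x)).1, Subtype.prop _, ?_, ?_, ?_⟩
  · exact SimpMod.IsMoore.map (S := P.row q) (S' := Q.row q) (SimpMod.isMoore_moore _)
      (fun a => (U a q).subtype) fun _ _ => rfl
  · exact SimpMod.IsMoore.map (S := P.col p) (S' := Q.col p)
      (moore₁_isMoore₂ (SimpMod.isMoore_moore _)) (fun a => (U p a).subtype) fun _ _ => rfl
  · exact (Submodule.Quotient.eq ((W p q).submoduleOf (U p q))).1 (((e1 _).symm.trans ((congrArg _ ((e2 _).symm.trans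
      (SimpMod.moore_eq (S := (Q.subquot hU hW).col p) h₂))).trans
      (SimpMod.moore_eq (S := (Q.subquot hU hW).row q) h₁))).symm)

/-- Relative version of the exactness of the complex of the cycles in both directions. -/
theorem exists_sub_d_mem (hU : Q.IsStable U) (hW : Q.IsStable W) {t : ℕ}
    (hr : (Q.subquot hU hW).RowExact t) (hc : (Q.subquot hU hW).ColExact t)
    (d : ∀ p q, Q.obj p q →ₗ[k] Q.obj p q) (hdU : ∀ p q, U p q ≤ (U p q).comap (d p q))
    (hdW : ∀ p q, W p q ≤ (W p q).comap (d p q)) (hdd : ∀ p q x, d p q (d p q x) = 0)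
    (hd₁ : ∀ {a b : ℕ} (q : ℕ) (u : Fin (a + 1) →o Fin (b + 1)) (x : Q.obj b q),
      Q.pull₁ q u (d b q x) = d a q (Q.pull₁ q u x))
    (hd₂ : ∀ {a b : ℕ} (p : ℕ) (u : Fin (a + 1) →o Fin (b + 1)) (x : Q.obj p b),
      Q.pull₂ p u (d p b x) = d p a (Q.pull₂ p u x))
    (H : ∀ p q, Q.obj p q →ₗ[k] Q.obj p q) (hHU : ∀ p q, U p q ≤ (U p q).comap (H p q))
    (hHW : ∀ p q, W p q ≤ (W p q).comap (H p q))
    (hH : ∀ p q x, x - d p q (H p q x) - H p q (d p q x) ∈ W p q)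
    {p q : ℕ} (hpq : p + q + 1 < t) (z : Q.obj p q) (hz : z ∈ U p q) (h₁ : (Q.row q).IsCycle z)
    (h₂ : (Q.col p).IsCycle z) (hd : d p q z ∈ W p q) :
    ∃ f ∈ U (p + 1) (q + 1), (Q.row (q + 1)).IsMoore f ∧ (Q.col (p + 1)).IsMoore f ∧
      z - d p q (Q.pull₁ q (face 0) (Q.pull₂ (p + 1) (face 0) f)) ∈ W p q := by
  let d' : ∀ p q, (Q.subquot hU hW).obj p q →ₗ[k] (Q.subquot hU hW).obj p q := fun p q =>
    Submodule.mapQ _ _ ((d p q).restrict (hdU p q)) fun x hx => hdW p q hx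
  obtain ⟨y, hy₁, hy₂, hy⟩ := BiSimp.exists_d_eq_of_cycle d' hr hc
    (fun p q x => by
      obtain ⟨x, rfl⟩ := Submodule.mkQ_surjective _ x
      exact congrArg (cls hU hW) (Subtype.ext (hdd p q x.1)))
    (fun q u x => by
      obtain ⟨x, rfl⟩ := Submodule.mkQ_surjective _ x
      exact congrArg (cls hU hW) (Subtype.ext (hd₁ q u x.1)))
    (fun p u x => by
      obtain ⟨x, rfl⟩ := Submodule.mkQ_surjective _ x
      exact congrArg (cls hU hW) (Subtype.ext (hd₂ p u x.1)))
    (fun p q x hx => by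
      obtain ⟨x, rfl⟩ := Submodule.mkQ_surjective _ x
      -- The homotopy need only contract modulo `W`: if `dx` lies in `W`, then `x` agrees with `d (H
      -- x)` modulo `W`.
      have hx' : d p q x.1 ∈ W p q :=
        (cls_eq_zero hU hW ⟨d p q x.1, hdU p q x.2⟩).1 hx
      refine ⟨cls hU hW ⟨H p q x.1, hHU p q x.2⟩, Eq.symm ((Submodule.Quotient.eq _).2 ?_)⟩
      have := add_mem (hH p q x.1) (hHW p q hx')
      rwa [sub_add_cancel] at this) q hpq
    (cls hU hW ⟨z, hz⟩)
    (fun v hv => (cls_eq_zero hU hW ((Q.sub U hU).pull₁ q v ⟨z, hz⟩)).2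
      ((h₁ v hv).symm ▸ zero_mem _ : Q.pull₁ q v z ∈ _))
    (fun v hv => (cls_eq_zero hU hW ((Q.sub U hU).pull₂ p v ⟨z, hz⟩)).2
      ((h₂ v hv).symm ▸ zero_mem _ : Q.pull₂ p v z ∈ _))
    ((cls_eq_zero hU hW ⟨d p q z, hdU p q hz⟩).2 hd)
  obtain ⟨f, hf₁, hf₂, rfl⟩ := BiSimp.exists_face_face hr hc q p hpq y hy₁ hy₂
  obtain ⟨x, rfl⟩ := Submodule.mkQ_surjective _ f
  -- So far the lift is Moore modulo `W` only. The Whitney formula needs an actual Moore element,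
  -- and the projectors supply one in the same class.
  obtain ⟨f, hf, hf₁, hf₂, hxf⟩ := BiSimp.exists_moore_sub_mem hU hW x hf₁ hf₂
  refine ⟨f, hf, hf₁, hf₂, ?_⟩
  have h' : z - d p q (Q.pull₁ q (face 0) (Q.pull₂ (p + 1) (face 0) x.1)) ∈ W p q :=
    (Submodule.Quotient.eq ((W p q).submoduleOf (U p q))).1 hy.symm
  have h2 : d p q (Q.pull₁ q (face 0) (Q.pull₂ (p + 1) (face 0) (x.1 - f))) ∈ W p q :=
    hdW p q (hW.left q (face 0) (hW.right (p + 1) (face 0) hxf))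
  have := add_mem h' h2
  rwa [map_sub (Q.pull₂ (p + 1) (face 0)), map_sub (Q.pull₁ q (face 0)), map_sub (d p q),
    sub_add_sub_cancel] at this

end BiSimp

/-! ### Forms with coefficients and the relative exactness theorem for them. -/

variable {k : Type u} [CommRing k]

/-- The bisimplicial module `A ⊗ (D*(Δ_•) ⊗ D*(Δ_•))`. -/
abbrev biFormSimp (A : Type v) [AddCommGroup A] [Module k A] : BiSimp.{u, max u v} k where
  obj p q := A ⊗[k] BiForm k p q
  pull₁ q u := ((formPull k u).rTensor (Form k q)).lTensor A
  pull₂ p u := ((formPull k u).lTensor (Form k p)).lTensor A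
  pull₁_id a q := by rw [formPull_id, LinearMap.rTensor_id, LinearMap.lTensor_id]
  pull₁_comp q u v := by rw [formPull_comp, LinearMap.rTensor_comp, LinearMap.lTensor_comp]
  pull₂_id a q := by rw [formPull_id, LinearMap.lTensor_id, LinearMap.lTensor_id]
  pull₂_comp q u v := by rw [formPull_comp, LinearMap.lTensor_comp, LinearMap.lTensor_comp]
  pull_comm u v x := by
    rw [← LinearMap.comp_apply, ← LinearMap.comp_apply, ← LinearMap.lTensor_comp,
      ← LinearMap.lTensor_comp, LinearMap.rTensor_comp_lTensor, LinearMap.lTensor_comp_rTensor]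

/-- The image of `A ⊗ B` in `A ⊗ V`. -/
def coeffs (A : Type v) [AddCommGroup A] [Module k A] {V : Type w} [AddCommGroup V] [Module k V]
    (B : Submodule k V) : Submodule k (A ⊗[k] V) := LinearMap.range (B.subtype.lTensor A)

section Coeffs

variable {A : Type*} [AddCommGroup A] [Module k A] {A' : Type*} [AddCommGroup A'] [Module k A']
  {V : Type*} [AddCommGroup V] [Module k V] {V' : Type*} [AddCommGroup V'] [Module k V']

theorem tmul_mem_coeffs (a : A) {B : Submodule k V} {b : V} (hb : b ∈ B) :
    a ⊗ₜ[k] b ∈ coeffs A B := ⟨a ⊗ₜ ⟨b, hb⟩, by simp⟩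

theorem coeffs_le {B : Submodule k V} {U : Submodule k (A ⊗[k] V)}
    (h : ∀ a, ∀ b ∈ B, a ⊗ₜ[k] b ∈ U) : coeffs A B ≤ U := by
  rintro _ ⟨x, rfl⟩
  induction x with
  | zero => rw [map_zero]; exact zero_mem _
  | add x y hx hy => rw [map_add]; exact add_mem hx hy
  | tmul a b => exact h a b.1 b.2

theorem mem_coeffs_top (x : A ⊗[k] V) : x ∈ coeffs A (⊤ : Submodule k V) := by
  induction x with
  | zero => exact zero_mem _
  | add x y hx hy => exact add_mem hx hy
  | tmul a b => exact tmul_mem_coeffs a trivial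

theorem coeffs_mono {B B' : Submodule k V} (h : B ≤ B') : coeffs A B ≤ coeffs A B' :=
  coeffs_le fun a _ hb => tmul_mem_coeffs a (h hb)

theorem coeffs_le_comap_map {B : Submodule k V} {B' : Submodule k V'} {f : V →ₗ[k] V'}
    (g : A →ₗ[k] A') (h : B ≤ B'.comap f) :
    coeffs A B ≤ (coeffs A' B').comap (TensorProduct.map g f) :=
  coeffs_le fun a b hb => by
    rw [Submodule.mem_comap, TensorProduct.map_tmul]
    exact tmul_mem_coeffs _ (h hb)

theorem coeffs_le_comap_lTensor {B : Submodule k V} {B' : Submodule k V'} {f : V →ₗ[k] V'}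
    (h : B ≤ B'.comap f) : coeffs A B ≤ (coeffs A B').comap (f.lTensor A) :=
  coeffs_le_comap_map LinearMap.id h

theorem coeffs_le_comap_rTensor {B : Submodule k V} (g : A →ₗ[k] A') :
    coeffs A B ≤ (coeffs A' B).comap (g.rTensor V) :=
  coeffs_le_comap_map (f := LinearMap.id) g le_rfl

end Coeffs

section RelExact

variable (A : Type v) [AddCommGroup A] [Module k A] {T : Finset ℤ} {R R' : Set ℤ → Set ℤ → Prop}

theorem isStable_coeffs (hR : IsHereditary R) :
    (biFormSimp (k := k) A).IsStable fun p q => coeffs A (spanRel k R p q) where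
  left q u := coeffs_le_comap_lTensor (spanRel_le_comap_map hR (isLocal_formPull u) (isLocal_id q))
  right p u := coeffs_le_comap_lTensor (spanRel_le_comap_map hR (isLocal_id p) (isLocal_formPull u))

theorem map_mem_bot {V W : Type*} [AddCommGroup V] [Module k V] [AddCommGroup W] [Module k W]
    (f : V →ₗ[k] W) {x : V} (hx : x ∈ (⊥ : Submodule k V)) : f x ∈ (⊥ : Submodule k W) := by
  rw [(Submodule.mem_bot k).1 hx, map_zero]
  exact zero_mem _

theorem isStable_bot (Q : BiSimp.{u, v} k) : Q.IsStable fun _ _ => ⊥ where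
  left _ _ := bot_le
  right _ _ := bot_le

/-- The submodule `W` is left free because two cases are needed: zero, for absolute lifts, and the
forms satisfying a stronger condition, for relative acyclicity. -/
theorem rowExact_coeffs (hR' : IsExtendable T R')
    {W : ∀ p q, Submodule k ((biFormSimp (k := k) A).obj p q)}
    (hW : (biFormSimp (k := k) A).IsStable W)
    (h : ∀ p q, q < T.card → ∀ x ∈ W p q, (insLeft k T p q).lTensor A x ∈ W (p + 1) q) :
    (BiSimp.subquot _ (isStable_coeffs A hR'.hereditary) hW).RowExact T.card := by
  refine BiSimp.subquot_rowExact _ _ (fun p q => (insLeft k T p q).lTensor A)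
    (fun p q hq => coeffs_le_comap_lTensor (spanRel_le_comap_insLeft hR' hq)) h ?_ ?_ ?_
  · intro p q hq x
    change (LinearMap.lTensor A _ ∘ₗ LinearMap.lTensor A _) x = x
    rw [← LinearMap.lTensor_comp, face_zero_insLeft (Finset.card_pos.1 (by omega)),
      LinearMap.lTensor_id]
    rfl
  · intro p q hq y x
    change (LinearMap.lTensor A _ ∘ₗ LinearMap.lTensor A _) x =
      (LinearMap.lTensor A _ ∘ₗ LinearMap.lTensor A _) x
    rw [← LinearMap.lTensor_comp, face_succ_insLeft (Finset.card_pos.1 (by omega)),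
      LinearMap.lTensor_comp]
  · intro q hq y x
    change (LinearMap.lTensor A _ ∘ₗ LinearMap.lTensor A _) x = 0
    rw [← LinearMap.lTensor_comp, face_succ_insLeft_zero (Finset.card_pos.1 (by omega)),
      LinearMap.lTensor_zero]
    rfl

theorem colExact_coeffs (hR' : IsExtendable T R')
    {W : ∀ p q, Submodule k ((biFormSimp (k := k) A).obj p q)}
    (hW : (biFormSimp (k := k) A).IsStable W)
    (h : ∀ p q, p < T.card → ∀ x ∈ W p q, (insRight k T p q).lTensor A x ∈ W p (q + 1)) :
    (BiSimp.subquot _ (isStable_coeffs A hR'.hereditary) hW).ColExact T.card := by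
  refine BiSimp.subquot_colExact _ _ (fun p q => (insRight k T p q).lTensor A)
    (fun p q hq => coeffs_le_comap_lTensor (spanRel_le_comap_insRight hR' hq)) h ?_ ?_ ?_
  · intro p q hq x
    change (LinearMap.lTensor A _ ∘ₗ LinearMap.lTensor A _) x = x
    rw [← LinearMap.lTensor_comp, face_zero_insRight (Finset.card_pos.1 (by omega)),
      LinearMap.lTensor_id]
    rfl
  · intro p q hq y x
    change (LinearMap.lTensor A _ ∘ₗ LinearMap.lTensor A _) x =
      (LinearMap.lTensor A _ ∘ₗ LinearMap.lTensor A _) x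
    rw [← LinearMap.lTensor_comp, face_succ_insRight (Finset.card_pos.1 (by omega)),
      LinearMap.lTensor_comp]
  · intro q hq y x
    change (LinearMap.lTensor A _ ∘ₗ LinearMap.lTensor A _) x = 0
    rw [← LinearMap.lTensor_comp, face_succ_insRight_zero (Finset.card_pos.1 (by omega)),
      LinearMap.lTensor_zero]
    rfl

variable {A}

theorem lTensor_biPull_face {p q : ℕ} (x : A ⊗[k] BiForm k (p + 1) (q + 1)) :
    (biPull k (face 0) (face 0)).lTensor A x = ((formPull k (face 0)).rTensor (Form k q)).lTensor A
      (((formPull k (face 0)).lTensor (Form k (p + 1))).lTensor A x) := by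
  rw [← LinearMap.comp_apply, ← LinearMap.lTensor_comp, LinearMap.rTensor_comp_lTensor]
  rfl

/-- An element all of whose faces vanish is a face in both directions. -/
theorem exists_face_face_eq (hR : IsExtendable T R) {p q : ℕ} (hpq : p + q + 1 < T.card)
    {g : A ⊗[k] BiForm k p q} (hg : g ∈ coeffs A (spanRel k R p q))
    (h₁ : ((biFormSimp A).row q).IsCycle g) (h₂ : ((biFormSimp A).col p).IsCycle g) :
    ∃ f ∈ coeffs A (spanRel k R (p + 1) (q + 1)),
      ((biFormSimp A).row (q + 1)).IsMoore f ∧ ((biFormSimp A).col (p + 1)).IsMoore f ∧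
      (biPull k (face 0) (face 0)).lTensor A f = g := by
  let hU := isStable_coeffs (k := k) A hR.hereditary
  let hW := isStable_bot (biFormSimp (k := k) A)
  -- With `W = ⊥` the subquotient is the submodule itself, so the lift obtained has exactly the
  -- prescribed double face.
  have hr := rowExact_coeffs A hR hW fun p q _ x hx =>
    map_mem_bot (LinearMap.lTensor A _) hx
  have hc := colExact_coeffs A hR hW fun p q _ x hx =>
    map_mem_bot (LinearMap.lTensor A _) hx
  obtain ⟨y, hy₁, hy₂, hy⟩ := BiSimp.exists_face_face hr hc q p hpq
    (BiSimp.cls hU hW ⟨g, hg⟩) (fun v hv => (BiSimp.cls_eq_zero hU hW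
      (((biFormSimp A).sub _ hU).pull₁ q v ⟨g, hg⟩)).2 ((Submodule.mem_bot k).2 (h₁ v hv)))
      (fun v hv => (BiSimp.cls_eq_zero hU hW
      (((biFormSimp A).sub _ hU).pull₂ p v ⟨g, hg⟩)).2 ((Submodule.mem_bot k).2 (h₂ v hv)))
  obtain ⟨y, rfl⟩ := Submodule.mkQ_surjective _ y
  obtain ⟨f, hf, hf₁, hf₂, hyf⟩ := BiSimp.exists_moore_sub_mem hU hW y hy₁ hy₂
  refine ⟨f, hf, hf₁, hf₂, ?_⟩
  have e : y.1 = f := sub_eq_zero.1 ((Submodule.mem_bot k).1 hyf)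
  have := (Submodule.Quotient.eq _).1 hy
  have h := sub_eq_zero.1 ((Submodule.mem_bot k).1 this)
  exact (lTensor_biPull_face f).trans ((congrArg (fun x => (biFormSimp A).pull₁ q (face 0)
    ((biFormSimp A).pull₂ (p + 1) (face 0) x)) e.symm).trans h)

/-- The defect of the contraction is the projection on constants. These have empty supports, so they
satisfy `R` and vanish in the relative complex. -/
theorem lTensor_biHomotopy_mem (h0 : R ∅ ∅) {p q : ℕ} (x : A ⊗[k] BiForm k p q) :
    x - (biD k p q).lTensor A ((biHomotopy k p q).lTensor A x) -
      (biHomotopy k p q).lTensor A ((biD k p q).lTensor A x) ∈ coeffs A (spanRel k R p q) := by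
  have := congrArg (fun f => LinearMap.lTensor A f x) (biD_biHomotopy (k := k) p q)
  simp only [LinearMap.lTensor_add, LinearMap.lTensor_sub, LinearMap.lTensor_comp,
    LinearMap.lTensor_id, LinearMap.add_apply, LinearMap.sub_apply, LinearMap.comp_apply,
    LinearMap.id_apply] at this
  rw [sub_sub, this, sub_sub_cancel]
  have h : (⊤ : Submodule k (BiForm k p q)) ≤ (spanRel k R p q).comap
      (TensorProduct.map (unitProj k p) (unitProj k q)) := fun y _ => map_unitProj_mem h0 p q y
  exact coeffs_le_comap_lTensor h (mem_coeffs_top x)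

theorem lTensor_biD_biD {p q : ℕ} (x : A ⊗[k] BiForm k p q) :
    (biD k p q).lTensor A ((biD k p q).lTensor A x) = 0 := by
  rw [← LinearMap.comp_apply, ← LinearMap.lTensor_comp, biD_comp_self, LinearMap.lTensor_zero,
    LinearMap.zero_apply]

theorem rTensor_formPull_biD {p p' : ℕ} (q : ℕ) (u : Fin (p + 1) →o Fin (p' + 1))
    (x : A ⊗[k] BiForm k p' q) :
    ((formPull k u).rTensor (Form k q)).lTensor A ((biD k p' q).lTensor A x) =
      (biD k p q).lTensor A (((formPull k u).rTensor _).lTensor A x) := by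
  have := biD_comp_biPull (k := k) u (OrderHom.id : Fin (q + 1) →o Fin (q + 1))
  rw [biPull, formPull_id] at this
  rw [← LinearMap.comp_apply, ← LinearMap.lTensor_comp, ← LinearMap.comp_apply,
    ← LinearMap.lTensor_comp]
  exact congrArg (fun f => LinearMap.lTensor A f x) this.symm

theorem lTensor_formPull_biD {q q' : ℕ} (p : ℕ) (u : Fin (q + 1) →o Fin (q' + 1))
    (x : A ⊗[k] BiForm k p q') :
    ((formPull k u).lTensor (Form k p)).lTensor A ((biD k p q').lTensor A x) =
      (biD k p q).lTensor A (((formPull k u).lTensor _).lTensor A x) := by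
  have := biD_comp_biPull (k := k) (OrderHom.id : Fin (p + 1) →o Fin (p + 1)) u
  rw [biPull, formPull_id] at this
  rw [← LinearMap.comp_apply, ← LinearMap.lTensor_comp, ← LinearMap.comp_apply,
    ← LinearMap.lTensor_comp]
  exact congrArg (fun f => LinearMap.lTensor A f x) this.symm

/-- The relative complex of the elements all of whose faces vanish is exact. -/
theorem exists_sub_d_mem (hR : IsExtendable T R) (hR' : IsExtendable T R')
    (h0 : R ∅ ∅) {p q : ℕ} (hpq : p + q + 1 < T.card)
    {z : A ⊗[k] BiForm k p q} (hz : z ∈ coeffs A (spanRel k R' p q))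
    (h₁ : ((biFormSimp A).row q).IsCycle z) (h₂ : ((biFormSimp A).col p).IsCycle z)
    (hd : (biD k p q).lTensor A z ∈ coeffs A (spanRel k R p q)) :
    ∃ f ∈ coeffs A (spanRel k R' (p + 1) (q + 1)),
      ((biFormSimp A).row (q + 1)).IsMoore f ∧ ((biFormSimp A).col (p + 1)).IsMoore f ∧
      z - (biD k p q).lTensor A ((biPull k (face 0) (face 0)).lTensor A f) ∈
        coeffs A (spanRel k R p q) := by
  let hU := isStable_coeffs (k := k) A hR'.hereditary
  let hW := isStable_coeffs (k := k) A hR.hereditary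
  have hr := rowExact_coeffs A hR' hW fun p q hq =>
    coeffs_le_comap_lTensor (spanRel_le_comap_insLeft hR hq)
  have hc := colExact_coeffs A hR' hW fun p q hp =>
    coeffs_le_comap_lTensor (spanRel_le_comap_insRight hR hp)
  obtain ⟨f, hf, hf₁, hf₂, h⟩ := BiSimp.exists_sub_d_mem hU hW hr hc
    (fun p q => (biD k p q).lTensor A)
    (fun p q => coeffs_le_comap_lTensor (spanRel_le_comap_biD hR'.hereditary p q))
    (fun p q => coeffs_le_comap_lTensor (spanRel_le_comap_biD hR.hereditary p q))
    (fun p q => lTensor_biD_biD) (fun q u x => rTensor_formPull_biD q u x)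
    (fun p u x => lTensor_formPull_biD p u x) (fun p q => (biHomotopy k p q).lTensor A)
    (fun p q => coeffs_le_comap_lTensor (spanRel_le_comap_biHomotopy hR'.hereditary p q))
    (fun p q => coeffs_le_comap_lTensor (spanRel_le_comap_biHomotopy hR.hereditary p q))
    (fun p q x => lTensor_biHomotopy_mem h0 x) hpq z hz h₁ h₂ hd
  exact ⟨f, hf, hf₁, hf₂, (congrArg (fun y => z - (biD k p q).lTensor A y ∈
    coeffs A (spanRel k R p q)) (lTensor_biPull_face f)).mpr h⟩

end RelExact

end Subquotients
end QuasiComm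
end

noncomputable section

namespace QuasiComm

/-! ### The Whitney family in two variables. -/

section BiWhitney

variable {k : Type u} [CommRing k]

theorem CosMod.normal_rTensor (C : CosMod.{u, v} k) (V : Type w) [AddCommGroup V] [Module k V]
    (a : ℕ) : (C.rTensor V).normal a = (C.normal a).rTensor V := by
  change _ = LinearMap.rTensorHom V (C.normal a)
  simp only [CosMod.normal, map_sum, map_smul]
  rfl

theorem CosMod.normal_lTensor (C : CosMod.{u, v} k) (V : Type w) [AddCommGroup V] [Module k V]
    (a : ℕ) : (C.lTensor V).normal a = (C.normal a).lTensor V := by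
  change _ = LinearMap.lTensorHom V (C.normal a)
  simp only [CosMod.normal, map_sum, map_smul]
  rfl

theorem SimpMod.moore_rTensor (S : SimpMod.{u, v} k) (V : Type w) [AddCommGroup V] [Module k V]
    (a : ℕ) : (S.rTensor V).moore a = (S.moore a).rTensor V := by
  change _ = LinearMap.rTensorHom V (S.moore a)
  simp only [SimpMod.moore, map_sum, map_smul]
  rfl

theorem SimpMod.moore_lTensor (S : SimpMod.{u, v} k) (V : Type w) [AddCommGroup V] [Module k V]
    (a : ℕ) : (S.lTensor V).moore a = (S.moore a).lTensor V := by
  change _ = LinearMap.lTensorHom V (S.moore a)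
  simp only [SimpMod.moore, map_sum, map_smul]
  rfl

theorem isNormal_rTensor_normal {C : CosMod.{u, v} k} {V : Type w} [AddCommGroup V] [Module k V]
    {a : ℕ} (ξ : C.obj a ⊗[k] V) : (C.rTensor V).IsNormal ((C.normal a).rTensor V ξ) := by
  rw [← CosMod.normal_rTensor]
  exact CosMod.isNormal_normal (C := C.rTensor V) ξ

/-- The composition of the projection on the normal elements and of `whitney`. -/
def normalWhitney (C : CosMod.{u, w} k) (S : SimpMod.{u, v} k) (r p : ℕ) :
    C.obj r ⊗[k] S.obj (r + 1) →ₗ[k] C.obj p ⊗[k] S.obj p :=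
  whitney C S r p ∘ₗ (C.normal r).rTensor _

theorem normalWhitney_compatible (C : CosMod.{u, w} k) (S : SimpMod.{u, v} k) (r : ℕ) {p p' : ℕ}
    (v : Fin (p + 1) →o Fin (p' + 1)) :
    (C.push v).rTensor (S.obj p) ∘ₗ normalWhitney C S r p =
      (S.pull v).lTensor (C.obj p') ∘ₗ normalWhitney C S r p' :=
  LinearMap.ext fun ξ => whitney_compatible v (isNormal_rTensor_normal ξ)

theorem normalWhitney_of_lt (C : CosMod.{u, w} k) (S : SimpMod.{u, v} k) {r p : ℕ} (h : p < r) :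
    normalWhitney C S r p = 0 :=
  LinearMap.ext fun ξ => whitney_of_lt h (isNormal_rTensor_normal ξ)

/-- The projectors make every element normal and Moore, so `whitney_self` becomes an identity of
linear maps. In this form it can be tensored with its analogue in the second variable. -/
theorem normalWhitney_self (C : CosMod.{u, w} k) (S : SimpMod.{u, v} k) (r : ℕ) :
    normalWhitney C S r r ∘ₗ (S.moore (r + 1)).lTensor (C.obj r) =
      TensorProduct.map (C.normal r) (S.pull (face 0) ∘ₗ S.moore (r + 1)) := by
  refine LinearMap.ext fun ξ => ?_
  have e : (C.normal r).rTensor _ ((S.moore (r + 1)).lTensor (C.obj r) ξ) =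
      (S.lTensor (C.obj r)).moore (r + 1) ((C.normal r).rTensor _ ξ) := by
    rw [SimpMod.moore_lTensor, ← LinearMap.comp_apply, ← LinearMap.comp_apply,
      LinearMap.rTensor_comp_lTensor, LinearMap.lTensor_comp_rTensor]
  rw [LinearMap.comp_apply, normalWhitney, LinearMap.comp_apply,
    whitney_self (isNormal_rTensor_normal _)]
  · rw [← LinearMap.comp_apply, ← LinearMap.comp_apply, LinearMap.lTensor_comp_rTensor,
      LinearMap.map_comp_lTensor]
  · rw [e]
    exact SimpMod.isMoore_moore (S := S.lTensor (C.obj r)) _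

theorem normalWhitney_eq_sum (C : CosMod.{u, w} k) (S : SimpMod.{u, v} k) (r p : ℕ) :
    normalWhitney C S r p = ∑ u : Fin (r + 1) →o Fin (p + 1),
      TensorProduct.map (C.push u ∘ₗ C.normal r) (whitneyCoeff S u) := by
  refine LinearMap.ext fun ξ => ?_
  rw [normalWhitney, whitney, LinearMap.comp_apply, LinearMap.sum_apply, LinearMap.sum_apply]
  refine Finset.sum_congr rfl fun u _ => ?_
  rw [← LinearMap.comp_apply, LinearMap.map_comp_rTensor]

section Comm

theorem rTensor_lTensor_apply {V V' W W' : Type*} [AddCommGroup V] [AddCommGroup V']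
    [AddCommGroup W] [AddCommGroup W'] [Module k V] [Module k V'] [Module k W] [Module k W']
    (f : V →ₗ[k] V') (g : W →ₗ[k] W') (x : V ⊗[k] W) :
    f.rTensor W' (g.lTensor V x) = TensorProduct.map f g x := by
  rw [← LinearMap.comp_apply, LinearMap.rTensor_comp_lTensor]

theorem lTensor_rTensor_comm {V V' W W' : Type*} [AddCommGroup V] [AddCommGroup V']
    [AddCommGroup W] [AddCommGroup W'] [Module k V] [Module k V'] [Module k W] [Module k W']
    (f : V →ₗ[k] V') (g : W →ₗ[k] W') (x : V ⊗[k] W) :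
    g.lTensor V' (f.rTensor W x) = f.rTensor W' (g.lTensor V x) := by
  rw [rTensor_lTensor_apply, ← LinearMap.comp_apply, LinearMap.lTensor_comp_rTensor]

open TensorProduct in
theorem map_tensorTensorTensorComm {V V' W W' A A' B B' : Type*} [AddCommGroup V]
    [AddCommGroup V'] [AddCommGroup W] [AddCommGroup W'] [AddCommGroup A] [AddCommGroup A']
    [AddCommGroup B] [AddCommGroup B'] [Module k V] [Module k V'] [Module k W] [Module k W']
    [Module k A] [Module k A'] [Module k B] [Module k B'] (f : V →ₗ[k] V') (g : W →ₗ[k] W')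
    (a : A →ₗ[k] A') (b : B →ₗ[k] B') (z : (V ⊗[k] A) ⊗[k] (W ⊗[k] B)) :
    map (map f g) (map a b) (tensorTensorTensorComm k V A W B z) =
      tensorTensorTensorComm k V' A' W' B' (map (map f a) (map g b) z) := by
  refine LinearMap.congr_fun (f := map (map f g) (map a b) ∘ₗ
    (tensorTensorTensorComm k V A W B).toLinearMap) (g := (tensorTensorTensorComm k V' A' W' B' :
      _ →ₗ[k] _) ∘ₗ map (map f a) (map g b)) (ext_fourfold' fun x y z w => ?_) z
  simp

end Comm

variable (C : CosMod.{u, v} k) (D : CosMod.{u, w} k)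
variable (S S' : SimpMod.{u, u} k)

/-- The construction `normalWhitney` in both directions. -/
def biWhitney (r s p q : ℕ) :
    (C.obj r ⊗[k] D.obj s) ⊗[k] (S.obj (r + 1) ⊗[k] S'.obj (s + 1)) →ₗ[k]
      (C.obj p ⊗[k] D.obj q) ⊗[k] (S.obj p ⊗[k] S'.obj q) :=
  (TensorProduct.tensorTensorTensorComm k _ _ _ _).toLinearMap ∘ₗ
    TensorProduct.map (normalWhitney C S r p) (normalWhitney D S' s q) ∘ₗ
      (TensorProduct.tensorTensorTensorComm k _ _ _ _).symm.toLinearMap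

theorem biWhitney_comm (r s p q : ℕ)
    (z : (C.obj r ⊗[k] S.obj (r + 1)) ⊗[k] (D.obj s ⊗[k] S'.obj (s + 1))) :
    biWhitney C D S S' r s p q (TensorProduct.tensorTensorTensorComm k _ _ _ _ z) =
      TensorProduct.tensorTensorTensorComm k _ _ _ _
        (TensorProduct.map (normalWhitney C S r p) (normalWhitney D S' s q) z) := by
  simp only [biWhitney, LinearMap.comp_apply, LinearEquiv.coe_coe, LinearEquiv.symm_apply_apply]

theorem biWhitney_compatible (r s : ℕ) {p p' q q' : ℕ} (u : Fin (p + 1) →o Fin (p' + 1))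
    (v : Fin (q + 1) →o Fin (q' + 1))
    (f : (C.obj r ⊗[k] D.obj s) ⊗[k] (S.obj (r + 1) ⊗[k] S'.obj (s + 1))) :
    (TensorProduct.map (C.push u) (D.push v)).rTensor _ (biWhitney C D S S' r s p q f) =
      (TensorProduct.map (S.pull u) (S'.pull v)).lTensor _ (biWhitney C D S S' r s p' q' f) := by
  obtain ⟨z, rfl⟩ := (TensorProduct.tensorTensorTensorComm k _ _ _ _).surjective f
  rw [biWhitney_comm, biWhitney_comm, LinearMap.rTensor, LinearMap.lTensor, ← TensorProduct.map_id,
    ← TensorProduct.map_id, map_tensorTensorTensorComm, map_tensorTensorTensorComm]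
  congr 1
  rw [← LinearMap.comp_apply, ← LinearMap.comp_apply, ← TensorProduct.map_comp,
    ← TensorProduct.map_comp]
  exact congrArg₂ (fun f g => TensorProduct.map f g z) (normalWhitney_compatible C S r u)
    (normalWhitney_compatible D S' s v)

theorem biWhitney_of_lt {r s p q : ℕ} (h : p < r ∨ q < s) : biWhitney C D S S' r s p q = 0 := by
  unfold biWhitney
  rcases h with h | h
  · rw [normalWhitney_of_lt C S h, TensorProduct.map_zero_left, LinearMap.zero_comp,
      LinearMap.comp_zero]
  · rw [normalWhitney_of_lt D S' h, TensorProduct.map_zero_right, LinearMap.zero_comp,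
      LinearMap.comp_zero]

theorem biWhitney_eq_sum (r s p q : ℕ) : biWhitney C D S S' r s p q =
    ∑ u : Fin (r + 1) →o Fin (p + 1), ∑ v : Fin (s + 1) →o Fin (q + 1),
      TensorProduct.map (TensorProduct.map (C.push u ∘ₗ C.normal r) (D.push v ∘ₗ D.normal s))
        (TensorProduct.map (whitneyCoeff S u) (whitneyCoeff S' v)) := by
  refine LinearMap.ext fun f => ?_
  obtain ⟨z, rfl⟩ := (TensorProduct.tensorTensorTensorComm k _ _ _ _).surjective f
  simp only [biWhitney_comm, LinearMap.sum_apply, map_tensorTensorTensorComm, ← map_sum]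
  congr 1
  rw [normalWhitney_eq_sum, normalWhitney_eq_sum, ← TensorProduct.mapBilinear_apply]
  simp only [map_sum, LinearMap.sum_apply, TensorProduct.mapBilinear_apply]
  exact Finset.sum_comm

theorem biWhitney_self {r s : ℕ}
    (f : (C.obj r ⊗[k] D.obj s) ⊗[k] (S.obj (r + 1) ⊗[k] S'.obj (s + 1)))
    (hf : (TensorProduct.map (S.moore (r + 1)) (S'.moore (s + 1))).lTensor _ f = f) :
    biWhitney C D S S' r s r s f = (TensorProduct.map (C.normal r) (D.normal s)).rTensor _
      ((TensorProduct.map (S.pull (face 0)) (S'.pull (face 0))).lTensor _ f) := by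
  rw [← hf]
  obtain ⟨z, rfl⟩ := (TensorProduct.tensorTensorTensorComm k _ _ _ _).surjective f
  rw [rTensor_lTensor_apply, LinearMap.lTensor, ← TensorProduct.map_id,
    map_tensorTensorTensorComm, biWhitney_comm, map_tensorTensorTensorComm, ← LinearMap.comp_apply,
    ← LinearMap.comp_apply, ← TensorProduct.map_comp, ← TensorProduct.map_comp,
    ← LinearMap.lTensor, ← LinearMap.lTensor, LinearMap.map_comp_lTensor, LinearMap.map_comp_lTensor]
  congr 1
  exact congrArg₂ (fun f g => TensorProduct.map f g z) (normalWhitney_self C S r)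
    (normalWhitney_self D S' s)

end BiWhitney

/-! ### Leading components of compatible families. -/

section Leading

variable {k : Type u} [CommRing k] (C : CosMod.{u, v} k) (D : CosMod.{u, w} k)

/-- A compatible family of elements of the `(C_p ⊗ D_q) ⊗ (D*(Δ_p) ⊗ D*(Δ_q))`. -/
def IsCompatible (x : ∀ p q, (C.obj p ⊗[k] D.obj q) ⊗[k] BiForm k p q) : Prop :=
  ∀ ⦃p p' q q' : ℕ⦄ (u : Fin (p + 1) →o Fin (p' + 1)) (v : Fin (q + 1) →o Fin (q' + 1)),
    (TensorProduct.map (C.push u) (D.push v)).rTensor _ (x p q) =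
      (biPull k u v).lTensor _ (x p' q')

variable {C D} {x y : ∀ p q, (C.obj p ⊗[k] D.obj q) ⊗[k] BiForm k p q}

theorem IsCompatible.left (hx : IsCompatible C D x) {p p' : ℕ} (q : ℕ)
    (u : Fin (p + 1) →o Fin (p' + 1)) :
    ((C.push u).rTensor (D.obj q)).rTensor (BiForm k p q) (x p q) =
      ((formPull k u).rTensor (Form k q)).lTensor (C.obj p' ⊗[k] D.obj q) (x p' q) := by
  have := hx u (OrderHom.id : Fin (q + 1) →o Fin (q + 1))
  rwa [biPull, formPull_id, D.push_id] at this

theorem IsCompatible.right (hx : IsCompatible C D x) {q q' : ℕ} (p : ℕ)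
    (u : Fin (q + 1) →o Fin (q' + 1)) :
    ((D.push u).lTensor (C.obj p)).rTensor (BiForm k p q) (x p q) =
      ((formPull k u).lTensor (Form k p)).lTensor (C.obj p ⊗[k] D.obj q') (x p q') := by
  have := hx (OrderHom.id : Fin (p + 1) →o Fin (p + 1)) u
  rwa [biPull, formPull_id, C.push_id] at this

theorem IsCompatible.sub (hx : IsCompatible C D x) (hy : IsCompatible C D y) :
    IsCompatible C D fun p q => x p q - y p q := fun _ _ _ _ u v => by
  rw [map_sub, map_sub, hx u v, hy u v]

theorem IsCompatible.add (hx : IsCompatible C D x) (hy : IsCompatible C D y) :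
    IsCompatible C D fun p q => x p q + y p q := fun _ _ _ _ u v => by
  rw [map_add, map_add, hx u v, hy u v]

theorem IsCompatible.map (hx : IsCompatible C D x) (f : ∀ p q, BiForm k p q →ₗ[k] BiForm k p q)
    (hf : ∀ {p p' q q' : ℕ} (u : Fin (p + 1) →o Fin (p' + 1)) (v : Fin (q + 1) →o Fin (q' + 1)),
      f p q ∘ₗ biPull k u v = biPull k u v ∘ₗ f p' q') :
    IsCompatible C D fun p q => (f p q).lTensor _ (x p q) := fun p p' q q' u v => by
  rw [← LinearMap.comp_apply, ← LinearMap.comp_apply, ← LinearMap.lTensor_comp, ← hf,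
    LinearMap.rTensor_comp_lTensor, ← LinearMap.lTensor_comp_rTensor, LinearMap.lTensor_comp,
    LinearMap.comp_apply, LinearMap.comp_apply, hx u v]

theorem isCompatible_biWhitney {r s : ℕ} (f : (C.obj r ⊗[k] D.obj s) ⊗[k] BiForm k (r + 1) (s + 1)) :
    IsCompatible C D fun p q => biWhitney C D (formSimp k) (formSimp k) r s p q f :=
  fun _ _ _ _ u v => biWhitney_compatible C D (formSimp k) (formSimp k) r s u v f

/-- The components of `x` at the left and below `(r, s)` vanish. -/
def IsLeading (x : ∀ p q, (C.obj p ⊗[k] D.obj q) ⊗[k] BiForm k p q) (r s : ℕ) : Prop :=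
  (∀ p, p + 1 = r → x p s = 0) ∧ ∀ q, q + 1 = s → x r q = 0

/-- By compatibility, a codegeneracy applied to `x r s` is a simplicial pullback of the component to
its left, which is zero. -/
theorem IsLeading.normal_left (hx : IsCompatible C D x) {r s : ℕ} (h : IsLeading x r s) :
    ((C.normal r).rTensor (D.obj s)).rTensor (BiForm k r s) (x r s) = x r s := by
  rw [← CosMod.normal_rTensor, ← CosMod.normal_rTensor]
  refine CosMod.normal_eq (C := (C.rTensor (D.obj s)).rTensor (BiForm k r s)) ?_
  cases r with
  | zero => exact CosMod.isNormal_zero (C := (C.rTensor (D.obj s)).rTensor (BiForm k 0 s)) _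
  | succ r =>
    refine CosMod.isNormal_of_codegen
      (C := (C.rTensor (D.obj s)).rTensor (BiForm k (r + 1) s)) fun i => ?_
    refine (hx.left s (codegen i)).trans ?_
    rw [h.1 r rfl, map_zero]

theorem IsLeading.normal_right (hx : IsCompatible C D x) {r s : ℕ} (h : IsLeading x r s) :
    ((D.normal s).lTensor (C.obj r)).rTensor (BiForm k r s) (x r s) = x r s := by
  rw [← CosMod.normal_lTensor, ← CosMod.normal_rTensor]
  refine CosMod.normal_eq (C := (D.lTensor (C.obj r)).rTensor (BiForm k r s)) ?_
  cases s with
  | zero => exact CosMod.isNormal_zero (C := (D.lTensor (C.obj r)).rTensor (BiForm k r 0)) _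
  | succ s =>
    refine CosMod.isNormal_of_codegen
      (C := (D.lTensor (C.obj r)).rTensor (BiForm k r (s + 1))) fun i => ?_
    refine (hx.right r (codegen i)).trans ?_
    rw [h.2 s rfl, map_zero]

theorem IsLeading.normal (hx : IsCompatible C D x) {r s : ℕ} (h : IsLeading x r s) :
    (TensorProduct.map (C.normal r) (D.normal s)).rTensor (BiForm k r s) (x r s) = x r s := by
  rw [← LinearMap.rTensor_comp_lTensor, LinearMap.rTensor_comp, LinearMap.comp_apply,
    h.normal_right hx, h.normal_left hx]

/-- Dually, a face of `x r s` is the image under a coface of the vanishing component to its left. -/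
theorem IsLeading.cycle_left (hx : IsCompatible C D x) {r s : ℕ} (h : IsLeading x r s) :
    ((biFormSimp (C.obj r ⊗[k] D.obj s)).row s).IsCycle (x r s) := by
  cases r with
  | zero => exact SimpMod.isCycle_zero (S := (biFormSimp (C.obj 0 ⊗[k] D.obj s)).row s) _
  | succ r =>
    refine SimpMod.isCycle_of_face
      (S := (biFormSimp (C.obj (r + 1) ⊗[k] D.obj s)).row s) fun i => ?_
    refine (hx.left s (face i)).symm.trans ?_
    rw [h.1 r rfl, map_zero]

theorem IsLeading.cycle_right (hx : IsCompatible C D x) {r s : ℕ} (h : IsLeading x r s) :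
    ((biFormSimp (C.obj r ⊗[k] D.obj s)).col r).IsCycle (x r s) := by
  cases s with
  | zero => exact SimpMod.isCycle_zero (S := (biFormSimp (C.obj r ⊗[k] D.obj 0)).col r) _
  | succ s =>
    refine SimpMod.isCycle_of_face
      (S := (biFormSimp (C.obj r ⊗[k] D.obj (s + 1))).col r) fun i => ?_
    refine (hx.right r (face i)).symm.trans ?_
    rw [h.2 s rfl, map_zero]

/-- The normalized complex of `C` vanishes in degrees greater than `m`. -/
def CosMod.IsTruncated (C : CosMod.{u, v} k) (m : ℕ) : Prop := ∀ p, m < p → C.normal p = 0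

/-- Once the previous component vanishes, the next one is fixed by the normal projector, and that
projector is zero beyond the truncation. The argument runs in the first direction, then in the
second. -/
theorem IsCompatible.eq_zero (hx : IsCompatible C D x) {m n : ℕ} (hC : C.IsTruncated m)
    (hD : D.IsTruncated n) (h : ∀ p q, p ≤ m → q ≤ n → x p q = 0) (p q : ℕ) : x p q = 0 := by
  have h1 : ∀ p q, q ≤ n → x p q = 0 := by
    intro p q hq
    induction p with
    | zero => exact h 0 q (Nat.zero_le _) hq
    | succ p ih =>
      by_cases hp : p + 1 ≤ m
      · exact h _ q hp hq
      · have e : ((C.normal (p + 1)).rTensor (D.obj q)).rTensor (BiForm k (p + 1) q)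
            (x (p + 1) q) = x (p + 1) q := by
          rw [← CosMod.normal_rTensor, ← CosMod.normal_rTensor]
          refine CosMod.normal_eq (C := (C.rTensor (D.obj q)).rTensor (BiForm k (p + 1) q))
            (CosMod.isNormal_of_codegen
              (C := (C.rTensor (D.obj q)).rTensor (BiForm k (p + 1) q)) fun i => ?_)
          refine (hx.left q (codegen i)).trans ?_
          rw [ih, map_zero]
        rw [← e, hC _ (by omega), LinearMap.rTensor_zero, LinearMap.rTensor_zero,
          LinearMap.zero_apply]
  induction q with
  | zero => exact h1 p 0 (Nat.zero_le _)
  | succ q ih =>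
    by_cases hq : q + 1 ≤ n
    · exact h1 p _ hq
    · have e : ((D.normal (q + 1)).lTensor (C.obj p)).rTensor (BiForm k p (q + 1))
          (x p (q + 1)) = x p (q + 1) := by
        rw [← CosMod.normal_lTensor, ← CosMod.normal_rTensor]
        refine CosMod.normal_eq (C := (D.lTensor (C.obj p)).rTensor (BiForm k p (q + 1)))
          (CosMod.isNormal_of_codegen
            (C := (D.lTensor (C.obj p)).rTensor (BiForm k p (q + 1))) fun i => ?_)
        refine (hx.right p (codegen i)).trans ?_
        rw [ih, map_zero]
      rw [← e, hD _ (by omega), LinearMap.lTensor_zero, LinearMap.rTensor_zero,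
        LinearMap.zero_apply]

theorem isLocal_whitneyCoeff {r p : ℕ} (u : Fin (r + 1) →o Fin (p + 1)) :
    IsLocal (whitneyCoeff (formSimp k) u) := fun w => by
  simp only [whitneyCoeff, LinearMap.sum_apply, LinearMap.smul_apply]
  exact Submodule.sum_mem _ fun t _ => Submodule.smul_mem _ _ (isLocal_formPull _ w)

/-- The formula uses only simplicial pullbacks on the side of the forms, and these do not enlarge
supports. -/
theorem biWhitney_mem_coeffs {R : Set ℤ → Set ℤ → Prop} (hR : IsHereditary R) {r s : ℕ}
    {f : (C.obj r ⊗[k] D.obj s) ⊗[k] BiForm k (r + 1) (s + 1)}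
    (hf : f ∈ coeffs _ (spanRel k R (r + 1) (s + 1))) (p q : ℕ) :
    biWhitney C D (formSimp k) (formSimp k) r s p q f ∈ coeffs _ (spanRel k R p q) := by
  have key : ∀ (g : C.obj r ⊗[k] D.obj s →ₗ[k] C.obj p ⊗[k] D.obj q) (a : Form k (r + 1) →ₗ[k] Form k p)
      (b : Form k (s + 1) →ₗ[k] Form k q), IsLocal a → IsLocal b →
      TensorProduct.map g (TensorProduct.map a b) f ∈
        coeffs (C.obj p ⊗[k] D.obj q) (spanRel k R p q) := fun g a b ha hb =>
    coeffs_le_comap_map g (spanRel_le_comap_map hR ha hb) hf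
  rw [biWhitney_eq_sum]
  simp only [LinearMap.sum_apply]
  refine Submodule.sum_mem _ fun u _ => Submodule.sum_mem _ fun v _ => ?_
  exact key _ _ _ (isLocal_whitneyCoeff u) (isLocal_whitneyCoeff v)

theorem moore_lTensor_eq {S S' : SimpMod.{u, u} k} {A : Type w} [AddCommGroup A] [Module k A]
    {p q : ℕ} {f : A ⊗[k] (S.obj p ⊗[k] S'.obj q)}
    (h₁ : ((S.rTensor (S'.obj q)).lTensor A).IsMoore f)
    (h₂ : ((S'.lTensor (S.obj p)).lTensor A).IsMoore f) :
    (TensorProduct.map (S.moore p) (S'.moore q)).lTensor A f = f := by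
  have e1 := SimpMod.moore_eq h₁
  have e2 := SimpMod.moore_eq h₂
  rw [SimpMod.moore_lTensor, SimpMod.moore_rTensor] at e1
  rw [SimpMod.moore_lTensor, SimpMod.moore_lTensor] at e2
  rw [← LinearMap.rTensor_comp_lTensor, LinearMap.lTensor_comp, LinearMap.comp_apply, e2, e1]

theorem biWhitney_form_self {r s : ℕ} {f : (C.obj r ⊗[k] D.obj s) ⊗[k] BiForm k (r + 1) (s + 1)}
    (h₁ : ((biFormSimp (C.obj r ⊗[k] D.obj s)).row (s + 1)).IsMoore f)
    (h₂ : ((biFormSimp (C.obj r ⊗[k] D.obj s)).col (r + 1)).IsMoore f) :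
    biWhitney C D (formSimp k) (formSimp k) r s r s f =
      (TensorProduct.map (C.normal r) (D.normal s)).rTensor _
        ((biPull k (face 0) (face 0)).lTensor _ f) :=
  biWhitney_self C D (formSimp k) (formSimp k) f (moore_lTensor_eq h₁ h₂)

end Leading
end QuasiComm
end

noncomputable section

namespace QuasiComm

/-! ### Correction of a family, one bidegree at a time. -/

section Core

variable {k : Type u} [CommRing k] {C : CosMod.{u, v} k} {D : CosMod.{u, w} k}
  {T : Finset ℤ} {R R' : Set ℤ → Set ℤ → Prop} {m n : ℕ}

theorem IsCompatible.biD {x : ∀ p q, (C.obj p ⊗[k] D.obj q) ⊗[k] BiForm k p q}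
    (hx : IsCompatible C D x) : IsCompatible C D fun p q => (biD k p q).lTensor _ (x p q) :=
  hx.map (fun p q => QuasiComm.biD k p q) fun u v => biD_comp_biPull k u v

theorem lTensor_biD_mem_coeffs (hR : IsHereditary R) {A : Type v} [AddCommGroup A] [Module k A]
    {p q : ℕ} {x : A ⊗[k] BiForm k p q} (hx : x ∈ coeffs A (spanRel k R p q)) :
    (biD k p q).lTensor A x ∈ coeffs A (spanRel k R p q) :=
  coeffs_le_comap_lTensor (spanRel_le_comap_biD hR p q) hx

theorem normal_mem_coeffs {r s : ℕ} {x : (C.obj r ⊗[k] D.obj s) ⊗[k] BiForm k r s}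
    (hx : x ∈ coeffs (C.obj r ⊗[k] D.obj s) (spanRel k R r s)) :
    (TensorProduct.map (C.normal r) (D.normal s)).rTensor _ x ∈
      coeffs (C.obj r ⊗[k] D.obj s) (spanRel k R r s) :=
  coeffs_le_comap_rTensor _ hx

/-- A leading component that is closed modulo `R` can be removed by a coboundary, up to `R`. -/
theorem exists_leading_sub_d_mem (hR : IsExtendable T R) (hR' : IsExtendable T R') (h0 : R ∅ ∅)
    {x : ∀ p q, (C.obj p ⊗[k] D.obj q) ⊗[k] BiForm k p q} (hx : IsCompatible C D x) {r s : ℕ}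
    (hrs : r + s + 1 < T.card) (hl : IsLeading x r s)
    (hxR : x r s ∈ coeffs (C.obj r ⊗[k] D.obj s) (spanRel k R' r s))
    (hdx : (biD k r s).lTensor _ (x r s) ∈ coeffs (C.obj r ⊗[k] D.obj s) (spanRel k R r s)) :
    ∃ y : ∀ p q, (C.obj p ⊗[k] D.obj q) ⊗[k] BiForm k p q, IsCompatible C D y ∧
      (∀ p q, y p q ∈ coeffs (C.obj p ⊗[k] D.obj q) (spanRel k R' p q)) ∧
      (∀ p q, p < r ∨ q < s → y p q = 0) ∧
      x r s - (biD k r s).lTensor _ (y r s) ∈ coeffs (C.obj r ⊗[k] D.obj s) (spanRel k R r s) := by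
  obtain ⟨f, hf, hf₁, hf₂, h⟩ := exists_sub_d_mem hR hR' h0 hrs hxR (hl.cycle_left hx)
    (hl.cycle_right hx) hdx
  refine ⟨fun p q => biWhitney C D (formSimp k) (formSimp k) r s p q f, isCompatible_biWhitney f,
    biWhitney_mem_coeffs hR'.hereditary hf, fun p q hpq => ?_, ?_⟩
  · exact LinearMap.congr_fun (biWhitney_of_lt C D (formSimp k) (formSimp k) hpq) f
  -- The component of the Whitney family is the normal projection of the double face, whereas `h`
  -- concerns the double face itself. Projecting `h` is harmless, because the projector acts on
  -- coefficients only and fixes `x r s`.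
  · have h' := normal_mem_coeffs h
    rw [map_sub, hl.normal hx] at h'
    have e := biWhitney_form_self hf₁ hf₂
    have e' : (biD k r s).lTensor _ (biWhitney C D (formSimp k) (formSimp k) r s r s f) =
        (TensorProduct.map (C.normal r) (D.normal s)).rTensor (BiForm k r s)
          ((biD k r s).lTensor _ ((biPull k (face 0) (face 0)).lTensor _ f)) := by
      rw [e, lTensor_rTensor_comm]
    exact (congrArg (fun z => x r s - z ∈ coeffs (C.obj r ⊗[k] D.obj s) (spanRel k R r s)) e').mpr h'

/-- A leading component that already satisfies `R` is the double face of an element satisfying `R`;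
the Whitney family of that element has the same component there. -/
theorem exists_leading_sub_eq_zero (hR : IsExtendable T R)
    {x : ∀ p q, (C.obj p ⊗[k] D.obj q) ⊗[k] BiForm k p q} (hx : IsCompatible C D x) {r s : ℕ}
    (hrs : r + s + 1 < T.card) (hl : IsLeading x r s)
    (hxR : x r s ∈ coeffs (C.obj r ⊗[k] D.obj s) (spanRel k R r s)) :
    ∃ y : ∀ p q, (C.obj p ⊗[k] D.obj q) ⊗[k] BiForm k p q, IsCompatible C D y ∧
      (∀ p q, y p q ∈ coeffs (C.obj p ⊗[k] D.obj q) (spanRel k R p q)) ∧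
      (∀ p q, p < r ∨ q < s → y p q = 0) ∧ x r s = y r s := by
  obtain ⟨f, hf, hf₁, hf₂, h⟩ := exists_face_face_eq hR hrs hxR (hl.cycle_left hx)
    (hl.cycle_right hx)
  refine ⟨fun p q => biWhitney C D (formSimp k) (formSimp k) r s p q f, isCompatible_biWhitney f,
    biWhitney_mem_coeffs hR.hereditary hf, fun p q hpq => ?_, ?_⟩
  · exact LinearMap.congr_fun (biWhitney_of_lt C D (formSimp k) (formSimp k) hpq) f
  · have e := biWhitney_form_self hf₁ hf₂
    rw [h, hl.normal hx] at e
    exact e.symm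

/-- A family of `R'` whose differential is in `R` is cohomologous to a family of `R`. -/
theorem exists_family_sub_d_mem (hC : C.IsTruncated m) (hD : D.IsTruncated n)
    (hT : m + n + 1 < T.card) (hR : IsExtendable T R) (hR' : IsExtendable T R')
    (hRR' : ∀ F F', R F F' → R' F F') (h0 : R ∅ ∅)
    {x : ∀ p q, (C.obj p ⊗[k] D.obj q) ⊗[k] BiForm k p q} (hx : IsCompatible C D x)
    (hxR : ∀ p q, x p q ∈ coeffs (C.obj p ⊗[k] D.obj q) (spanRel k R' p q))
    (hdx : ∀ p q, (biD k p q).lTensor _ (x p q) ∈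
      coeffs (C.obj p ⊗[k] D.obj q) (spanRel k R p q)) :
    ∃ y : ∀ p q, (C.obj p ⊗[k] D.obj q) ⊗[k] BiForm k p q, IsCompatible C D y ∧
      (∀ p q, y p q ∈ coeffs (C.obj p ⊗[k] D.obj q) (spanRel k R' p q)) ∧
      ∀ p q, x p q - (biD k p q).lTensor _ (y p q) ∈
        coeffs (C.obj p ⊗[k] D.obj q) (spanRel k R p q) := by
  -- Bidegrees of the rectangle are numbered lexicographically by `p * (n + 1) + q`. The number `j`
  -- counts those already cleared, and the induction is on the number `i` of those that remain.
  suffices H : ∀ i j : ℕ, i + j = (m + 1) * (n + 1) →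
      ∀ x : ∀ p q, (C.obj p ⊗[k] D.obj q) ⊗[k] BiForm k p q, IsCompatible C D x →
      (∀ p q, x p q ∈ coeffs (C.obj p ⊗[k] D.obj q) (spanRel k R' p q)) →
      (∀ p q, (biD k p q).lTensor _ (x p q) ∈
        coeffs (C.obj p ⊗[k] D.obj q) (spanRel k R p q)) →
      (∀ p q, p ≤ m → q ≤ n → p * (n + 1) + q < j → x p q = 0) →
      ∃ y : ∀ p q, (C.obj p ⊗[k] D.obj q) ⊗[k] BiForm k p q, IsCompatible C D y ∧
        (∀ p q, y p q ∈ coeffs (C.obj p ⊗[k] D.obj q) (spanRel k R' p q)) ∧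
        ∀ p q, x p q - (biD k p q).lTensor _ (y p q) ∈
          coeffs (C.obj p ⊗[k] D.obj q) (spanRel k R p q) from
    H _ 0 (add_zero _) x hx hxR hdx fun p q _ _ h => absurd h (Nat.not_lt_zero _)
  intro i
  induction i with
  | zero =>
    intro j hj x hx hxR hdx hz
    refine ⟨fun p q => 0, fun _ _ _ _ u v => by rw [map_zero, map_zero], fun p q => zero_mem _,
      fun p q => ?_⟩
    rw [map_zero, sub_zero, hx.eq_zero hC hD fun p q hp hq => hz p q hp hq ?_]
    · exact zero_mem _
    · have : p * (n + 1) ≤ m * (n + 1) := Nat.mul_le_mul_right _ hp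
      have e : (m + 1) * (n + 1) = m * (n + 1) + (n + 1) := by ring
      omega
  | succ i ih =>
    intro j hj x hx hxR hdx hz
    obtain ⟨r, s, hr, hs, rfl⟩ : ∃ r s, r ≤ m ∧ s ≤ n ∧ r * (n + 1) + s = j := by
      refine ⟨j / (n + 1), j % (n + 1), ?_, ?_, ?_⟩
      · refine Nat.le_of_lt_succ ((Nat.div_lt_iff_lt_mul (Nat.succ_pos n)).2 ?_)
        change j < (m + 1) * (n + 1)
        omega
      · exact Nat.le_of_lt_succ (Nat.mod_lt _ (Nat.succ_pos n))
      · rw [mul_comm]; exact Nat.div_add_mod j (n + 1)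
    have hrank : ∀ p q, q ≤ n → p * (n + 1) + q < r * (n + 1) + s → p < r ∨ q < s := by
      intro p q hq hlt
      by_contra hcon
      push Not at hcon
      have : r * (n + 1) ≤ p * (n + 1) := Nat.mul_le_mul_right _ hcon.1
      omega
    have heq : ∀ p q, q ≤ n → p * (n + 1) + q = r * (n + 1) + s → (p = r ∧ q = s) := by
      intro p q hq he
      have : p = r := by
        rcases lt_trichotomy p r with h | h | h
        · have : (p + 1) * (n + 1) ≤ r * (n + 1) := Nat.mul_le_mul_right _ h
          have e : (p + 1) * (n + 1) = p * (n + 1) + (n + 1) := by ring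
          omega
        · exact h
        · have : (r + 1) * (n + 1) ≤ p * (n + 1) := Nat.mul_le_mul_right _ h
          have e : (r + 1) * (n + 1) = r * (n + 1) + (n + 1) := by ring
          omega
      subst this
      omega
    have hlead : ∀ z : ∀ p q, (C.obj p ⊗[k] D.obj q) ⊗[k] BiForm k p q,
        (∀ p q, p ≤ m → q ≤ n → p * (n + 1) + q < r * (n + 1) + s → z p q = 0) →
        IsLeading z r s := by
      intro z hz
      refine ⟨?_, ?_⟩
      · rintro p rfl
        refine hz p s (by omega) hs ?_
        have e : (p + 1) * (n + 1) = p * (n + 1) + (n + 1) := by ring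
        omega
      · rintro q rfl
        exact hz r q hr (by omega) (by omega)
    obtain ⟨y, hy, hyR, hy0, hxy⟩ := exists_leading_sub_d_mem hR hR' h0 hx (by omega)
      (hlead x hz) (hxR r s) (hdx r s)
    have hx' := hx.sub hy.biD
    have hz' : ∀ p q, p ≤ m → q ≤ n → p * (n + 1) + q < r * (n + 1) + s →
        x p q - (biD k p q).lTensor _ (y p q) = 0 := fun p q hp hq hlt => by
      rw [hz p q hp hq hlt, hy0 p q (hrank p q hq hlt), map_zero, sub_zero]
    -- Each bidegree takes two corrections: a coboundary brings the component into `R`, then a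
    -- family of type `R` makes it vanish. The latter need not be a coboundary, as the conclusion is
    -- only modulo `R`.
    obtain ⟨g, hg, hgR, hg0, hxg⟩ := exists_leading_sub_eq_zero hR hx' (by omega)
      (hlead _ hz') hxy
    obtain ⟨y', hy', hyR', hxy'⟩ := ih (r * (n + 1) + s + 1) (by omega) _ (hx'.sub hg)
      (fun p q => sub_mem (sub_mem (hxR p q) (lTensor_biD_mem_coeffs hR'.hereditary (hyR p q)))
        (coeffs_mono (spanRel_mono hRR' p q) (hgR p q)))
      (fun p q => by
        rw [map_sub, map_sub, lTensor_biD_biD, sub_zero]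
        exact sub_mem (hdx p q) (lTensor_biD_mem_coeffs hR.hereditary (hgR p q)))
      (fun p q hp hq hlt => by
        rcases Nat.lt_succ_iff_lt_or_eq.1 hlt with h | h
        · rw [hz' p q hp hq h, hg0 p q (hrank p q hq h), sub_zero]
        · obtain ⟨rfl, rfl⟩ := heq p q hq h
          rw [hxg, sub_self])
    refine ⟨_, hy.add hy', fun p q => add_mem (hyR p q) (hyR' p q), fun p q => ?_⟩
    have := add_mem (hxy' p q) (hgR p q)
    rw [map_add]
    convert this using 1
    abel

end Core

/-! ### Homogeneous parts, and the two support conditions. -/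

section Degrees

variable {k : Type u} [CommRing k]

variable (k) in
/-- The projection on the part of total degree `n`. -/
def biDeg (n p q : ℕ) : BiForm k p q →ₗ[k] BiForm k p q :=
  ∑ ab ∈ Finset.HasAntidiagonal.antidiagonal n, TensorProduct.map (wordProj k p fun w => w.degree = ab.1)
    (wordProj k q fun w => w.degree = ab.2)

theorem biDeg_tmul (n : ℕ) {p q : ℕ} (w : Word p) (w' : Word q) :
    biDeg k n p q (formOf k w ⊗ₜ[k] formOf k w') =
      if w.degree + w'.degree = n then formOf k w ⊗ₜ[k] formOf k w' else 0 := by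
  classical
  simp only [biDeg, LinearMap.sum_apply, TensorProduct.map_tmul, wordProj_formOf]
  split_ifs with h
  · rw [Finset.sum_eq_single (w.degree, w'.degree)]
    · rw [if_pos rfl, if_pos rfl]
    · rintro ⟨a, b⟩ - hne
      by_cases ha : w.degree = a
      · by_cases hb : w'.degree = b
        · exact absurd (by rw [ha, hb]) hne
        · rw [if_neg hb, TensorProduct.tmul_zero]
      · rw [if_neg ha, TensorProduct.zero_tmul]
    · exact fun hn => absurd (Finset.HasAntidiagonal.mem_antidiagonal.2 h) hn
  · refine Finset.sum_eq_zero ?_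
    rintro ⟨a, b⟩ hab
    rw [Finset.HasAntidiagonal.mem_antidiagonal] at hab
    by_cases ha : w.degree = a
    · rw [if_neg (fun hb : w'.degree = b => h (by rw [ha, hb]; exact hab)), TensorProduct.tmul_zero]
    · rw [if_neg ha, TensorProduct.zero_tmul]

theorem biDeg_comp_biPull (n : ℕ) {p q p' q' : ℕ} (u : Fin (p + 1) →o Fin (p' + 1))
    (v : Fin (q + 1) →o Fin (q' + 1)) :
    biDeg k n p q ∘ₗ biPull k u v = biPull k u v ∘ₗ biDeg k n p' q' := by
  refine biForm_hom_ext fun w w' => ?_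
  have e : biDeg k n p q (biPull k u v (formOf k w ⊗ₜ[k] formOf k w')) =
      if w.degree + w'.degree = n then biPull k u v (formOf k w ⊗ₜ[k] formOf k w') else 0 := by
    simp only [biPull, TensorProduct.map_tmul, formPull_formOf, TensorProduct.sum_tmul,
      TensorProduct.tmul_sum, map_sum, biDeg_tmul]
    split_ifs with h
    · refine Finset.sum_congr rfl fun A hA => Finset.sum_congr rfl fun B hB => ?_
      rw [if_pos (by rwa [degree_spread hA, degree_spread hB])]
    · refine Finset.sum_eq_zero fun A hA => Finset.sum_eq_zero fun B hB => ?_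
      rw [if_neg (by rwa [degree_spread hA, degree_spread hB])]
  rw [LinearMap.comp_apply, LinearMap.comp_apply, e, biDeg_tmul]
  split_ifs
  · rfl
  · rw [map_zero]

theorem biD_tmul {p q : ℕ} (w : Word p) (w' : Word q) :
    biD k p q (formOf k w ⊗ₜ[k] formOf k w') =
      (∑ i ∈ w.heavisides, (-(-1 : k) ^ w.diracBefore i) • (formOf k (w.diff i) ⊗ₜ[k] formOf k w')) +
      ∑ i ∈ w'.heavisides, ((-1 : k) ^ w.degree * -(-1 : k) ^ w'.diracBefore i) •
        (formOf k w ⊗ₜ[k] formOf k (w'.diff i)) := by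
  simp only [biD, LinearMap.add_apply, TensorProduct.map_tmul, LinearMap.id_apply, formD_formOf,
    formSign_formOf, TensorProduct.sum_tmul, TensorProduct.tmul_sum, ← TensorProduct.smul_tmul',
    TensorProduct.tmul_smul, smul_smul]
  congr 1
  refine Finset.sum_congr rfl fun i _ => ?_
  rw [mul_comm]

theorem biDeg_biD (n : ℕ) {p q : ℕ} (w : Word p) (w' : Word q) :
    biDeg k n p q (biD k p q (formOf k w ⊗ₜ[k] formOf k w')) =
      if w.degree + w'.degree + 1 = n then biD k p q (formOf k w ⊗ₜ[k] formOf k w') else 0 := by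
  rw [biD_tmul]
  simp only [map_add, map_sum, map_smul, biDeg_tmul]
  split_ifs with h
  · congr 1
    · refine Finset.sum_congr rfl fun i hi => ?_
      rw [if_pos (by rw [degree_diff hi]; omega)]
    · refine Finset.sum_congr rfl fun i hi => ?_
      rw [if_pos (by rw [degree_diff hi]; omega)]
  · rw [Finset.sum_eq_zero, Finset.sum_eq_zero, add_zero]
    · intro i hi
      rw [if_neg (by rw [degree_diff hi]; omega), smul_zero]
    · intro i hi
      rw [if_neg (by rw [degree_diff hi]; omega), smul_zero]

theorem biDeg_zero_comp_biD (p q : ℕ) : biDeg k 0 p q ∘ₗ biD k p q = 0 :=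
  biForm_hom_ext fun w w' => by
    rw [LinearMap.comp_apply, biDeg_biD, if_neg (by omega), LinearMap.zero_apply]

/-- The correction of a family ignores degrees. This identity allows a correcting family to be
replaced by its part of the degree wanted. -/
theorem biDeg_succ_comp_biD (n p q : ℕ) :
    biDeg k (n + 1) p q ∘ₗ biD k p q = biD k p q ∘ₗ biDeg k n p q :=
  biForm_hom_ext fun w w' => by
    rw [LinearMap.comp_apply, LinearMap.comp_apply, biDeg_biD, biDeg_tmul]
    by_cases h : w.degree + w'.degree = n
    · rw [if_pos h, if_pos (by omega)]
    · rw [if_neg h, if_neg (by omega), map_zero]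

/-- The supports are in `T`. -/
def FullRel (T : Set ℤ) (F F' : Set ℤ) : Prop := F ⊆ T ∧ F' ⊆ T

/-- The supports are disjoint and in `T`. -/
def ReducedRel (T : Set ℤ) (F F' : Set ℤ) : Prop := F ⊆ T ∧ F' ⊆ T ∧ Disjoint F F'

theorem isExtendable_fullRel {T : Finset ℤ} {T' : Set ℤ} (h : (T : Set ℤ) ⊆ T') :
    IsExtendable T (FullRel T') where
  hereditary := fun _ _ _ _ h1 h2 h3 => ⟨h1.trans h3.1, h2.trans h3.2⟩
  left := fun _ _ _ hs _ h1 => ⟨Set.insert_subset (h hs) h1.1, h1.2⟩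
  right := fun _ _ _ hs _ h1 => ⟨h1.1, Set.insert_subset (h hs) h1.2⟩

/-- A point added to one support is taken outside the other, so disjointness persists. Keeping `T`
apart from `T'` lets the extra degeneracies use points of the smaller set while the forms live on
the larger one. -/
theorem isExtendable_reducedRel {T : Finset ℤ} {T' : Set ℤ} (h : (T : Set ℤ) ⊆ T') :
    IsExtendable T (ReducedRel T') where
  hereditary := fun _ _ _ _ h1 h2 h3 => ⟨h1.trans h3.1, h2.trans h3.2.1, h3.2.2.mono h1 h2⟩
  left := fun _ _ _ hs hn h1 => ⟨Set.insert_subset (h hs) h1.1, h1.2.1,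
    Set.disjoint_insert_left.2 ⟨hn, h1.2.2⟩⟩
  right := fun _ _ _ hs hn h1 => ⟨h1.1, Set.insert_subset (h hs) h1.2.1,
    Set.disjoint_insert_right.2 ⟨hn, h1.2.2⟩⟩

theorem spanRel_le_comap_biDeg {R : Set ℤ → Set ℤ → Prop} {n p q : ℕ}
    {B : Submodule k (BiForm k p q)} (h : ∀ (w : Word p) (w' : Word q), R w.support w'.support →
      w.degree + w'.degree = n → formOf k w ⊗ₜ[k] formOf k w' ∈ B) :
    spanRel k R p q ≤ B.comap (biDeg k n p q) := by
  refine Submodule.span_le.2 ?_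
  rintro _ ⟨w, w', hR, rfl⟩
  rw [SetLike.mem_coe, Submodule.mem_comap, biDeg_tmul]
  split_ifs with hn
  · exact h w w' hR hn
  · exact zero_mem _

theorem fullRel_le_comap_biDeg (T : Set ℤ) (n p q : ℕ) :
    spanRel k (FullRel T) p q ≤ (biFormsIn k T n p q).comap (biDeg k n p q) :=
  spanRel_le_comap_biDeg fun w w' h hn =>
    Submodule.subset_span ⟨w, w', h.1, h.2, hn, rfl⟩

theorem reducedRel_le_comap_biDeg (T : Set ℤ) (n p q : ℕ) :
    spanRel k (ReducedRel T) p q ≤ (reducedBiFormsIn k T n p q).comap (biDeg k n p q) :=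
  spanRel_le_comap_biDeg fun w w' h hn =>
    Submodule.subset_span ⟨w, w', h.1, h.2.1, h.2.2, hn, rfl⟩

theorem biFormsIn_le_spanRel (T : Set ℤ) (n p q : ℕ) :
    biFormsIn k T n p q ≤ spanRel k (FullRel T) p q :=
  Submodule.span_mono fun _ ⟨w, w', h, h', _, e⟩ => ⟨w, w', ⟨h, h'⟩, e⟩

theorem reducedBiFormsIn_le_spanRel (T : Set ℤ) (n p q : ℕ) :
    reducedBiFormsIn k T n p q ≤ spanRel k (ReducedRel T) p q :=
  Submodule.span_mono fun _ ⟨w, w', h, h', hd, _, e⟩ => ⟨w, w', ⟨h, h', hd⟩, e⟩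

theorem biFormsIn_le_eqLocus (T : Set ℤ) (n p q : ℕ) :
    biFormsIn k T n p q ≤ LinearMap.eqLocus (biDeg k n p q) LinearMap.id := by
  refine Submodule.span_le.2 ?_
  rintro _ ⟨w, w', _, _, h, rfl⟩
  rw [SetLike.mem_coe, LinearMap.mem_eqLocus, biDeg_tmul, if_pos h, LinearMap.id_apply]

end Degrees
end QuasiComm
end

noncomputable section

namespace QuasiComm

/-! ### An elementwise criterion for quasi-isomorphisms. -/

section QuasiIsos

open CategoryTheory

variable {k : Type u} [CommRing k]

/-- A linear map lifts through another one after a surjective base change if its values do. -/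
theorem exists_lift_up_to_refinements {A B V : ModuleCat.{w} k} (f : A ⟶ V) (g : B ⟶ V)
    (h : ∀ a, ∃ b, g.hom b = f.hom a) :
    ∃ (A' : ModuleCat.{w} k) (π : A' ⟶ A) (_ : Epi π) (x : A' ⟶ B), π ≫ f = x ≫ g := by
  let E : Submodule k (A × B) :=
    LinearMap.eqLocus (f.hom ∘ₗ LinearMap.fst k A B) (g.hom ∘ₗ LinearMap.snd k A B)
  refine ⟨ModuleCat.of k E, ModuleCat.ofHom (LinearMap.fst k A B ∘ₗ E.subtype), ?_,
    ModuleCat.ofHom (LinearMap.snd k A B ∘ₗ E.subtype), ?_⟩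
  · rw [ModuleCat.epi_iff_surjective]
    intro a
    obtain ⟨b, hb⟩ := h a
    exact ⟨⟨(a, b), hb.symm⟩, rfl⟩
  · exact ModuleCat.hom_ext (LinearMap.ext fun x => x.2)

/-- Injectivity and surjectivity on homology are tested up to refinements. Pointwise liftability
suffices for that, with a fibre product as the refinement. -/
theorem quasiIso_of_elements {K L : CochainComplex (ModuleCat.{w} k) ℕ} (φ : K ⟶ L)
    (hmono : ∀ (i j l : ℕ), (ComplexShape.up ℕ).prev j = i → (ComplexShape.up ℕ).next j = l →
      ∀ (x : K.X j) (y : L.X i), (K.d j l).hom x = 0 → (φ.f j).hom x = (L.d i j).hom y →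
        ∃ z : K.X i, (K.d i j).hom z = x)
    (hepi : ∀ (i j l : ℕ), (ComplexShape.up ℕ).prev j = i → (ComplexShape.up ℕ).next j = l →
      ∀ (y : L.X j), (L.d j l).hom y = 0 →
        ∃ (x : K.X j) (z : L.X i), (K.d j l).hom x = 0 ∧
          (φ.f j).hom x + (L.d i j).hom z = y) : QuasiIso φ := by
  rw [quasiIso_iff]
  intro j
  rw [quasiIsoAt_iff_isIso_homologyMap]
  have h1 : Mono (HomologicalComplex.homologyMap φ j) := by
    rw [HomologicalComplex.mono_homologyMap_iff_up_to_refinements φ _ j _ rfl rfl]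
    intro A x hx y hxy
    refine exists_lift_up_to_refinements x (K.d _ j) fun a => ?_
    refine hmono _ j _ rfl rfl (x.hom a) (y.hom a) ?_ ?_
    · exact LinearMap.congr_fun (congrArg ModuleCat.Hom.hom hx) a
    · exact LinearMap.congr_fun (congrArg ModuleCat.Hom.hom hxy) a
  have h2 : Epi (HomologicalComplex.homologyMap φ j) := by
    rw [HomologicalComplex.epi_homologyMap_iff_up_to_refinements φ _ j _ rfl rfl]
    intro A y hy
    let Z := LinearMap.ker (K.d j ((ComplexShape.up ℕ).next j)).hom
    let P := L.X ((ComplexShape.up ℕ).prev j)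
    obtain ⟨A', π, hπ, x, hx⟩ := exists_lift_up_to_refinements
      (B := ModuleCat.of k (Z × P)) y
      (ModuleCat.ofHom (((φ.f j).hom ∘ₗ Z.subtype).coprod (L.d _ j).hom)) fun a => by
        obtain ⟨x, z, hx, hxz⟩ := hepi _ j _ rfl rfl (y.hom a)
          (LinearMap.congr_fun (congrArg ModuleCat.Hom.hom hy) a)
        refine ⟨(⟨x, hx⟩, z), ?_⟩
        rw [← hxz]
        rfl
    refine ⟨A', π, hπ, x ≫ ModuleCat.ofHom (Z.subtype ∘ₗ LinearMap.fst k Z P), ?_,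
      x ≫ ModuleCat.ofHom (LinearMap.snd k Z P), ?_⟩
    · exact ModuleCat.hom_ext (LinearMap.ext fun a => (x.hom a).1.2)
    · rw [hx]
      rfl
  exact isIso_of_mono_of_epi _

theorem subcomplex_d {V : Type w} [AddCommGroup V] [Module k V] (d : V →ₗ[k] V)
    (hd : ∀ x, d (d x) = 0) (W : ℕ → Submodule k V) (hW : ∀ n, W n ≤ (W (n + 1)).comap d) (n : ℕ)
    (x : W n) : ((subcomplex d hd W hW).d n (n + 1)).hom x = (⟨d x.1, hW n x.2⟩ : W (n + 1)) := by
  have e : (subcomplex d hd W hW).d n (n + 1) = ModuleCat.ofHom (d.restrict (hW n)) :=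
    CochainComplex.of_d (fun n => ModuleCat.of k (W n))
      (fun n => ModuleCat.ofHom (d.restrict (hW n))) n
  rw [e]
  rfl

/-- The inclusion of a subcomplex is a quasi-isomorphism if each cochain whose differential is in the
subcomplex is in the subcomplex up to a coboundary. -/
theorem quasiIso_subcomplexInclusion {V : Type w} [AddCommGroup V] [Module k V] (d : V →ₗ[k] V)
    (hd : ∀ x, d (d x) = 0) (W W' : ℕ → Submodule k V) (hW : ∀ n, W n ≤ (W (n + 1)).comap d)
    (hW' : ∀ n, W' n ≤ (W' (n + 1)).comap d) (h : ∀ n, W n ≤ W' n)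
    (h0 : ∀ x ∈ W' 0, d x ∈ W 1 → x ∈ W 0)
    (h1 : ∀ n, ∀ x ∈ W' (n + 1), d x ∈ W (n + 2) → ∃ y ∈ W' n, x - d y ∈ W (n + 1)) :
    QuasiIso (subcomplexInclusion d hd W W' hW hW' h) := by
  refine quasiIso_of_elements _ ?_ ?_
  · rintro i j l hi hj x y hx hxy
    cases j with
    | zero =>
      refine ⟨0, ?_⟩
      have e : (subcomplex d hd W' hW').d i 0 = 0 :=
        HomologicalComplex.shape _ _ _ (by simp)
      rw [e] at hxy
      have : (x : W 0).1 = 0 := congrArg Subtype.val (a₁ := Submodule.inclusion (h 0) x) hxy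
      rw [map_zero]
      exact (Subtype.ext this).symm
    | succ j =>
      rw [CochainComplex.prev_nat_succ] at hi
      subst hi
      have hxy' : (x : W (j + 1)).1 = d (y : W' j).1 :=
        congrArg Subtype.val (a₁ := Submodule.inclusion (h (j + 1)) x)
          (hxy.trans (subcomplex_d d hd W' hW' j y))
      -- Injectivity: the primitive `y` lies in the larger complex and its differential in the
      -- smaller one. Subtracting a coboundary moves `y` into the smaller complex without changing
      -- that differential.
      have hy : d (y : W' j).1 ∈ W (j + 1) := hxy' ▸ (x : W (j + 1)).2
      cases j with
      | zero =>
        refine ⟨(⟨y.1, h0 _ y.2 hy⟩ : W 0), ?_⟩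
        exact (subcomplex_d d hd W hW 0 _).trans (Subtype.ext hxy'.symm)
      | succ j =>
        obtain ⟨z, hz, hyz⟩ := h1 j _ y.2 hy
        refine ⟨(⟨y.1 - d z, hyz⟩ : W (j + 1)), ?_⟩
        refine (subcomplex_d d hd W hW (j + 1) _).trans (Subtype.ext ?_)
        change d (y.1 - d z) = _
        rw [map_sub, hd, sub_zero]
        exact hxy'.symm
  · rintro i j l hi hj y hy
    rw [CochainComplex.next] at hj
    subst hj
    replace hy := (subcomplex_d d hd W' hW' j y).symm.trans hy
    have hy' : d (y : W' j).1 ∈ W (j + 1) := by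
      have : d (y : W' j).1 = 0 := congrArg Subtype.val hy
      rw [this]
      exact zero_mem _
    cases j with
    | zero =>
      refine ⟨(⟨y.1, h0 _ y.2 hy'⟩ : W 0), 0, ?_, ?_⟩
      · exact (subcomplex_d d hd W hW 0 _).trans (Subtype.ext
          (show d (y : W' 0).1 = 0 from congrArg Subtype.val hy))
      · rw [map_zero, add_zero]
        rfl
    | succ j =>
      rw [CochainComplex.prev_nat_succ] at hi
      subst hi
      obtain ⟨z, hz, hyz⟩ := h1 j _ y.2 hy'
      refine ⟨(⟨y.1 - d z, hyz⟩ : W (j + 1)), (⟨z, hz⟩ : W' j), ?_, ?_⟩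
      · refine (subcomplex_d d hd W hW (j + 1) _).trans (Subtype.ext ?_)
        change d (y.1 - d z) = 0
        rw [map_sub, hd, sub_zero]
        exact congrArg Subtype.val hy
      · have e := subcomplex_d d hd W' hW' j (⟨z, hz⟩ : W' j)
        exact (congrArg (fun t => Submodule.inclusion (h (j + 1)) ⟨y.1 - d z, hyz⟩ + t) e).trans
          (Subtype.ext (sub_add_cancel y.1 (d z)))

end QuasiIsos

/-! ### Passage from cosimplicial objects to compatible families. -/

section Cosimplicial

open CategoryTheory

variable {k : Type u} [CommRing k]

/-- The cosimplicial module given by a cosimplicial object. -/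
abbrev cosMod (M : CosimplicialObject (ModuleCat.{v} k)) : CosMod.{u, v} k where
  obj p := level M p
  push u := (M.map (SimplexCategory.Hom.mk u)).hom
  push_id a := by
    have := M.map_id (SimplexCategory.mk a)
    exact congrArg ModuleCat.Hom.hom this
  push_comp u v := by
    have := M.map_comp (SimplexCategory.Hom.mk u) (SimplexCategory.Hom.mk v)
    exact congrArg ModuleCat.Hom.hom this

/-- The normal projector kills all cofaces but the last, so it is zero when their images span the
module. -/
theorem isTruncated_of_dimensionLE {M : CosimplicialObject (ModuleCat.{v} k)} {m : ℕ}
    (h : DimensionLE M m) : (cosMod M).IsTruncated m := by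
  intro p hp
  cases p with
  | zero => omega
  | succ p =>
    have h1 : cofaces M (p + 1) = ⊤ := Submodule.Quotient.subsingleton_iff.1 (h _ hp)
    have h2 : cofaces M (p + 1) ≤ LinearMap.ker ((cosMod M).normal (p + 1)) := by
      refine iSup_le fun i => ?_
      rintro _ ⟨x, rfl⟩
      exact CosMod.normal_face (C := cosMod M) i x
    rw [h1, top_le_iff, LinearMap.ker_eq_top] at h2
    exact h2

variable {M : CosimplicialObject (ModuleCat.{v} k)} {N : CosimplicialObject (ModuleCat.{w} k)}
  {m n : ℕ}

/-- Outside the rectangle one of the normalized factors is zero, so the finiteness condition in the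
coproduct is automatic. -/
theorem mem_biCoproduct (hM : DimensionLE M m) (hN : DimensionLE N n)
    {B : ∀ p q, Submodule k (BiForm k p q)} {x : BiFamily M N} :
    x ∈ biCoproduct M N B ↔ (∀ p q, x p q ∈ coeffs (level M p ⊗[k] level N q) (B p q)) ∧
      IsCompatible (cosMod M) (cosMod N) x := by
  constructor
  · rintro ⟨h1, h2, -⟩
    exact ⟨h1, fun p p' q q' u v => h2 p p' q q' (SimplexCategory.Hom.mk u)
      (SimplexCategory.Hom.mk v)⟩
  · rintro ⟨h1, h2⟩
    refine ⟨h1, fun p p' q q' f g => h2 f.toOrderHom g.toOrderHom, ?_⟩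
    refine ((Set.finite_Iic m).prod (Set.finite_Iic n)).subset ?_
    rintro ⟨p, q⟩ h
    rw [Set.mem_prod, Set.mem_Iic, Set.mem_Iic]
    refine ⟨?_, ?_⟩
    · by_contra hp
      have := hM p (not_le.1 hp)
      exact h (Subsingleton.elim _ _)
    · by_contra hq
      have := hN q (not_le.1 hq)
      exact h (Subsingleton.elim _ _)

/-- The exactness statement in a fixed degree for a finite set of singular points. -/
theorem exists_biCoproduct_sub_d_mem (hM : DimensionLE M m) (hN : DimensionLE N n) {T : Finset ℤ}
    (hT : m + n + 1 < T.card) {R R' : Set ℤ → Set ℤ → Prop}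
    (hR : IsExtendable T R) (hR' : IsExtendable T R') (hRR' : ∀ F F', R F F' → R' F F')
    (h0 : R ∅ ∅) {B B' : ℕ → ∀ p q, Submodule k (BiForm k p q)}
    (hB : ∀ n p q, spanRel k R p q ≤ (B n p q).comap (biDeg k n p q))
    (hB' : ∀ n p q, spanRel k R' p q ≤ (B' n p q).comap (biDeg k n p q))
    (hBR : ∀ n p q, B n p q ≤ spanRel k R p q) (hBR' : ∀ n p q, B' n p q ≤ spanRel k R' p q)
    (hdeg : ∀ n p q, B' n p q ≤ LinearMap.eqLocus (biDeg k n p q) LinearMap.id) :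
    (∀ x ∈ biCoproduct M N (B' 0), biFamilyD M N x ∈ biCoproduct M N (B 1) →
      x ∈ biCoproduct M N (B 0)) ∧
    ∀ i, ∀ x ∈ biCoproduct M N (B' (i + 1)), biFamilyD M N x ∈ biCoproduct M N (B (i + 2)) →
      ∃ y ∈ biCoproduct M N (B' i), x - biFamilyD M N y ∈ biCoproduct M N (B (i + 1)) := by
  have key : ∀ i, ∀ x ∈ biCoproduct M N (B' i), biFamilyD M N x ∈ biCoproduct M N (B (i + 1)) →
      ∃ y : BiFamily M N, IsCompatible (cosMod M) (cosMod N) y ∧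
      (∀ p q, y p q ∈ coeffs (level M p ⊗[k] level N q) (spanRel k R' p q)) ∧
      ∀ p q, x p q - (biD k p q).lTensor _ (y p q) ∈
        coeffs (level M p ⊗[k] level N q) (spanRel k R p q) := by
    intro i x hx hdx
    rw [mem_biCoproduct hM hN] at hx hdx
    exact exists_family_sub_d_mem (isTruncated_of_dimensionLE hM) (isTruncated_of_dimensionLE hN)
      hT hR hR' hRR' h0 hx.2 (fun p q => coeffs_mono (hBR' i p q) (hx.1 p q))
      (fun p q => coeffs_mono (hBR (i + 1) p q) (hdx.1 p q))
  have hid : ∀ i, ∀ x ∈ biCoproduct M N (B' i), ∀ p q, (biDeg k i p q).lTensor _ (x p q) = x p q := by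
    intro i x hx p q
    have h : coeffs (level M p ⊗[k] level N q) (B' i p q) ≤
        LinearMap.eqLocus ((biDeg k i p q).lTensor _) LinearMap.id := coeffs_le fun a b hb => by
      have := hdeg i p q hb
      rw [LinearMap.mem_eqLocus] at this ⊢
      rw [LinearMap.lTensor_tmul, this]
      rfl
    exact h (hx.1 p q)
  refine ⟨fun x hx hdx => ?_, fun i x hx hdx => ?_⟩
  · obtain ⟨y, hy, hyR, hxy⟩ := key 0 x hx hdx
    rw [mem_biCoproduct hM hN]
    refine ⟨fun p q => ?_, ((mem_biCoproduct hM hN).1 hx).2⟩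
    -- A coboundary has no part of degree `0`, so the projection on degree `0` leaves `x` itself in
    -- the smaller module.
    have := coeffs_le_comap_lTensor (hB 0 p q) (hxy p q)
    rw [Submodule.mem_comap, map_sub, hid 0 x hx, ← LinearMap.comp_apply,
      ← LinearMap.lTensor_comp, biDeg_zero_comp_biD, LinearMap.lTensor_zero, LinearMap.zero_apply,
      sub_zero] at this
    exact this
  · obtain ⟨y, hy, hyR, hxy⟩ := key (i + 1) x hx hdx
    -- The primitive is replaced by its part of degree `i`. This part is still a compatible family,
    -- because simplicial operators preserve degrees.
    have hy' : IsCompatible (cosMod M) (cosMod N) fun p q => (biDeg k i p q).lTensor _ (y p q) :=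
      hy.map (fun p q => biDeg k i p q) fun u v => biDeg_comp_biPull i u v
    refine ⟨fun p q => (biDeg k i p q).lTensor _ (y p q), (mem_biCoproduct hM hN).2
      ⟨fun p q => coeffs_le_comap_lTensor (hB' i p q) (hyR p q), hy'⟩, (mem_biCoproduct hM hN).2
      ⟨fun p q => ?_, (((mem_biCoproduct hM hN).1 hx).2).sub hy'.biD⟩⟩
    have := coeffs_le_comap_lTensor (hB (i + 1) p q) (hxy p q)
    rw [Submodule.mem_comap, map_sub, hid (i + 1) x hx, ← LinearMap.comp_apply,
      ← LinearMap.lTensor_comp, biDeg_succ_comp_biD, LinearMap.lTensor_comp,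
      LinearMap.comp_apply] at this
    exact this

end Cosimplicial
end QuasiComm
end

noncomputable section

namespace QuasiComm

/-! ### The quasi-isomorphisms for arbitrary sets of singular points. -/

section MainQuasiIsos

open CategoryTheory

variable {k : Type u} [CommRing k]

/-- Finite subsets are directed under union, so the supremum is a union. -/
theorem mem_iSup_finset {V : Type*} [AddCommGroup V] [Module k V] {S : Set ℤ}
    {F : Finset ℤ → Submodule k V} (hF : Monotone F) {x : V} :
    (x ∈ ⨆ (T : Finset ℤ) (_ : (T : Set ℤ) ⊆ S), F T) ↔ ∃ T : Finset ℤ, (T : Set ℤ) ⊆ S ∧ x ∈ F T := by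
  classical
  have : Nonempty {T : Finset ℤ // (T : Set ℤ) ⊆ S} := ⟨⟨∅, by simp⟩⟩
  rw [iSup_subtype', Submodule.mem_iSup_of_directed]
  · simp
  · rintro ⟨T, hT⟩ ⟨T', hT'⟩
    exact ⟨⟨T ∪ T', by rw [Finset.coe_union]; exact Set.union_subset hT hT'⟩,
      hF Finset.subset_union_left, hF Finset.subset_union_right⟩

theorem biFormsIn_mono {T T' : Set ℤ} (h : T ⊆ T') (n p q : ℕ) :
    biFormsIn k T n p q ≤ biFormsIn k T' n p q :=
  Submodule.span_mono fun _ ⟨w, w', h1, h2, e⟩ => ⟨w, w', h1.trans h, h2.trans h, e⟩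

theorem reducedBiFormsIn_mono {T T' : Set ℤ} (h : T ⊆ T') (n p q : ℕ) :
    reducedBiFormsIn k T n p q ≤ reducedBiFormsIn k T' n p q :=
  Submodule.span_mono fun _ ⟨w, w', h1, h2, e⟩ => ⟨w, w', h1.trans h, h2.trans h, e⟩

variable {M : CosimplicialObject (ModuleCat.{v} k)} {N : CosimplicialObject (ModuleCat.{w} k)}
  {m n : ℕ} {S : Set ℤ}

theorem mem_fullTensor {i : ℕ} {x : BiFamily M N} : x ∈ fullTensor M N S i ↔
    ∃ T : Finset ℤ, (T : Set ℤ) ⊆ S ∧ x ∈ biCoproduct M N (biFormsIn k T i) :=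
  mem_iSup_finset fun _ _ h => biCoproduct_mono M N fun p q =>
    biFormsIn_mono (Finset.coe_subset.2 h) i p q

theorem mem_reducedTensor {i : ℕ} {x : BiFamily M N} : x ∈ reducedTensor M N S i ↔
    ∃ T : Finset ℤ, (T : Set ℤ) ⊆ S ∧ x ∈ biCoproduct M N (reducedBiFormsIn k T i) :=
  mem_iSup_finset fun _ _ h => biCoproduct_mono M N fun p q =>
    reducedBiFormsIn_mono (Finset.coe_subset.2 h) i p q

theorem exists_finset_card {l : ℕ} (hS : (l : ℕ∞) < S.encard) :
    ∃ T : Finset ℤ, (T : Set ℤ) ⊆ S ∧ l < T.card := by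
  obtain ⟨t, ht, h⟩ := Set.exists_subset_encard_eq (s := S) (k := ((l + 1 : ℕ) : ℕ∞))
    (by rw [Nat.cast_add, Nat.cast_one]; exact Order.add_one_le_of_lt hS)
  have hfin : t.Finite := Set.finite_of_encard_eq_coe h
  refine ⟨hfin.toFinset, by simpa using ht, ?_⟩
  rw [hfin.encard_eq_coe_toFinset_card, Nat.cast_inj] at h
  omega

theorem quasiIso_reducedInclusion (hM : DimensionLE M m) (hN : DimensionLE N n)
    (hS : ((m + n + 1 : ℕ) : ℕ∞) < S.encard) : QuasiIso (reducedInclusion M N S) := by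
  classical
  -- A cochain and its differential involve finitely many points. Adding `T₀` to them gives a finite
  -- set large enough for the zigzags.
  obtain ⟨T₀, hT₀, hcard⟩ := exists_finset_card hS
  have key : ∀ i, ∀ x ∈ fullTensor M N S i, biFamilyD M N x ∈ reducedTensor M N S (i + 1) →
      ∃ T : Finset ℤ, (T : Set ℤ) ⊆ S ∧ m + n + 1 < T.card ∧
        x ∈ biCoproduct M N (biFormsIn k T i) ∧
        biFamilyD M N x ∈ biCoproduct M N (reducedBiFormsIn k T (i + 1)) := by
    intro i x hx hdx
    obtain ⟨T₁, h₁, hx⟩ := mem_fullTensor.1 hx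
    obtain ⟨T₂, h₂, hdx⟩ := mem_reducedTensor.1 hdx
    refine ⟨T₀ ∪ (T₁ ∪ T₂), ?_, ?_, ?_, ?_⟩
    · rw [Finset.coe_union, Finset.coe_union]
      exact Set.union_subset hT₀ (Set.union_subset h₁ h₂)
    · exact hcard.trans_le (Finset.card_le_card Finset.subset_union_left)
    · exact biCoproduct_mono M N (fun p q => biFormsIn_mono (Finset.coe_subset.2
        (Finset.subset_union_left.trans Finset.subset_union_right)) i p q) hx
    · exact biCoproduct_mono M N (fun p q => reducedBiFormsIn_mono (Finset.coe_subset.2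
        (Finset.subset_union_right.trans Finset.subset_union_right)) (i + 1) p q) hdx
  have main := fun (T : Finset ℤ) (hT : m + n + 1 < T.card) =>
    exists_biCoproduct_sub_d_mem hM hN hT (isExtendable_reducedRel (T' := T) le_rfl)
      (isExtendable_fullRel (T' := T) le_rfl) (fun _ _ h => ⟨h.1, h.2.1⟩)
      ⟨Set.empty_subset _, Set.empty_subset _, disjoint_bot_left⟩
      (reducedRel_le_comap_biDeg (k := k) (T : Set ℤ)) (fullRel_le_comap_biDeg (T : Set ℤ))
      (reducedBiFormsIn_le_spanRel (T : Set ℤ)) (biFormsIn_le_spanRel (T : Set ℤ))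
      (biFormsIn_le_eqLocus (T : Set ℤ))
  refine quasiIso_subcomplexInclusion _ _ _ _ _ _ _ ?_ ?_
  · intro x hx hdx
    obtain ⟨T, hTS, hT, hx, hdx⟩ := key 0 x hx hdx
    exact mem_reducedTensor.2 ⟨T, hTS, (main T hT).1 x hx hdx⟩
  · intro i x hx hdx
    obtain ⟨T, hTS, hT, hx, hdx⟩ := key (i + 1) x hx hdx
    obtain ⟨y, hy, hxy⟩ := (main T hT).2 i x hx hdx
    exact ⟨y, mem_fullTensor.2 ⟨T, hTS, hy⟩, mem_reducedTensor.2 ⟨T, hTS, hxy⟩⟩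

theorem quasiIso_reducedExtension (hM : DimensionLE M m) (hN : DimensionLE N n)
    (hS : ((m + n + 1 : ℕ) : ℕ∞) < S.encard) {S' : Set ℤ} (h : S ⊆ S') :
    QuasiIso (reducedExtension M N h) := by
  classical
  obtain ⟨T₀, hT₀, hcard⟩ := exists_finset_card hS
  have key : ∀ i, ∀ x ∈ reducedTensor M N S' i, biFamilyD M N x ∈ reducedTensor M N S (i + 1) →
      ∃ T T' : Finset ℤ, (T : Set ℤ) ⊆ S ∧ (T' : Set ℤ) ⊆ S' ∧ T ⊆ T' ∧ m + n + 1 < T.card ∧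
        x ∈ biCoproduct M N (reducedBiFormsIn k T' i) ∧
        biFamilyD M N x ∈ biCoproduct M N (reducedBiFormsIn k T (i + 1)) := by
    intro i x hx hdx
    obtain ⟨T₁, h₁, hx⟩ := mem_reducedTensor.1 hx
    obtain ⟨T₂, h₂, hdx⟩ := mem_reducedTensor.1 hdx
    have hT : ((T₀ ∪ T₂ : Finset ℤ) : Set ℤ) ⊆ S := by
      rw [Finset.coe_union]
      exact Set.union_subset hT₀ h₂
    refine ⟨T₀ ∪ T₂, T₁ ∪ (T₀ ∪ T₂), hT, ?_, Finset.subset_union_right, ?_, ?_, ?_⟩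
    · rw [Finset.coe_union]
      exact Set.union_subset h₁ (hT.trans h)
    · exact hcard.trans_le (Finset.card_le_card Finset.subset_union_left)
    · exact biCoproduct_mono M N (fun p q => reducedBiFormsIn_mono (Finset.coe_subset.2
        Finset.subset_union_left) i p q) hx
    · exact biCoproduct_mono M N (fun p q => reducedBiFormsIn_mono (Finset.coe_subset.2
        Finset.subset_union_right) (i + 1) p q) hdx
  -- Here both conditions ask for disjoint supports, in `T` and in `T'` respectively. New points are
  -- taken from `T` in both cases, so only the smaller set has to be large.
  have main := fun (T T' : Finset ℤ) (hTT' : T ⊆ T') (hT : m + n + 1 < T.card) =>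
    exists_biCoproduct_sub_d_mem hM hN hT (isExtendable_reducedRel (T' := T) le_rfl)
      (isExtendable_reducedRel (T' := T') (Finset.coe_subset.2 hTT'))
      (fun _ _ h => ⟨h.1.trans (Finset.coe_subset.2 hTT'),
        h.2.1.trans (Finset.coe_subset.2 hTT'), h.2.2⟩)
      ⟨Set.empty_subset _, Set.empty_subset _, disjoint_bot_left⟩
      (reducedRel_le_comap_biDeg (k := k) (T : Set ℤ)) (reducedRel_le_comap_biDeg (T' : Set ℤ))
      (reducedBiFormsIn_le_spanRel (T : Set ℤ)) (reducedBiFormsIn_le_spanRel (T' : Set ℤ))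
      (fun i p q => (reducedBiFormsIn_le k (T' : Set ℤ) i p q).trans
        (biFormsIn_le_eqLocus (T' : Set ℤ) i p q))
  refine quasiIso_subcomplexInclusion _ _ _ _ _ _ _ ?_ ?_
  · intro x hx hdx
    obtain ⟨T, T', hTS, hTS', hTT', hT, hx, hdx⟩ := key 0 x hx hdx
    exact mem_reducedTensor.2 ⟨T, hTS, (main T T' hTT' hT).1 x hx hdx⟩
  · intro i x hx hdx
    obtain ⟨T, T', hTS, hTS', hTT', hT, hx, hdx⟩ := key (i + 1) x hx hdx
    obtain ⟨y, hy, hxy⟩ := (main T T' hTT' hT).2 i x hx hdx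
    exact ⟨y, mem_reducedTensor.2 ⟨T', hTS', hy⟩, mem_reducedTensor.2 ⟨T, hTS, hxy⟩⟩

/-- Above the dimension every simplex is degenerate. A normal cochain vanishes on degenerate
simplices, hence is zero, and a cochain with zero normal projection is a sum of images of cofaces
other than the last. -/
theorem dimensionLE_simplicialCochains {X : SSet.{v}} (h : X.HasDimensionLE m) :
    DimensionLE (simplicialCochains k X) m := by
  intro p hp
  rw [Submodule.Quotient.subsingleton_iff, eq_top_iff]
  obtain ⟨p, rfl⟩ : ∃ p', p = p' + 1 := ⟨p - 1, by omega⟩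
  intro c _
  let C := cosMod (simplicialCochains k X)
  have h0 : C.normal (p + 1) c = 0 := by
    funext x
    have hx : x ∈ X.degenerate (p + 1) := by
      rw [X.degenerate_eq_univ_of_hasDimensionLT (m + 1) (p + 1) (by omega)]
      exact Set.mem_univ x
    obtain ⟨a, ha, f, y, rfl⟩ := hx
    have hf : ¬ Function.Injective f.toOrderHom := fun hinj => by
      have := Fintype.card_le_of_injective _ hinj
      simp at this
      omega
    exact congrFun (CosMod.isNormal_normal (C := C) c f.toOrderHom hf) y
  have := CosMod.sub_normal_mem (C := C) c
  rw [h0, sub_zero] at this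
  exact this

end MainQuasiIsos
end QuasiComm
end

noncomputable section

namespace QuasiComm

/-! ### Linear reconstruction of a compatible family from one component. -/

section Reconstruction

variable {k : Type u} [CommRing k] {C : CosMod.{u, v} k} {V : Type w} [AddCommGroup V] [Module k V]

variable (C V) in
/-- A family of elements of the `(C_p ⊗ D*(Δ_p)) ⊗ V` which is compatible with the structure maps. -/
def IsCompatibleFamily (x : ∀ p, (C.obj p ⊗[k] Form k p) ⊗[k] V) : Prop :=
  ∀ ⦃p p' : ℕ⦄ (u : Fin (p + 1) →o Fin (p' + 1)),
    ((C.push u).rTensor (Form k p)).rTensor V (x p) =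
      ((formPull k u).lTensor (C.obj p')).rTensor V (x p')

variable {x y : ∀ p, (C.obj p ⊗[k] Form k p) ⊗[k] V}

theorem IsCompatibleFamily.sub (hx : IsCompatibleFamily C V x) (hy : IsCompatibleFamily C V y) :
    IsCompatibleFamily C V fun p => x p - y p := fun _ _ u => by
  rw [map_sub, map_sub, hx u, hy u]

theorem IsCompatibleFamily.isNormal_of_eq_zero (hx : IsCompatibleFamily C V x) {r : ℕ}
    (h : x r = 0) : ((C.normal (r + 1)).rTensor (Form k (r + 1))).rTensor V (x (r + 1)) =
      x (r + 1) := by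
  rw [← CosMod.normal_rTensor, ← CosMod.normal_rTensor]
  refine CosMod.normal_eq (C := (C.rTensor (Form k (r + 1))).rTensor V)
    (CosMod.isNormal_of_codegen (C := (C.rTensor (Form k (r + 1))).rTensor V) fun i => ?_)
  refine (hx (codegen i)).trans ?_
  rw [h, map_zero]

theorem IsCompatibleFamily.normal_eq (hx : IsCompatibleFamily C V x) {r : ℕ}
    (h : ∀ p < r, x p = 0) : ((C.normal r).rTensor (Form k r)).rTensor V (x r) = x r := by
  cases r with
  | zero =>
    rw [← CosMod.normal_rTensor, ← CosMod.normal_rTensor]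
    exact CosMod.normal_eq (C := (C.rTensor (Form k 0)).rTensor V)
      (CosMod.isNormal_zero (C := (C.rTensor (Form k 0)).rTensor V) _)
  | succ r => exact hx.isNormal_of_eq_zero (h r (Nat.lt_succ_self r))

theorem IsCompatibleFamily.eq_zero (hx : IsCompatibleFamily C V x) {m : ℕ} (hC : C.IsTruncated m)
    (h : ∀ p ≤ m, x p = 0) (p : ℕ) : x p = 0 := by
  induction p with
  | zero => exact h 0 (Nat.zero_le m)
  | succ p ih =>
    by_cases hp : p + 1 ≤ m
    · exact h _ hp
    · rw [← hx.isNormal_of_eq_zero ih, hC _ (by omega), LinearMap.rTensor_zero,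
        LinearMap.rTensor_zero, LinearMap.zero_apply]

/-- Since the earlier components vanish, all faces of `x r` are zero, and the extra degeneracy turns
such an element into a Moore element. -/
theorem IsCompatibleFamily.moore_ins (hx : IsCompatibleFamily C V x) (s : ℤ) {r : ℕ}
    (h : ∀ p < r, x p = 0) :
    (((formSimp k).moore (r + 1)).lTensor (C.obj r)).rTensor V
      (((ins k s r).lTensor (C.obj r)).rTensor V (x r)) =
        ((ins k s r).lTensor (C.obj r)).rTensor V (x r) := by
  have e := SimpMod.moore_eq (S := ((formSimp k).lTensor (C.obj r)).rTensor V)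
    (b := ((ins k s r).lTensor (C.obj r)).rTensor V (x r)) (SimpMod.isMoore_of_face fun i => ?_)
  · rwa [SimpMod.moore_rTensor, SimpMod.moore_lTensor] at e
  change ((formPull k (face i.succ)).lTensor (C.obj r)).rTensor V
      (((ins k s r).lTensor (C.obj r)).rTensor V (x r)) = 0
  rw [← LinearMap.comp_apply, ← LinearMap.rTensor_comp, ← LinearMap.lTensor_comp]
  cases r with
  | zero =>
    have e0 : formPull k (face i.succ) ∘ₗ ins k s 0 = 0 :=
      LinearMap.ext fun z => formPull_face_succ_ins_zero s i z
    rw [e0, LinearMap.lTensor_zero, LinearMap.rTensor_zero, LinearMap.zero_apply]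
  | succ r =>
    have e0 : formPull k (face i.succ) ∘ₗ ins k s (r + 1) = ins k s r ∘ₗ formPull k (face i) :=
      LinearMap.ext fun z => formPull_face_succ_ins s i z
    rw [e0, LinearMap.lTensor_comp, LinearMap.rTensor_comp, LinearMap.comp_apply, ← hx (face i),
      h r (Nat.lt_succ_self r), map_zero, map_zero]

/-- The extra degeneracy gives a Moore lift of `x r` by a linear map on forms alone, so the lift
makes sense with any coefficients `V`. A fixed `s` is enough, as no disjointness is involved. -/
theorem IsCompatibleFamily.normalWhitney_ins (hx : IsCompatibleFamily C V x) (s : ℤ) {r : ℕ}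
    (h : ∀ p < r, x p = 0) :
    (normalWhitney C (formSimp k) r r).rTensor V
      (((ins k s r).lTensor (C.obj r)).rTensor V (x r)) = x r := by
  have e0 : formPull k (face 0) ∘ₗ ins k s r = LinearMap.id :=
    LinearMap.ext fun z => formPull_face_zero_ins s z
  rw [← hx.moore_ins s h, ← LinearMap.comp_apply, ← LinearMap.rTensor_comp, normalWhitney_self,
    ← LinearMap.rTensor_comp_lTensor, LinearMap.lTensor_comp, LinearMap.rTensor_comp,
    LinearMap.rTensor_comp, LinearMap.comp_apply, LinearMap.comp_apply, hx.moore_ins s h]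
  refine Eq.trans (congrArg _ ?_) (hx.normal_eq h)
  change ((formPull k (face 0)).lTensor (C.obj r)).rTensor V
      (((ins k s r).lTensor (C.obj r)).rTensor V (x r)) = x r
  rw [← LinearMap.comp_apply, ← LinearMap.rTensor_comp, ← LinearMap.lTensor_comp, e0,
    LinearMap.lTensor_id, LinearMap.rTensor_id, LinearMap.id_apply]

/-- The map `i ↦ min i b`. -/
def clamp (a b : ℕ) : Fin (a + 1) →o Fin (b + 1) where
  toFun i := ⟨min i b, by omega⟩
  monotone' i j h := by
    rw [Fin.mk_le_mk]
    exact min_le_min_right b h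

theorem clamp_comp_clamp {r m : ℕ} (h : r ≤ m) : (clamp m r).comp (clamp r m) = OrderHom.id := by
  ext i
  have := i.2
  change min (min i.1 m) r = i.1
  omega

variable (C) in
/-- The component in `r ≤ m` of a compatible family with component `z` in `m`. -/
def restrictTo (m r : ℕ) : C.obj m ⊗[k] Form k m →ₗ[k] C.obj r ⊗[k] Form k r :=
  TensorProduct.map (C.push (clamp m r)) (formPull k (clamp r m))

/-- Pushing `x m` down to `r` equals pulling `x r` up to `m`. The inclusion of `[r]` in `[m]` is a
section of the clamping map, so pulling back along it recovers `x r`. -/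
theorem IsCompatibleFamily.restrictTo (hx : IsCompatibleFamily C V x) {r m : ℕ} (h : r ≤ m) :
    (restrictTo C m r).rTensor V (x m) = x r := by
  rw [QuasiComm.restrictTo, ← LinearMap.lTensor_comp_rTensor, LinearMap.rTensor_comp,
    LinearMap.comp_apply, hx (clamp m r), ← LinearMap.comp_apply, ← LinearMap.rTensor_comp,
    ← LinearMap.lTensor_comp]
  have e : formPull k (clamp r m) ∘ₗ formPull k (clamp m r) = LinearMap.id := by
    rw [← formPull_comp, clamp_comp_clamp h, formPull_id]
  rw [e, LinearMap.lTensor_id, LinearMap.rTensor_id, LinearMap.id_apply]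

variable (C) in
/-- The compatible family determined by its component in `m`, up to the components in `p ≥ r`. -/
def extend (s : ℤ) (m : ℕ) : ℕ → ∀ p, C.obj m ⊗[k] Form k m →ₗ[k] C.obj p ⊗[k] Form k p
  | 0, _ => 0
  | r + 1, p => extend s m r p + normalWhitney C (formSimp k) r p ∘ₗ (ins k s r).lTensor _ ∘ₗ
      (restrictTo C m r - extend s m r r)

theorem extend_compatible (s : ℤ) (m r : ℕ) {p p' : ℕ} (u : Fin (p + 1) →o Fin (p' + 1)) :
    (C.push u).rTensor (Form k p) ∘ₗ extend C s m r p =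
      (formPull k u).lTensor (C.obj p') ∘ₗ extend C s m r p' := by
  induction r with
  | zero => simp [extend]
  | succ r ih =>
    have h : (C.push u).rTensor (Form k p) ∘ₗ normalWhitney C (formSimp k) r p =
        (formPull k u).lTensor (C.obj p') ∘ₗ normalWhitney C (formSimp k) r p' :=
      normalWhitney_compatible C (formSimp k) r u
    rw [extend, extend, LinearMap.comp_add, LinearMap.comp_add, ih, ← LinearMap.comp_assoc,
      ← LinearMap.comp_assoc, h]
    rfl

theorem isCompatibleFamily_extend (s : ℤ) (m r : ℕ) (z : (C.obj m ⊗[k] Form k m) ⊗[k] V) :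
    IsCompatibleFamily C V fun p => (extend C s m r p).rTensor V z := fun p p' u => by
  rw [← LinearMap.comp_apply, ← LinearMap.comp_apply, ← LinearMap.rTensor_comp,
    ← LinearMap.rTensor_comp, extend_compatible]

/-- The difference between `x` and the part built so far vanishes before `r`. The family generated
by its component in `r` corrects that component and leaves the earlier ones alone. -/
theorem IsCompatibleFamily.extend_eq_of_lt (hx : IsCompatibleFamily C V x) (s : ℤ) {m r : ℕ}
    (hr : r ≤ m + 1) {p : ℕ} (hp : p < r) : (extend C s m r p).rTensor V (x m) = x p := by
  induction r generalizing p with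
  | zero => omega
  | succ r ih =>
    have h0 : ∀ p < r, x p - (extend C s m r p).rTensor V (x m) = 0 := fun p hp => by
      rw [ih (by omega) hp, sub_self]
    have hy := hx.sub (isCompatibleFamily_extend s m r (x m))
    have e : (extend C s m (r + 1) p).rTensor V (x m) = (extend C s m r p).rTensor V (x m) +
        (normalWhitney C (formSimp k) r p).rTensor V (((ins k s r).lTensor (C.obj r)).rTensor V
          (x r - (extend C s m r r).rTensor V (x m))) := by
      rw [extend, LinearMap.rTensor_add, LinearMap.add_apply, LinearMap.rTensor_comp,
        LinearMap.rTensor_comp, LinearMap.rTensor_sub, LinearMap.comp_apply, LinearMap.comp_apply,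
        LinearMap.sub_apply, hx.restrictTo (by omega)]
    rw [e]
    rcases Nat.lt_succ_iff_lt_or_eq.1 hp with h | rfl
    · rw [normalWhitney_of_lt C _ h, LinearMap.rTensor_zero, LinearMap.zero_apply, add_zero,
        ih (by omega) h]
    · have := hy.normalWhitney_ins s h0
      rw [this, add_sub_cancel]

/-- The components up to `m` agree after `m + 1` steps, and truncation forces agreement beyond `m`.
-/
theorem IsCompatibleFamily.extend_eq (hx : IsCompatibleFamily C V x) (s : ℤ) {m : ℕ}
    (hC : C.IsTruncated m) (p : ℕ) : (extend C s m (m + 1) p).rTensor V (x m) = x p := by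
  have := ((isCompatibleFamily_extend s m (m + 1) (x m)).sub hx).eq_zero hC (fun p hp => by
    rw [hx.extend_eq_of_lt s le_rfl (Nat.lt_succ_of_le hp), sub_self]) p
  exact sub_eq_zero.1 this

theorem degree_ins (s : ℤ) {p : ℕ} (w : Word p) : (w.ins s).degree = w.degree := by
  have : (w.ins s).diracs = w.diracs.map (Fin.succEmb (p + 1)) := by
    ext i
    refine Fin.cases ?_ (fun i => ?_) i
    · simp [zero_notMem_diracs_ins, Fin.succ_ne_zero]
    · rw [mem_diracs_ins_succ]
      simp
  unfold Word.degree
  rw [this, Finset.card_map]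

theorem formsIn_le_comap_formPull (T : Set ℤ) (a : ℕ) {p q : ℕ} (u : Fin (p + 1) →o Fin (q + 1)) :
    formsIn k T a q ≤ (formsIn k T a p).comap (formPull k u) := by
  refine Submodule.span_le.2 ?_
  rintro _ ⟨w, hw, ha, rfl⟩
  rw [SetLike.mem_coe, Submodule.mem_comap, formPull_formOf]
  exact Submodule.sum_mem _ fun A hA => Submodule.subset_span
    ⟨_, (support_spread u w A).trans hw, (degree_spread hA).trans ha, rfl⟩

theorem formsIn_le_comap_ins {T : Set ℤ} {s : ℤ} (hs : s ∈ T) (a p : ℕ) :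
    formsIn k T a p ≤ (formsIn k T a (p + 1)).comap (ins k s p) := by
  refine Submodule.span_le.2 ?_
  rintro _ ⟨w, hw, ha, rfl⟩
  rw [SetLike.mem_coe, Submodule.mem_comap, ins_formOf]
  refine Submodule.subset_span ⟨_, ?_, (degree_ins s w).trans ha, rfl⟩
  rw [support_ins]
  exact Set.insert_subset hs hw

theorem normalWhitney_mem_coeffs {T : Set ℤ} {a r : ℕ} {z : C.obj r ⊗[k] Form k (r + 1)}
    (hz : z ∈ coeffs (C.obj r) (formsIn k T a (r + 1))) (p : ℕ) :
    normalWhitney C (formSimp k) r p z ∈ coeffs (C.obj p) (formsIn k T a p) := by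
  rw [normalWhitney_eq_sum, LinearMap.sum_apply]
  refine Submodule.sum_mem _ fun u _ => ?_
  refine coeffs_le_comap_map (C.push u ∘ₗ C.normal r) (f := whitneyCoeff (formSimp k) u)
    (fun y hy => ?_) hz
  rw [Submodule.mem_comap, whitneyCoeff, LinearMap.sum_apply]
  exact Submodule.sum_mem _ fun t _ => Submodule.smul_mem _ _ (formsIn_le_comap_formPull T a _ hy)

theorem extend_mem_coeffs {T : Set ℤ} {s : ℤ} (hs : s ∈ T) {a m : ℕ}
    {z : C.obj m ⊗[k] Form k m} (hz : z ∈ coeffs (C.obj m) (formsIn k T a m)) (r p : ℕ) :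
    extend C s m r p z ∈ coeffs (C.obj p) (formsIn k T a p) := by
  induction r generalizing p with
  | zero => exact zero_mem _
  | succ r ih =>
    refine add_mem (ih p) (normalWhitney_mem_coeffs ?_ p)
    refine coeffs_le_comap_lTensor (formsIn_le_comap_ins hs a r) ?_
    exact sub_mem (coeffs_le_comap_map _ (formsIn_le_comap_formPull T a _) hz) (ih r)

end Reconstruction
end QuasiComm
end

noncomputable section

namespace QuasiComm

/-! ### The comparison map and a left inverse. -/

section Comparison

open scoped DirectSum

variable {k : Type u} [CommRing k] {M : CategoryTheory.CosimplicialObject (ModuleCat.{v} k)}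
  {N : CategoryTheory.CosimplicialObject (ModuleCat.{w} k)} {m n : ℕ} {S : Set ℤ} {s : ℤ}

theorem mem_coproduct (hM : DimensionLE M m) {B : ∀ p, Submodule k (Form k p)} {x : Family M} :
    x ∈ coproduct M B ↔ (∀ p, x p ∈ coeffs (level M p) (B p)) ∧
      ∀ (p p' : ℕ) (u : Fin (p + 1) →o Fin (p' + 1)),
        ((cosMod M).push u).rTensor (Form k p) (x p) =
          (formPull k u).lTensor (level M p') (x p') := by
  constructor
  · rintro ⟨h1, h2, -⟩
    exact ⟨h1, fun p p' u => h2 p p' (SimplexCategory.Hom.mk u)⟩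
  · rintro ⟨h1, h2⟩
    refine ⟨h1, fun p p' f => h2 p p' f.toOrderHom, (Set.finite_Iic m).subset fun p h => ?_⟩
    by_contra hp
    have := hM p (not_le.1 hp)
    exact h (Subsingleton.elim _ _)

theorem formsIn_mono {T T' : Set ℤ} (h : T ⊆ T') (a p : ℕ) : formsIn k T a p ≤ formsIn k T' a p :=
  Submodule.span_mono fun _ ⟨w, h1, h2, e⟩ => ⟨w, h1.trans h, h2, e⟩

theorem mem_cochains (hM : DimensionLE M m) {a : ℕ} {x : Family M} : x ∈ cochains M S a ↔
    ∃ T : Finset ℤ, (T : Set ℤ) ⊆ S ∧ x ∈ coproduct M (formsIn k T a) :=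
  mem_iSup_finset fun T T' h x hx => by
    rw [mem_coproduct hM] at hx ⊢
    exact ⟨fun p => coeffs_mono (formsIn_mono (Finset.coe_subset.2 h) a p) (hx.1 p), hx.2⟩

variable (k) in
/-- The projection on the forms of degree `a` with singular support in `S`. -/
def formPart (S : Set ℤ) (a p : ℕ) : Form k p →ₗ[k] Form k p :=
  wordProj k p (fun w => w.degree = a) ∘ₗ wordProj k p fun w => w.support ⊆ S

theorem formPart_formOf (a : ℕ) {p : ℕ} {w : Word p} (h : w.support ⊆ S) :
    formPart k S a p (formOf k w) = if w.degree = a then formOf k w else 0 := by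
  rw [formPart, LinearMap.comp_apply, wordProj_formOf, if_pos h, wordProj_formOf]
  congr

theorem formPart_formOf_of_not {a p : ℕ} {w : Word p} (h : ¬ w.support ⊆ S) :
    formPart k S a p (formOf k w) = 0 := by
  rw [formPart, LinearMap.comp_apply, wordProj_formOf, if_neg h, map_zero]

/-- The tensor product of complexes is a direct sum over pairs of degrees; these projections
separate its summands. -/
theorem lTensor_formPart (hM : DimensionLE M m) {a : ℕ} {x : Family M} (hx : x ∈ cochains M S a)
    (b p : ℕ) :
    (formPart k S b p).lTensor (level M p) (x p) = if a = b then x p else 0 := by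
  obtain ⟨T, hT, hx⟩ := (mem_cochains hM).1 hx
  have key : coeffs (level M p) (formsIn k T a p) ≤ LinearMap.eqLocus
      ((formPart k S b p).lTensor (level M p)) (if a = b then LinearMap.id else 0) := by
    refine coeffs_le fun c f hf => ?_
    have hf' : formsIn k T a p ≤ LinearMap.eqLocus (formPart k S b p)
        (if a = b then LinearMap.id else 0) := by
      refine Submodule.span_le.2 ?_
      rintro _ ⟨w, hw, ha, rfl⟩
      rw [SetLike.mem_coe, LinearMap.mem_eqLocus, formPart_formOf b (hw.trans hT), ha]
      split_ifs <;> rfl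
    have e := hf' hf
    rw [LinearMap.mem_eqLocus] at e ⊢
    rw [LinearMap.lTensor_tmul, e]
    split_ifs
    · rfl
    · rw [LinearMap.zero_apply, LinearMap.zero_apply, TensorProduct.tmul_zero]
  have := key (((mem_coproduct hM).1 hx).1 p)
  rw [LinearMap.mem_eqLocus] at this
  rw [this]
  split_ifs <;> rfl

variable (M) in
/-- The compatible family with a given component in `m`. -/
def extendFamily (s : ℤ) (m : ℕ) : level M m ⊗[k] Form k m →ₗ[k] Family M :=
  LinearMap.pi fun p => extend (cosMod M) s m (m + 1) p

theorem extendFamily_mem (hM : DimensionLE M m) (hs : s ∈ S) (a : ℕ)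
    (z : level M m ⊗[k] Form k m) :
    extendFamily M s m ((formPart k S a m).lTensor (level M m) z) ∈ cochains M S a := by
  classical
  have h : ∀ (c : level M m) (f : Form k m), c ⊗ₜ[k] f ∈ (cochains M S a).comap
      (extendFamily M s m ∘ₗ (formPart k S a m).lTensor (level M m)) := by
    intro c
    suffices H : (cochains M S a).mkQ ∘ₗ extendFamily M s m ∘ₗ
        (formPart k S a m).lTensor (level M m) ∘ₗ TensorProduct.mk k _ _ c = 0 from fun f =>
      (Submodule.Quotient.mk_eq_zero (cochains M S a)).1 (LinearMap.congr_fun H f)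
    refine form_hom_ext fun w => (Submodule.Quotient.mk_eq_zero _).2 ?_
    change extendFamily M s m (c ⊗ₜ formPart k S a m (formOf k w)) ∈ _
    by_cases hw : w.support ⊆ S
    · rw [formPart_formOf a hw]
      split_ifs with ha
      · have hfin : w.support.Finite := Set.finite_iUnion fun i => by
          cases w i with
          | one => exact Set.finite_empty
          | heaviside s => exact Set.finite_singleton s
          | dirac s => exact Set.finite_singleton s
        -- The reconstruction introduces no singular point other than `s`, so a single finite set
        -- serves all components of the family.
        refine (mem_cochains hM).2 ⟨insert s hfin.toFinset, ?_, (mem_coproduct hM).2 ⟨fun p => ?_,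
          fun p p' u => LinearMap.congr_fun (extend_compatible (C := cosMod M) s m (m + 1) u) _⟩⟩
        · rw [Finset.coe_insert, Set.Finite.coe_toFinset]
          exact Set.insert_subset hs hw
        · refine extend_mem_coeffs (C := cosMod M) (Finset.mem_coe.2 (Finset.mem_insert_self _ _)) ?_
            (m + 1) p
          exact tmul_mem_coeffs _ (Submodule.subset_span ⟨w, by simp, ha, rfl⟩)
      · rw [TensorProduct.tmul_zero, map_zero]
        exact zero_mem _
    · rw [formPart_formOf_of_not hw, TensorProduct.tmul_zero, map_zero]
      exact zero_mem _
  induction z with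
  | zero => rw [map_zero, map_zero]; exact zero_mem _
  | add z z' hz hz' => rw [map_add, map_add]; exact add_mem hz hz'
  | tmul c f => exact h c f

/-- The cochain of degree `a` with a given component in `m`. -/
def extendCochain (hM : DimensionLE M m) (hs : s ∈ S) (a : ℕ) :
    level M m ⊗[k] Form k m →ₗ[k] cochains M S a :=
  LinearMap.codRestrict _ (extendFamily M s m ∘ₗ (formPart k S a m).lTensor (level M m))
    (extendFamily_mem hM hs a)

theorem extendFamily_apply (hM : DimensionLE M m) (s : ℤ) {a : ℕ} {x : Family M}
    (hx : x ∈ cochains M S a) : extendFamily M s m (x m) = x := by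
  obtain ⟨T, -, hx⟩ := (mem_cochains hM).1 hx
  -- The reconstruction theorem has coefficients in a module; here the coefficients are `k` itself.
  have h : IsCompatibleFamily (cosMod M) k fun p => x p ⊗ₜ[k] (1 : k) := fun p p' u => by
    rw [LinearMap.rTensor_tmul, LinearMap.rTensor_tmul]
    exact congrArg (· ⊗ₜ[k] (1 : k)) (((mem_coproduct hM).1 hx).2 p p' u)
  funext p
  have e := h.extend_eq s (isTruncated_of_dimensionLE hM) p
  have e' := congrArg (TensorProduct.rid k _) e
  rw [LinearMap.rTensor_tmul, TensorProduct.rid_tmul, TensorProduct.rid_tmul, one_smul,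
    one_smul] at e'
  exact e'

theorem extendCochain_apply (hM : DimensionLE M m) (hs : s ∈ S) {a : ℕ} (x : cochains M S a) :
    extendCochain hM hs a (x.1 m) = x := by
  refine Subtype.ext ?_
  change extendFamily M s m ((formPart k S a m).lTensor (level M m) (x.1 m)) = x.1
  rw [lTensor_formPart hM x.2, if_pos rfl, extendFamily_apply hM s x.2]

theorem extendCochain_of_ne (hM : DimensionLE M m) (hs : s ∈ S) {a b : ℕ} (h : a ≠ b)
    (x : cochains M S a) : extendCochain hM hs b (x.1 m) = 0 := by
  refine Subtype.ext ?_
  change extendFamily M s m ((formPart k S b m).lTensor (level M m) (x.1 m)) = 0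
  rw [lTensor_formPart hM x.2, if_neg h, map_zero]

theorem tensorComparison_lof (i : ℕ) (ab : Finset.HasAntidiagonal.antidiagonal i)
    (x : cochains M S ab.1.1) (y : cochains N S ab.1.2) :
    (tensorComparison M N S i (DirectSum.lof k _ (fun ab : Finset.HasAntidiagonal.antidiagonal i =>
      cochains M S ab.1.1 ⊗[k] cochains N S ab.1.2) ab (x ⊗ₜ[k] y))).1 = tensorFamily M N x.1 y.1 := by
  unfold tensorComparison
  rw [DirectSum.toModule_lof]
  rfl

/-- The element of the tensor product of the complexes of cochains determined by the component
in `(m, n)` of a family. -/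
def comparisonInverse (hM : DimensionLE M m) (hN : DimensionLE N n) (hs : s ∈ S) (i : ℕ) :
    BiFamily M N →ₗ[k] (⨁ ab : Finset.HasAntidiagonal.antidiagonal i,
      cochains M S ab.1.1 ⊗[k] cochains N S ab.1.2) :=
  ∑ ab : Finset.HasAntidiagonal.antidiagonal i,
    DirectSum.lof k _ (fun ab : Finset.HasAntidiagonal.antidiagonal i =>
      cochains M S ab.1.1 ⊗[k] cochains N S ab.1.2) ab ∘ₗ
    TensorProduct.map (extendCochain hM hs ab.1.1) (extendCochain hN hs ab.1.2) ∘ₗ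
    (TensorProduct.tensorTensorTensorComm k (level M m) (Form k m) (level N n)
      (Form k n)).symm.toLinearMap ∘ₗ LinearMap.proj n ∘ₗ LinearMap.proj m

theorem comparisonInverse_apply (hM : DimensionLE M m) (hN : DimensionLE N n) (hs : s ∈ S) (i : ℕ)
    (x : BiFamily M N) : comparisonInverse hM hN hs i x =
      ∑ ab : Finset.HasAntidiagonal.antidiagonal i,
        DirectSum.lof k _ (fun ab : Finset.HasAntidiagonal.antidiagonal i =>
          cochains M S ab.1.1 ⊗[k] cochains N S ab.1.2) ab
        (TensorProduct.map (extendCochain hM hs ab.1.1) (extendCochain hN hs ab.1.2)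
          ((TensorProduct.tensorTensorTensorComm k (level M m) (Form k m) (level N n)
            (Form k n)).symm (x m n))) := by
  rw [comparisonInverse, LinearMap.sum_apply]
  rfl

/-- On a pure tensor in degrees `(a, b)`, only the summand of those degrees survives, and there each
factor is reconstructed from its own component. -/
theorem comparisonInverse_tensorComparison (hM : DimensionLE M m) (hN : DimensionLE N n)
    (hs : s ∈ S) (i : ℕ) (t : ⨁ ab : Finset.HasAntidiagonal.antidiagonal i,
      cochains M S ab.1.1 ⊗[k] cochains N S ab.1.2) :
    comparisonInverse hM hN hs i (tensorComparison M N S i t).1 = t := by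
  refine LinearMap.congr_fun (f := comparisonInverse hM hN hs i ∘ₗ (fullTensor M N S i).subtype ∘ₗ
    tensorComparison M N S i) (g := LinearMap.id)
    (DirectSum.linearMap_ext k fun ab => TensorProduct.ext' fun x y => ?_) t
  change comparisonInverse hM hN hs i (tensorComparison M N S i (DirectSum.lof k _
    (fun ab : Finset.HasAntidiagonal.antidiagonal i =>
      cochains M S ab.1.1 ⊗[k] cochains N S ab.1.2) ab (x ⊗ₜ[k] y))).1 = _
  rw [tensorComparison_lof, comparisonInverse_apply]
  simp only [tensorFamily_apply, LinearEquiv.symm_apply_apply, TensorProduct.map_tmul]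
  rw [Finset.sum_eq_single ab]
  · rw [extendCochain_apply, extendCochain_apply]
    rfl
  · intro ab' _ hne
    by_cases ha : ab.1.1 = ab'.1.1
    · have hb : ab.1.2 ≠ ab'.1.2 := fun hb => hne (Subtype.ext (Prod.ext ha.symm hb.symm))
      rw [extendCochain_of_ne hN hs hb, TensorProduct.tmul_zero, map_zero]
    · rw [extendCochain_of_ne hM hs ha, TensorProduct.zero_tmul, map_zero]
  · exact fun h => absurd (Finset.mem_univ _) h

end Comparison
end QuasiComm
end

noncomputable section

namespace QuasiComm

/-! ### Bijectivity of the comparison map. -/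

section ComparisonBijective

open scoped DirectSum

section Swap

variable {k : Type u} [CommRing k] {V V' W W' A A' B B' : Type*} [AddCommGroup V] [AddCommGroup V']
  [AddCommGroup W] [AddCommGroup W'] [AddCommGroup A] [AddCommGroup A'] [AddCommGroup B]
  [AddCommGroup B'] [Module k V] [Module k V'] [Module k W] [Module k W'] [Module k A] [Module k A']
  [Module k B] [Module k B']

theorem tensorTensorTensorComm_symm_map (f : V →ₗ[k] V') (g : W →ₗ[k] W') (a : A →ₗ[k] A')
    (b : B →ₗ[k] B') (z : (V ⊗[k] W) ⊗[k] (A ⊗[k] B)) :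
    (TensorProduct.tensorTensorTensorComm k V' A' W' B').symm
      (TensorProduct.map (TensorProduct.map f g) (TensorProduct.map a b) z) =
      TensorProduct.map (TensorProduct.map f a) (TensorProduct.map g b)
        ((TensorProduct.tensorTensorTensorComm k V A W B).symm z) := by
  rw [LinearEquiv.symm_apply_eq, ← map_tensorTensorTensorComm, LinearEquiv.apply_symm_apply]

end Swap

variable {k : Type u} [CommRing k]

theorem IsCompatible.isCompatibleFamily_left {C : CosMod.{u, v} k} {D : CosMod.{u, w} k}
    {x : ∀ p q, (C.obj p ⊗[k] D.obj q) ⊗[k] BiForm k p q} (hx : IsCompatible C D x) (q : ℕ) :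
    IsCompatibleFamily C (D.obj q ⊗[k] Form k q) fun p =>
      (TensorProduct.tensorTensorTensorComm k (C.obj p) (Form k p) (D.obj q) (Form k q)).symm
        (x p q) := fun p p' u => by
  have e := congrArg (TensorProduct.tensorTensorTensorComm k _ (Form k p) _ (Form k q)).symm
    (hx.left q u)
  have h1 := tensorTensorTensorComm_symm_map (C.push u) (LinearMap.id (R := k) (M := D.obj q))
    (LinearMap.id (R := k) (M := Form k p)) (LinearMap.id (R := k) (M := Form k q)) (x p q)
  have h2 := tensorTensorTensorComm_symm_map (LinearMap.id (R := k) (M := C.obj p'))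
    (LinearMap.id (R := k) (M := D.obj q)) (formPull k u)
    (LinearMap.id (R := k) (M := Form k q)) (x p' q)
  rw [TensorProduct.map_id, TensorProduct.map_id] at h1 h2
  exact h1.symm.trans (e.trans h2)

theorem IsCompatible.isCompatibleFamily_right {C : CosMod.{u, v} k} {D : CosMod.{u, w} k}
    {x : ∀ p q, (C.obj p ⊗[k] D.obj q) ⊗[k] BiForm k p q} (hx : IsCompatible C D x) (p : ℕ) :
    IsCompatibleFamily D (C.obj p ⊗[k] Form k p) fun q => TensorProduct.comm k _ _
      ((TensorProduct.tensorTensorTensorComm k (C.obj p) (Form k p) (D.obj q) (Form k q)).symm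
        (x p q)) := fun q q' u => by
  have e := congrArg (TensorProduct.tensorTensorTensorComm k _ (Form k p) _ (Form k q)).symm
    (hx.right p u)
  have h1 := tensorTensorTensorComm_symm_map (LinearMap.id (R := k) (M := C.obj p)) (D.push u)
    (LinearMap.id (R := k) (M := Form k p)) (LinearMap.id (R := k) (M := Form k q)) (x p q)
  have h2 := tensorTensorTensorComm_symm_map (LinearMap.id (R := k) (M := C.obj p))
    (LinearMap.id (R := k) (M := D.obj q')) (LinearMap.id (R := k) (M := Form k p)) (formPull k u)
    (x p q')
  rw [TensorProduct.map_id, TensorProduct.map_id] at h1 h2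
  have h := congrArg (TensorProduct.comm k _ _) (h1.symm.trans (e.trans h2))
  rw [← TensorProduct.map_comm, ← TensorProduct.map_comm] at h
  exact h

/-- A compatible family on a product is determined by its component in `(m, n)`. -/
theorem IsCompatible.map_extend_eq {C : CosMod.{u, v} k} {D : CosMod.{u, w} k}
    {x : ∀ p q, (C.obj p ⊗[k] D.obj q) ⊗[k] BiForm k p q} (hx : IsCompatible C D x) (s : ℤ)
    {m n : ℕ} (hC : C.IsTruncated m) (hD : D.IsTruncated n) (p q : ℕ) :
    TensorProduct.map (extend C s m (m + 1) p) (extend D s n (n + 1) q)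
      ((TensorProduct.tensorTensorTensorComm k (C.obj m) (Form k m) (D.obj n) (Form k n)).symm
        (x m n)) =
      (TensorProduct.tensorTensorTensorComm k (C.obj p) (Form k p) (D.obj q) (Form k q)).symm
        (x p q) := by
  have h1 := (hx.isCompatibleFamily_left n).extend_eq s hC p
  have h2 := (hx.isCompatibleFamily_right p).extend_eq s hD q
  -- The first variable is reconstructed with the second kept at `n` as coefficients, then the
  -- second one with the first already at `p`.
  rw [← LinearMap.lTensor_comp_rTensor, LinearMap.comp_apply, h1]
  refine (TensorProduct.comm k _ _).injective (Eq.trans ?_ h2)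
  exact (TensorProduct.map_comm _ _ _).symm

variable {M : CategoryTheory.CosimplicialObject (ModuleCat.{v} k)}
  {N : CategoryTheory.CosimplicialObject (ModuleCat.{w} k)} {m n : ℕ} {S : Set ℤ} {s : ℤ}

theorem sum_formPart_tmul {i p q : ℕ} {w : Word p} {w' : Word q} (hw : w.support ⊆ S)
    (hw' : w'.support ⊆ S) (h : w.degree + w'.degree = i) :
    ∑ ab : Finset.HasAntidiagonal.antidiagonal i, formPart k S ab.1.1 p (formOf k w) ⊗ₜ[k]
      formPart k S ab.1.2 q (formOf k w') = formOf k w ⊗ₜ[k] formOf k w' := by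
  have e := biDeg_tmul (k := k) i w w'
  rw [if_pos h, biDeg, LinearMap.sum_apply, ← Finset.sum_coe_sort] at e
  refine Eq.trans (Finset.sum_congr rfl fun ab _ => ?_) e
  rw [formPart_formOf _ hw, formPart_formOf _ hw', TensorProduct.map_tmul, wordProj_formOf,
    wordProj_formOf]
  congr

/-- A form of total degree `i` is the sum of its bihomogeneous parts, and the restriction to
supports in `S` loses nothing. -/
theorem sum_formPart (hM : DimensionLE M m) (hN : DimensionLE N n) {i : ℕ} {x : BiFamily M N}
    (hx : x ∈ fullTensor M N S i) (p q : ℕ) :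
    ∑ ab : Finset.HasAntidiagonal.antidiagonal i,
      TensorProduct.map ((formPart k S ab.1.1 p).lTensor (level M p))
        ((formPart k S ab.1.2 q).lTensor (level N q))
        ((TensorProduct.tensorTensorTensorComm k (level M p) (Form k p) (level N q)
          (Form k q)).symm (x p q)) =
      (TensorProduct.tensorTensorTensorComm k (level M p) (Form k p) (level N q)
        (Form k q)).symm (x p q) := by
  obtain ⟨T, hT, hx⟩ := mem_fullTensor.1 hx
  have h1 : biFormsIn k T i p q ≤ LinearMap.eqLocus (∑ ab : Finset.HasAntidiagonal.antidiagonal i,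
      TensorProduct.map (formPart k S ab.1.1 p) (formPart k S ab.1.2 q)) LinearMap.id := by
    refine Submodule.span_le.2 ?_
    rintro _ ⟨w, w', hw, hw', h, rfl⟩
    rw [SetLike.mem_coe, LinearMap.mem_eqLocus, LinearMap.sum_apply]
    simp only [TensorProduct.map_tmul]
    exact sum_formPart_tmul (hw.trans hT) (hw'.trans hT) h
  have h2 : coeffs (level M p ⊗[k] level N q) (biFormsIn k T i p q) ≤ LinearMap.eqLocus
      ((∑ ab : Finset.HasAntidiagonal.antidiagonal i,
        TensorProduct.map (formPart k S ab.1.1 p) (formPart k S ab.1.2 q)).lTensor _)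
      LinearMap.id := coeffs_le fun c f hf => by
    have := h1 hf
    rw [LinearMap.mem_eqLocus] at this ⊢
    rw [LinearMap.lTensor_tmul, this]
    rfl
  have h3 := h2 (((mem_biCoproduct hM hN).1 hx).1 p q)
  rw [LinearMap.mem_eqLocus, LinearMap.id_apply] at h3
  have e := congrArg (TensorProduct.tensorTensorTensorComm k _ (Form k p) _ (Form k q)).symm h3
  refine Eq.trans ?_ e
  change _ = (TensorProduct.tensorTensorTensorComm k _ (Form k p) _ (Form k q)).symm
    (LinearMap.lTensorHom (level M p ⊗[k] level N q) _ (x p q))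
  rw [map_sum, LinearMap.sum_apply, map_sum]
  refine Finset.sum_congr rfl fun ab _ => ?_
  have h4 := tensorTensorTensorComm_symm_map (LinearMap.id (R := k) (M := level M p))
    (LinearMap.id (R := k) (M := level N q)) (formPart k S ab.1.1 p) (formPart k S ab.1.2 q) (x p q)
  rw [TensorProduct.map_id] at h4
  exact h4.symm

theorem tensorComparison_lof_apply {i : ℕ} (ab : Finset.HasAntidiagonal.antidiagonal i)
    (t : cochains M S ab.1.1 ⊗[k] cochains N S ab.1.2) (p q : ℕ) :
    (tensorComparison M N S i (DirectSum.lof k _ (fun ab : Finset.HasAntidiagonal.antidiagonal i =>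
      cochains M S ab.1.1 ⊗[k] cochains N S ab.1.2) ab t)).1 p q =
      TensorProduct.tensorTensorTensorComm k (level M p) (Form k p) (level N q) (Form k q)
        (TensorProduct.map ((LinearMap.proj p : Family M →ₗ[k] _) ∘ₗ (cochains M S ab.1.1).subtype)
          ((LinearMap.proj q : Family N →ₗ[k] _) ∘ₗ (cochains N S ab.1.2).subtype) t) := by
  induction t with
  | zero => simp
  | add t t' ht ht' =>
    rw [map_add, map_add, map_add, map_add, ← ht, ← ht']
    rfl
  | tmul x y =>
    rw [tensorComparison_lof]
    rfl

theorem tensorComparison_comparisonInverse (hM : DimensionLE M m) (hN : DimensionLE N n)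
    (hs : s ∈ S) (i : ℕ) (x : fullTensor M N S i) :
    tensorComparison M N S i (comparisonInverse hM hN hs i x.1) = x := by
  obtain ⟨T, -, hT⟩ := mem_fullTensor.1 x.2
  refine Subtype.ext (funext fun p => funext fun q => ?_)
  let ev : fullTensor M N S i →ₗ[k] (level M p ⊗[k] level N q) ⊗[k] BiForm k p q :=
    (LinearMap.proj q) ∘ₗ (LinearMap.proj p) ∘ₗ (fullTensor M N S i).subtype
  change ev (tensorComparison M N S i (comparisonInverse hM hN hs i x.1)) = x.1 p q
  rw [comparisonInverse_apply, map_sum, map_sum]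
  refine (TensorProduct.tensorTensorTensorComm k _ (Form k p) _ (Form k q)).symm.injective ?_
  have e1 := ((mem_biCoproduct hM hN).1 hT).2.map_extend_eq s (isTruncated_of_dimensionLE hM)
    (isTruncated_of_dimensionLE hN) p q
  have e2 := congrArg (TensorProduct.map (extend (cosMod M) s m (m + 1) p)
    (extend (cosMod N) s n (n + 1) q)) (sum_formPart hM hN x.2 m n)
  refine Eq.trans ?_ (e2.trans e1)
  rw [map_sum]
  rw [map_sum]
  refine Finset.sum_congr rfl fun ab _ => ?_
  rw [LinearEquiv.symm_apply_eq]
  refine (tensorComparison_lof_apply ab _ p q).trans (congrArg _ ?_)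
  rw [← LinearMap.comp_apply, ← LinearMap.comp_apply, ← TensorProduct.map_comp,
    ← TensorProduct.map_comp]
  rfl

/-- The canonical map from the tensor product of the complexes of cochains is bijective. -/
theorem bijective_tensorComparison (hM : DimensionLE M m) (hN : DimensionLE N n)
    (hS : S.Nonempty) (i : ℕ) : Function.Bijective (tensorComparison M N S i) := by
  obtain ⟨s, hs⟩ := hS
  exact Function.bijective_iff_has_inverse.2 ⟨fun x => comparisonInverse hM hN hs i x.1,
    comparisonInverse_tensorComparison hM hN hs i, tensorComparison_comparisonInverse hM hN hs i⟩

end ComparisonBijective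
end QuasiComm
end

theorem mainTheorem6 {k : Type u} [CommRing k] (hk : QuasiComm.IsCoherent k) (m n : ℕ)
    (S : Set ℤ) (hS : ((m + n + 4 : ℕ) : ℕ∞) < S.encard) :
    (∀ (M : CategoryTheory.CosimplicialObject (ModuleCat.{v} k))
        (N : CategoryTheory.CosimplicialObject (ModuleCat.{w} k)),
      QuasiComm.IsFlat M → QuasiComm.IsFlat N →
      QuasiComm.DimensionLE M m → QuasiComm.DimensionLE N n →
        (∀ i : ℕ, Function.Bijective (QuasiComm.tensorComparison M N S i)) ∧
        QuasiIso (QuasiComm.reducedInclusion M N S)) ∧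
    (∀ (X : SSet.{v}) (Y : SSet.{w}), X.HasDimensionLE m → Y.HasDimensionLE n →
      QuasiIso (QuasiComm.reducedInclusion
        (QuasiComm.simplicialCochains k X) (QuasiComm.simplicialCochains k Y) S) ∧
      QuasiIso (QuasiComm.reducedExtension
        (QuasiComm.simplicialCochains k X) (QuasiComm.simplicialCochains k Y)
        (Set.subset_univ S)) ∧
      QuasiIso (QuasiComm.reducedInclusion
        (QuasiComm.simplicialCochains k X) (QuasiComm.simplicialCochains k Y) Set.univ)) := by
  -- The zigzag starting in bidegree `(r, s)` needs `r + s + 1 < card T`, and `r ≤ m`, `s ≤ n`.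
  have hS' : ((m + n + 1 : ℕ) : ℕ∞) < S.encard := lt_of_le_of_lt (by gcongr; omega) hS
  have hne : S.Nonempty := Set.encard_pos.1 (lt_of_le_of_lt zero_le hS)
  refine ⟨fun M N _ _ hM hN => ⟨QuasiComm.bijective_tensorComparison hM hN hne,
    QuasiComm.quasiIso_reducedInclusion hM hN hS'⟩, fun X Y hX hY => ?_⟩
  have hM := QuasiComm.dimensionLE_simplicialCochains (k := k) hX
  have hN := QuasiComm.dimensionLE_simplicialCochains (k := k) hY
  exact ⟨QuasiComm.quasiIso_reducedInclusion hM hN hS',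
    QuasiComm.quasiIso_reducedExtension hM hN hS' (Set.subset_univ S),
    QuasiComm.quasiIso_reducedInclusion hM hN
      (hS'.trans_le (Set.encard_le_encard (Set.subset_univ S)))⟩
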